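/- **The lattice.** Let $dP_3$ be the planar graph obtained by superimposing the regular hexagonal lattice on its dual triangular lattice. Its white vertices are the centres of the hexagons (degree 6) and the corners of the hexagons (degree 3); its black vertices are the midpoints of the sides of the hexagons (degree 4). Long edges (length $1$) join the centre of a hexagon to the midpoints of its sides; short edges (length $\sqrt3/3$) join a corner to the midpoints of the sides meeting there. Every hexagon has a corner directly north of its centre. All faces are 4-cycles, called squares; each contains one centre and one corner of the same hexagon, and its orientation (N, NE, SE, S, SW or NW) is the direction of that corner from that centre. **The diamonds.** A North $D_1$ consists of the N and NW squares of a hexagon and the SE square that shares with them the black vertex common to both; a South $D_1$ is a North $D_1$ rotated by $180^\circ$. $D_1'$ denotes a $D_1$ reflected in the vertical axis. Along each horizontal strip (the region between two consecutive rows of hexagon centres) N and S squares alternate, successive ones being one step (half the distance of adjacent centres) apart, and each of them belongs to one $D_1$ and to one $D_1'$ as its N or S square. * Integer order $n\ge 0$: let $T(0,0)$ be a $D_1$, North if $n$ is odd and South if $n$ is even. For $j\ge0$ let $T(i,j)$ be the $D_1$ in the strip $j$ steps north of that of $T(0,0)$ whose N or S square lies $i$ steps east of that of $T(0,0)$; for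 $j<0$, the $D_1$ in the strip $|j|$ steps south whose N or S square lies $i-1$ steps east of that of $T(0,0)$. Then $D_n=\bigcup_{|i|+|j|<n}T(i,j)$ (union of vertex and edge sets; $D_0$ is empty). * Half-integer order, $n\ge1$: let $T(0,0)$ be a $D_1'$, North if $n$ is even and South if $n$ is odd, and let $T(i,j)$ be the $D_1'$ in the strip $j$ steps north whose N or S square lies $i$ steps east of that of $T(0,0)$ (for all $i,j\in\mathbb Z$). Then $$D_{n+\frac12}=\bigcup_{|i|+|j|<n}T(i,j)\ \cup\bigcup_{\substack{0<j\le n\\ |i|<n+1-j}}T(i,j)\ \cup L_n\cup R_n ,$$ where $R_n$ is the SW square of $T(n+1,0)$ and $L_n$ is the SE square in the same strip that shares an edge with the N square of $T(n,0)$ and lies west of it. $D_{\frac12}$ is a single NE square. **Heights and tiles.** Orient each dual edge so that the black end of the lattice edge it crosses is on its left; put $H(e)=1$ if the arrow $e$ crosses a long edge and $H(e)=2$ if it crosses a short edge. Let $G$ be one of the diamonds. A square of the lattice is a square of $G$ if its four edges belong to $G$. Fix a square $o$ of the lattice that is not a square of $G$ but has a vertex in $G$ (any $o$ if $G$ is empty).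 The height function $h_M$ of a perfect matching $M$ of $G$ is defined on the squares of the lattice having a vertex in $G$ by $h_M(o)=0$ and $$h_M(y)=h_M(x)+H(e)-\begin{cases}6&\text{if the lattice edge crossed by } e \text{ is in } M\\0&\text{otherwise}\end{cases}$$ for every arrow $e:x\to y$ crossing a lattice edge with an endpoint in $G$. The number of tiles (upward plaquette flips) over a square $q$ of $G$ needed to build $M$ from the minimal height function is $t_M(q)=\frac16\bigl(h_M(q)-\min_{M'}h_{M'}(q)\bigr)$, the minimum being over all perfect matchings $M'$ of $G$. Let $$Z_G(a,b,c)=\sum_{M}a^{A(M)}b^{B(M)}c^{C(M)}\in\mathbb Z[a,b,c],$$ where $M$ runs over the perfect matchings of $G$, and $A(M),B(M),C(M)$ are the sums of $t_M(q)$ over the squares $q$ of $G$ of orientation NE or SW, N or S, NW or SE, respectively. Write $Z_m=Z_{D_m}$. **Theorem.** For every integer $n\ge0$ (and every choice of $o$), $$Z_n(a,b,c)=\prod_{i=0}^{n-1}\left(1+a^ib^ic^{i+1}\right)^{n-i}\left(1+a^ib^{i+1}c^{i+1}\right)^{n-i},$$ $$Z_{n+\frac12}(a,b,c)=\prod_{i=0}^{n}\left(1+a^{i+1}b^ic^i\right)^{n-i+1}\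 \prod_{i=0}^{n-1}\left(1+a^{i+1}b^{i+1}c^i\right)^{n-i}.$$ -/

import Mathlib

namespace DP3

/-! ## The `dP₃` lattice

The plane is given the basis `u = (1, 0)`, `v = (1/2, √3/2)`, and the integer pair `(x, y)` stands
for the point `(x u + y v) / 3`.  The hexagon with index `A = (i, j)` is centred at `2 i u + 2 j v`,
that is, at the coordinates `(6 i, 6 j)`; a corner of it lies directly north of its centre. -/

/-- The unit vectors at the angles `0°, 60°, 120°, 180°, 240°, 300°`, in the basis `u, v`.  The
hexagons adjacent to the hexagon `A` are `A + dir k`. -/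
def dir (k : ZMod 6) : ℤ × ℤ :=
  (![(1, 0), (0, 1), (-1, 1), (-1, 0), (0, -1), (1, -1)] : Fin 6 → ℤ × ℤ) k

/-- The centre of the hexagon `A` (a white vertex of degree six). -/
def center (A : ℤ × ℤ) : ℤ × ℤ := (6 : ℤ) • A

/-- The midpoint of the side of the hexagon `A` in direction `60° k` (a black vertex, of degree
four). -/
def mid (A : ℤ × ℤ) (k : ZMod 6) : ℤ × ℤ := (6 : ℤ) • A + (3 : ℤ) • dir k

/-- The corner of the hexagon `A` in direction `60° k + 30°` (a white vertex of degree three). -/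
def corner (A : ℤ × ℤ) (k : ZMod 6) : ℤ × ℤ := (6 : ℤ) • A + (2 : ℤ) • (dir k + dir (k + 1))

/-- The long edge from the centre of `A` to the midpoint of its `k`-th side. -/
def longEdge (A : ℤ × ℤ) (k : ZMod 6) : Sym2 (ℤ × ℤ) := s(center A, mid A k)

/-- The short edge from the `k`-th corner of `A` to the midpoint of its `k`-th side.  (The other
half of a side of `A` is the short edge of this form for the neighbouring hexagon.) -/
def shortEdge (A : ℤ × ℤ) (k : ZMod 6) : Sym2 (ℤ × ℤ) := s(corner A k, mid A k)

/-- The hexagonal lattice superimposed on its dual triangular lattice.  (Integer pairs that are not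
the coordinates of a lattice vertex are isolated, and belong to none of the subgraphs below.) -/
def dP3 : SimpleGraph (ℤ × ℤ) :=
  SimpleGraph.fromEdgeSet {e | ∃ A k, e = longEdge A k ∨ e = shortEdge A k}

/-- A square (face) of the lattice: the pair `(A, k)` is the square bounded by the centre of the
hexagon `A`, its `k`-th corner, and the midpoints of the two sides that meet in this corner. -/
abbrev Square : Type := (ℤ × ℤ) × ZMod 6

/-- The orientation north-east. -/
abbrev NE : ZMod 6 := 0
/-- The orientation north. -/
abbrev N : ZMod 6 := 1
/-- The orientation north-west. -/
abbrev NW : ZMod 6 := 2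
/-- The orientation south-west. -/
abbrev SW : ZMod 6 := 3
/-- The orientation south. -/
abbrev S : ZMod 6 := 4
/-- The orientation south-east. -/
abbrev SE : ZMod 6 := 5

/-- The four vertices of a square. -/
def squareVerts (q : Square) : Set (ℤ × ℤ) :=
  {center q.1, mid q.1 q.2, corner q.1 q.2, mid q.1 (q.2 + 1)}

/-- A square, as a subgraph (a 4-cycle) of the lattice. -/
def square (q : Square) : dP3.Subgraph := (⊤ : dP3.Subgraph).induce (squareVerts q)

/-! ## The diamonds -/

/-- The North `D₁` whose N square belongs to the hexagon `A`: a N square together with a NW and a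
SE square, all sharing the black vertex `mid A 2`. -/
def northD1 (A : ℤ × ℤ) : dP3.Subgraph :=
  square (A, N) ⊔ square (A, NW) ⊔ square (A + dir 2, SE)

/-- The South `D₁` whose S square belongs to `A`: a North `D₁` rotated by 180 degrees. -/
def southD1 (A : ℤ × ℤ) : dP3.Subgraph :=
  square (A, S) ⊔ square (A, SE) ⊔ square (A + dir 5, NW)

/-- The North `D₁'`: the reflection of a North `D₁` in the vertical axis. -/
def northD1' (A : ℤ × ℤ) : dP3.Subgraph :=
  square (A, N) ⊔ square (A, NE) ⊔ square (A + dir 1, SW)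

/-- The South `D₁'`: a North `D₁'` rotated by 180 degrees. -/
def southD1' (A : ℤ × ℤ) : dP3.Subgraph :=
  square (A, S) ⊔ square (A, SW) ⊔ square (A + dir 4, NE)

/-- The `D₁` in the `j`-th horizontal strip (the one between the `j`-th and the `(j+1)`-st row of
hexagons) whose N or S square lies on the vertical line with abscissa `x`.  N squares and S squares
alternate along a strip, so `D₁`s that are one step apart in it have opposite orientations. -/
def stripD1 (x j : ℤ) : dP3.Subgraph :=
  if Even (x - j) then northD1 ((x - j) / 2, j) else southD1 ((x - j) / 2, j + 1)

/-- The same with `D₁'` in place of `D₁`. -/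
def stripD1' (x j : ℤ) : dP3.Subgraph :=
  if Even (x - j) then northD1' ((x - j) / 2, j) else southD1' ((x - j) / 2, j + 1)

/-- The tile `T(i, j)` of the diamond of order `n`, `i` steps east and `j` steps north of `T(0, 0)`,
which is a North `D₁` if `n` is odd and a South `D₁` if `n` is even.  The strips being offset by
half a hexagon against each other, the column `i = 0` of the strips south of the central one is
the one that makes the two end tiles of these strips South `D₁`s, while the end tiles of the
central strip and of the strips north of it are North `D₁`s. -/
def tile (n : ℕ) (i j : ℤ) : dP3.Subgraph :=
  stripD1 (n + 1 + i - if j < 0 then 1 else 0) j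

/-- The diamond of integer order `n`. -/
def diamond (n : ℕ) : dP3.Subgraph :=
  ⨆ (i : ℤ) (j : ℤ) (_ : |i| + |j| < n), tile n i j

/-- The tile `T(i, j)` of the diamond of order `n + 1/2`; `T(0, 0)` is a North `D₁'` if `n` is even
and a South `D₁'` if `n` is odd. -/
def halfTile (n : ℕ) (i j : ℤ) : dP3.Subgraph := stripD1' (n + i) j

/-- The square `L_n`: the SE square to the west of the N square of `T(n, 0)`. -/
def leftSquare (n : ℕ) : dP3.Subgraph := square (((n : ℤ) - 1, 1), SE)

/-- The square `R_n`: the SW square of `T(n + 1, 0)`. -/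
def rightSquare (n : ℕ) : dP3.Subgraph := square (((n : ℤ), 1), SW)

/-- The diamond of half-integer order `n + 1/2`. -/
def halfDiamond : ℕ → dP3.Subgraph
  | 0 => square ((0, 0), NE)
  | n + 1 =>
      (⨆ (i : ℤ) (j : ℤ) (_ : |i| + |j| < (n + 1 : ℕ)), halfTile (n + 1) i j) ⊔
      (⨆ (i : ℤ) (j : ℤ) (_ : 0 < j ∧ j ≤ (n + 1 : ℕ) ∧ |i| < (n + 1 : ℕ) + 1 - j),
        halfTile (n + 1) i j) ⊔
      leftSquare (n + 1) ⊔ rightSquare (n + 1)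

/-- The perfect matchings of a subgraph of the lattice. -/
def PerfectMatching (G : dP3.Subgraph) : Type :=
  {M : dP3.Subgraph // M ≤ G ∧ M.IsMatching ∧ M.verts = G.verts}

/-! ## Height functions -/

/-- The arrows of the dual quiver of the lattice; there is one arrow for each edge of the
lattice. -/
inductive Arrow : Type
  | long (A : ℤ × ℤ) (k : ZMod 6)
  | short (A : ℤ × ℤ) (k : ZMod 6)

namespace Arrow

/-- The lattice edge that is crossed by an arrow. -/
def edge : Arrow → Sym2 (ℤ × ℤ)
  | long A k => longEdge A k
  | short A k => shortEdge A k

/-- The square in which an arrow starts. Arrows have the black vertex of the edge they cross on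
their left. -/
def source : Arrow → Square
  | long A k => (A, k)
  | short A k => (A + dir k, k + 2)

/-- The square in which an arrow ends. -/
def target : Arrow → Square
  | long A k => (A, k - 1)
  | short A k => (A, k)

/-- The height change of an arrow. -/
def heightChange : Arrow → ℤ
  | long _ _ => 1
  | short _ _ => 2

end Arrow

open Classical in
/-- `h` is the height function of the perfect matching `M` of `G`, normalised to be `0` at the
square `o`.  The heights are defined on the squares of `G` and on those lattice squares around `G`
that border it: the rule is imposed along every arrow that crosses a lattice edge with an endpoint
in `G`.  Elsewhere the values of `h` are irrelevant. -/
def IsHeightFunction (G : dP3.Subgraph) (M : PerfectMatching G) (o : Square) (h : Square → ℤ) :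
    Prop :=
  h o = 0 ∧ ∀ e : Arrow, (∃ v ∈ e.edge, v ∈ G.verts) →
    h e.target = h e.source + e.heightChange - if e.edge ∈ M.1.edgeSet then 6 else 0

/-- The height function of the perfect matching `M` of `G`, normalised at `o`. -/
noncomputable def height (G : dP3.Subgraph) (M : PerfectMatching G) (o : Square) : Square → ℤ :=
  Classical.epsilon (IsHeightFunction G M o)

/-- The minimal height function of `G`: the pointwise minimum over all perfect matchings. -/
noncomputable def minHeight (G : dP3.Subgraph) (o q : Square) : ℤ :=
  ⨅ M : PerfectMatching G, height G M o q

/-- The number of tiles above the square `q` in the pile of tiles for `M`, each tile (upward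
plaquette flip) raising the height by `6`, starting at the minimal height function. -/
noncomputable def numTiles (G : dP3.Subgraph) (M : PerfectMatching G) (o q : Square) : ℕ :=
  ((height G M o q - minHeight G o q) / 6).toNat

/-- The number of tiles of orientation `k` or of the opposite orientation `k + 3`, in the pile for
the perfect matching `M` of `G`. -/
noncomputable def tileCount (G : dP3.Subgraph) (M : PerfectMatching G) (o : Square) (k : ZMod 6) :
    ℕ :=
  ∑ᶠ q ∈ {q : Square | square q ≤ G ∧ (q.2 = k ∨ q.2 = k + 3)}, numTiles G M o q

/-- The square `o` lies outside of `G` and borders it (the latter unless `G` is empty). -/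
def IsOuterFace (G : dP3.Subgraph) (o : Square) : Prop :=
  ¬ square o ≤ G ∧ (G.verts.Nonempty → (squareVerts o ∩ G.verts).Nonempty)

/-- The generating function of the perfect matchings of `G`.  The variables `a = X 0`, `b = X 1`,
`c = X 2` count the tiles with the pairs of orientations NE/SW, N/S, NW/SE respectively. -/
noncomputable def genFun (G : dP3.Subgraph) (o : Square) : MvPolynomial (Fin 3) ℤ :=
  ∑ᶠ M : PerfectMatching G,
    MvPolynomial.X 0 ^ tileCount G M o NE * MvPolynomial.X 1 ^ tileCount G M o N *
      MvPolynomial.X 2 ^ tileCount G M o NW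

end DP3

/-!
The tile counts of the perfect matchings of a diamond are turned into edge weights, and the
weighted matchings are counted by domino shuffling.

*From tiles to edge weights.*  Let `U` be the vertex set of a diamond.  Give the edges of the
lattice monomial weights such that, for every square, the product of the weights of the two edges
crossed by the arrows leaving it, divided by the product of those of the two edges crossed by the
arrows entering it, is the variable of the orientation of the square (`exists_squareCond`).  Two
perfect matchings of `U` differ by the boundary of a function with finite support on the squares
(`exists_potential`): its value at a square is the difference of the signed numbers of edges of the
two matchings that a horizontal ray ending in the square crosses, and this works since the flux of
a matching of `U` through a closed curve depends only on the vertices of `U` inside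
(`crossing_sub`, `IsPM.flux_eq`).  This function is one sixth of the difference of the two heights.
As the minimum of two height functions is the height function of a matching, some matching lies
below all the others (`GoodRegion.exists_minimal`), so the function that compares a matching `M`
with it is the tile count of `M`.  Summing the weights of the squares against this function gives
the quotient of the weights of the two matchings (`sum_eq_add_finsum`).  Hence the generating
function is the weighted sum over all matchings, up to a Laurent monomial
(`matchingSum_eq_genFun`).

*Shuffling.*  The NW and SE squares are taken as cells, and the local move (urban renewal) is
applied to all of them simultaneously: in every cell, the part of the matching is replaced by the
complementary one (`matchingSum_shuffle`).  If the weights of the NW and SE, the N and S, and the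
NE and SW squares are `x, y, z`, the new ones are `xy, xz, 1/x` (`FaceCond.shuffle`).  The new
graph is again the lattice. The diamond of order `m / 2` becomes, apart from edges that are forced
to be in every matching, the diamond of order `(m - 1) / 2`, and the factor split off is `(1 + x) ^
⌈m / 2⌉` times a monomial (`matchingSum_region_step`).  The product in the claim obeys the same
recursion (`dragonProd_succ`), so it agrees with the matching sum up to a Laurent monomial
(`matchingSum_region`).

*Conclusion.*  Generating function and product are polynomials with a non-zero constant term that
differ by a Laurent monomial factor, and therefore are equal (`eq_of_eq_laurent_mul`).  It remains
to identify the diamonds, defined as unions of squares, with the induced subgraphs on the regions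
to which the shuffling applies.  For half-integer order this takes a reflection, which exchanges
two of the variables and reverses all arrows; the reversal inverts the weights of the squares, so
that the product changes only by a monomial (`dragonProd_inv`).
-/

namespace DP3

/-! ### Weighted matching sums of finite regions of a graph -/

open Classical in
/-- The number of ends of an edge with the pair of ends `p` that are equal to `v`. -/
noncomputable def inc {V : Type*} (p : V × V) (v : V) : ℕ :=
  (if p.1 = v then 1 else 0) + (if p.2 = v then 1 else 0)

open Classical in
/-- `M` is a perfect matching of the subgraph induced on the set `U` of vertices, in the graph whose
edge `e` has the ends `ends e`: each vertex in `U` is covered once, every other vertex is not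
covered. -/
def IsPM {E V : Type*} (ends : E → V × V) (U : Set V) (M : Finset E) : Prop :=
  ∀ v, ∑ e ∈ M, inc (ends e) v = if v ∈ U then 1 else 0

/-- The sum of the weights of the perfect matchings of the subgraph induced on `U`. -/
noncomputable def matchingSum {E V R : Type*} [CommSemiring R] (ends : E → V × V) (U : Set V)
    (w : E → R) : R :=
  ∑ᶠ (M : Finset E) (_ : IsPM ends U M), ∏ e ∈ M, w e

section Matching

variable {E V R : Type*} {ends : E → V × V} {U : Set V} {M : Finset E}

lemma inc_pos {p : V × V} {v : V} (h : p.1 = v ∨ p.2 = v) : 0 < inc p v := by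
  unfold inc; rcases h with h | h <;> simp [h]

lemma inc_eq_zero {p : V × V} {v : V} : inc p v = 0 ↔ p.1 ≠ v ∧ p.2 ≠ v := by
  unfold inc; split_ifs <;> simp_all

lemma inc_swap (p : V × V) (v : V) : inc p.swap v = inc p v := by
  unfold inc; exact add_comm _ _

lemma inc_map {V' : Type*} {f : V → V'} (hf : Function.Injective f) (p : V × V) (v : V) :
    inc (Prod.map f f p) (f v) = inc p v := by
  classical
  unfold inc
  exact congrArg₂ _ (if_congr hf.eq_iff rfl rfl) (if_congr hf.eq_iff rfl rfl)

lemma IsPM.mem_of_inc (h : IsPM ends U M) {e : E} (he : e ∈ M) {v : V}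
    (hv : (ends e).1 = v ∨ (ends e).2 = v) : v ∈ U := by
  by_contra hU
  have h1 := h v
  rw [if_neg hU, Finset.sum_eq_zero_iff] at h1
  exact (inc_pos hv).ne' (h1 e he)

lemma IsPM.exists_inc (h : IsPM ends U M) {v : V} (hv : v ∈ U) :
    ∃ e ∈ M, (ends e).1 = v ∨ (ends e).2 = v := by
  have h1 := h v
  rw [if_pos hv] at h1
  obtain ⟨e, he, h2⟩ := Finset.exists_ne_zero_of_sum_ne_zero (h1.trans_ne one_ne_zero)
  refine ⟨e, he, ?_⟩
  by_contra h3
  exact h2 (inc_eq_zero.2 (not_or.1 h3))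

lemma IsPM.eq_of_inc (h : IsPM ends U M) {v : V} {e e' : E} (he : e ∈ M) (he' : e' ∈ M)
    (hv : (ends e).1 = v ∨ (ends e).2 = v) (hv' : (ends e').1 = v ∨ (ends e').2 = v) : e = e' := by
  classical
  by_contra hne
  have h1 : ∑ e ∈ M, inc (ends e) v ≤ 1 := (h v).trans_le (by split_ifs <;> simp)
  have h2 : ∑ x ∈ {e, e'}, inc (ends x) v ≤ ∑ e ∈ M, inc (ends e) v :=
    Finset.sum_le_sum_of_subset (by intro x; simp only [Finset.mem_insert, Finset.mem_singleton]
                                    rintro (rfl | rfl) <;> assumption)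
  rw [Finset.sum_pair hne] at h2
  have := inc_pos hv
  have := inc_pos hv'
  omega

/-- The matching sum of the empty region is the weight of the empty matching. -/
lemma matchingSum_empty [CommSemiring R] (w : E → R) : matchingSum ends ∅ w = 1 := by
  classical
  unfold matchingSum
  rw [finsum_eq_single _ ∅]
  · rw [finsum_eq_if, if_pos]
    · simp
    · intro v; simp
  · intro M hM
    obtain ⟨e, he⟩ := Finset.nonempty_iff_ne_empty.2 hM
    rw [finsum_eq_if, if_neg]
    intro h
    exact h.mem_of_inc he (Or.inl rfl)

/-- An isomorphism `φE` on edges that is compatible with an injection `φV` of the vertices may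
exchange the two ends of an edge: only the pair of ends matters. -/
lemma isPM_map {E' V' : Type*} {ends' : E' → V' × V'} (φE : E ≃ E') {φV : V → V'}
    (hφ : Function.Injective φV)
    (h : ∀ e, ends' (φE e) = Prod.map φV φV (ends e) ∨
      ends' (φE e) = (Prod.map φV φV (ends e)).swap) :
    IsPM ends' (φV '' U) (M.map φE.toEmbedding) ↔ IsPM ends U M := by
  classical
  have h1 : ∀ e v, inc (ends' (φE e)) v = inc (Prod.map φV φV (ends e)) v := by
    intro e v
    rcases h e with h | h <;> rw [h]
    rw [inc_swap]
  unfold IsPM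
  simp only [Finset.sum_map, Equiv.coe_toEmbedding, h1]
  constructor
  · intro H v
    have := H (φV v)
    simp only [inc_map hφ] at this
    rw [this]
    exact if_congr hφ.mem_set_image rfl rfl
  · intro H v'
    by_cases hv : v' ∈ Set.range φV
    · obtain ⟨v, rfl⟩ := hv
      simp only [inc_map hφ]
      rw [H v]
      exact if_congr hφ.mem_set_image.symm rfl rfl
    · rw [if_neg (fun h ↦ hv (Set.image_subset_range _ _ h)), Finset.sum_eq_zero_iff]
      intro e _
      rw [inc_eq_zero]
      exact ⟨fun h ↦ hv ⟨_, h⟩, fun h ↦ hv ⟨_, h⟩⟩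

/-- Matching sums are invariant under isomorphisms of graphs; vertices without edges may be
ignored. -/
lemma matchingSum_map [CommSemiring R] {E' V' : Type*} {ends' : E' → V' × V'} (φE : E ≃ E')
    {φV : V → V'} (hφ : Function.Injective φV)
    (h : ∀ e, ends' (φE e) = Prod.map φV φV (ends e) ∨
      ends' (φE e) = (Prod.map φV φV (ends e)).swap) (w : E' → R) :
    matchingSum ends' (φV '' U) w = matchingSum ends U (fun e ↦ w (φE e)) := by
  unfold matchingSum
  symm
  refine finsum_eq_of_bijective (fun M ↦ M.map φE.toEmbedding) ?_ ?_
  · exact (Equiv.finsetCongr φE).bijective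
  · intro M
    simp only [Finset.prod_map, Equiv.coe_toEmbedding]
    simp only [isPM_map φE hφ h]

/-- Multiplying the weights of the edges by a function of their ends. -/
lemma matchingSum_gauge [CommSemiring R] [NoZeroDivisors R] (U : Finset V) (w : E → R) (g : V → R) :
    matchingSum ends U (fun e ↦ w e * (g (ends e).1 * g (ends e).2)) =
      (∏ v ∈ U, g v) * matchingSum ends U w := by
  classical
  unfold matchingSum
  rw [mul_finsum]
  refine finsum_congr fun M ↦ ?_
  simp only [finsum_eq_if]
  split_ifs with hM
  · rw [Finset.prod_mul_distrib, mul_comm]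
    congr 1
    have h1 : ∀ e ∈ M, g (ends e).1 * g (ends e).2 = ∏ v ∈ U, g v ^ inc (ends e) v := by
      intro e he
      have h2 := hM.mem_of_inc he (Or.inl rfl)
      have h3 := hM.mem_of_inc he (Or.inr rfl)
      simp only [inc, pow_add, Finset.prod_mul_distrib, pow_ite, pow_one, pow_zero]
      rw [Finset.prod_ite_eq, Finset.prod_ite_eq, if_pos (by simpa using h2),
        if_pos (by simpa using h3)]
    rw [Finset.prod_congr rfl h1, Finset.prod_comm]
    refine Finset.prod_congr rfl fun v hv ↦ ?_
    rw [Finset.prod_pow_eq_pow_sum, hM v, if_pos (by simpa using hv), pow_one]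
  · simp

open Classical in
/-- If the edges of `F` belong to every perfect matching of `U`, they may be removed together with
their ends. -/
lemma matchingSum_forced [CommSemiring R] [NoZeroDivisors R] {U' : Set V} (F : Finset E) (w : E → R)
    (hF : ∀ M, IsPM ends U M → F ⊆ M)
    (hU : ∀ v, (if v ∈ U then 1 else 0) = ∑ e ∈ F, inc (ends e) v + if v ∈ U' then 1 else 0) :
    matchingSum ends U w = (∏ e ∈ F, w e) * matchingSum ends U' w := by
  have key : ∀ M, Disjoint F M → (IsPM ends U (F ∪ M) ↔ IsPM ends U' M) := by
    intro M hM
    unfold IsPM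
    refine forall_congr' fun v ↦ ?_
    rw [Finset.sum_union hM, hU v]
    omega
  have disj : ∀ M, IsPM ends U' M → Disjoint F M := by
    intro M hM
    rw [Finset.disjoint_left]
    intro e he heM
    have h1 := hM.mem_of_inc heM (Or.inl rfl)
    have h2 := hU (ends e).1
    rw [if_pos h1] at h2
    have h3 : inc (ends e) (ends e).1 ≤ ∑ e' ∈ F, inc (ends e') (ends e).1 :=
      Finset.single_le_sum (f := fun e' ↦ inc (ends e') (ends e).1) (fun _ _ ↦ Nat.zero_le _) he
    have h4 : 0 < inc (ends e) (ends e).1 := inc_pos (Or.inl rfl)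
    split_ifs at h2; omega
  unfold matchingSum
  rw [mul_finsum]
  symm
  have : ∀ M, (∏ e ∈ F, w e) * (∑ᶠ (_ : IsPM ends U' M), ∏ e ∈ M, w e) =
      ∑ᶠ (_ : M ∈ {M | IsPM ends U' M}), ∏ e ∈ F ∪ M, w e := by
    intro M
    simp only [finsum_eq_if, Set.mem_ofPred_eq]
    split_ifs with h
    · rw [Finset.prod_union (disj M h)]
    · simp
  simp only [this]
  refine finsum_mem_eq_of_bijOn (t := {M | IsPM ends U M}) (fun M ↦ F ∪ M) ⟨?_, ?_, ?_⟩ ?_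
  · intro M hM
    exact (key M (disj M hM)).2 hM
  · intro M hM M' hM' h
    have h1 := Finset.union_sdiff_cancel_left (disj M hM)
    have h2 := Finset.union_sdiff_cancel_left (disj M' hM')
    simp only at h
    rw [← h1, ← h2, h]
  · intro M hM
    refine ⟨M \ F, ?_, Finset.union_sdiff_of_subset (hF M hM)⟩
    rw [Set.mem_ofPred_eq, ← key _ Finset.disjoint_sdiff, Finset.union_sdiff_of_subset (hF M hM)]
    exact hM
  · intro M _; rfl

end Matching

/-! ### Graphs made of 4-cycles, and the shuffling identity -/

/-- A bipartite graph made of 4-cycles, the *cells*, and of further edges.  The cell `c` has a `hub`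
in `P`, a tip of its own, and two opposite corners in `Q`, numbered by `Bool`, that join the hub to
the tip.  The tip of `c` is joined by a further edge to the *spoke* of `c` in `D`, and there are
edges between `P` and `D`, indexed by `Y`. -/
structure CellGraph (C Q P D Y : Type*) where
  /-- The hub of a cell. -/
  hub : C → P
  /-- The vertex joined to the tip of a cell from outside. -/
  spoke : C → D
  /-- The corners of a cell. -/
  corner : Bool → C → Q
  /-- The end in `P` of an additional edge. -/
  yHub : Y → P
  /-- The end in `D` of an additional edge. -/
  ySpoke : Y → D

/-- The vertices of a `CellGraph`; `t c` is the tip of the cell `c`. -/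
inductive Vert (C Q P D : Type*)
  | t (c : C)
  | q (x : Q)
  | p (x : P)
  | d (x : D)

/-- The edges of a `CellGraph`: for each cell `c` the edge `(c, none)` from its tip to its spoke,
the edges `(c, some (false, r))` from the hub to the `r`-th corner and `(c, some (true, r))` from
the tip to the `r`-th corner, and the additional edges. -/
abbrev CEdge (C Y : Type*) : Type _ := C × Option (Bool × Bool) ⊕ Y

namespace CellGraph

variable {C Q P D Y R : Type*} (G : CellGraph C Q P D Y)

/-- The ends of the edges of a `CellGraph`. -/
def ends : CEdge C Y → Vert C Q P D × Vert C Q P D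
  | Sum.inl (c, none) => (.t c, .d (G.spoke c))
  | Sum.inl (c, some (false, r)) => (.p (G.hub c), .q (G.corner r c))
  | Sum.inl (c, some (true, r)) => (.t c, .q (G.corner r c))
  | Sum.inr y => (.p (G.yHub y), .d (G.ySpoke y))

/-- The dual of a `CellGraph` exchanges the hubs with the spokes. -/
def dual : CellGraph C Q D P Y where
  hub := G.spoke
  spoke := G.hub
  corner := G.corner
  yHub := G.ySpoke
  ySpoke := G.yHub

end CellGraph

/-- The possible traces of a matching on a cell: no edge, the edge from the hub (`s = false`) or
from the tip (`s = true`) to the `r`-th corner, and the two perfect matchings, in which the `r`-th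
corner is matched with the hub. -/
inductive Loc
  | empty
  | single (s r : Bool)
  | double (r : Bool)
  deriving DecidableEq, Fintype

/-- Traces of a matching on a cell, without the distinction between the two perfect matchings. -/
inductive Coarse
  | empty
  | single (s r : Bool)
  | full
  deriving DecidableEq, Fintype

namespace Loc

/-- The edges in the cell and the edge at its tip; the latter is used if the tip is not covered
inside the cell. -/
def edges : Loc → Finset (Option (Bool × Bool))
  | empty => {none}
  | single false r => {none, some (false, r)}
  | single true r => {some (true, r)}
  | double r => {some (false, r), some (true, !r)}

/-- Forgets which perfect matching of the cell is used. -/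
def coarse : Loc → Coarse
  | empty => .empty
  | single s r => .single s r
  | double _ => .full

lemma edges_injective : Function.Injective edges := by
  intro l l'; revert l l'; decide

/-- A set of edges at a cell in which the tip is covered once and no other vertex is covered twice.
-/
lemma exists_edges (A : Option (Bool × Bool) → Prop)
    (h1 : ∃ o, A o ∧ ∀ r, o ≠ some (false, r))
    (h2 : ∀ s r r', A (some (s, r)) → A (some (s, r')) → r = r')
    (h3 : ∀ r, A none → ¬ A (some (true, r)))
    (h4 : ∀ r, A (some (false, r)) → ¬ A (some (true, r))) :
    ∃ l : Loc, ∀ o, o ∈ l.edges ↔ A o := by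
  have hall : ∀ l : Loc, (∀ o, o ∈ l.edges ↔ A o) ↔
      ((none ∈ l.edges ↔ A none) ∧ ∀ s r, some (s, r) ∈ l.edges ↔ A (some (s, r))) := by
    intro l
    constructor
    · intro h; exact ⟨h _, fun s r ↦ h _⟩
    · rintro ⟨ha, hb⟩ (_ | ⟨s, r⟩)
      · exact ha
      · exact hb s r
  simp only [hall]
  by_cases hn : A none
  · have ht : ∀ r, ¬ A (some (true, r)) := fun r ↦ h3 r hn
    by_cases hf : ∃ r, A (some (false, r))
    · obtain ⟨r, hr⟩ := hf
      have hr' : ¬ A (some (false, !r)) := fun h ↦ by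
        have := h2 _ _ _ hr h; cases r <;> simp at this
      refine ⟨.single false r, ?_⟩
      cases r <;> simp_all [edges]
    · push Not at hf
      exact ⟨.empty, by simp_all [edges]⟩
  · obtain ⟨r, hr⟩ : ∃ r, A (some (true, r)) := by
      obtain ⟨_ | ⟨_ | _, r⟩, ho, hne⟩ := h1
      · exact absurd ho hn
      · exact absurd rfl (hne r)
      · exact ⟨r, ho⟩
    have hr' : ¬ A (some (true, !r)) := fun h ↦ by
        have := h2 _ _ _ hr h; cases r <;> simp at this
    have hf : ¬ A (some (false, r)) := fun h ↦ h4 r h hr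
    by_cases hf' : A (some (false, !r))
    · refine ⟨.double (!r), ?_⟩
      cases r <;> simp_all [edges]
    · refine ⟨.single true r, ?_⟩
      cases r <;> simp_all [edges]

end Loc

namespace Coarse

/-- The number of times the hub is covered inside the cell. -/
def hub : Coarse → ℕ
  | empty => 0
  | single s _ => if s then 0 else 1
  | full => 1

/-- The number of times the spoke is covered by the edge at the tip of the cell. -/
def spoke : Coarse → ℕ
  | empty => 1
  | single s _ => if s then 0 else 1
  | full => 0

/-- The number of times the `r`-th corner is covered inside the cell. -/
def corner (r : Bool) : Coarse → ℕ
  | empty => 0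
  | single _ r' => if r = r' then 1 else 0
  | full => 1

/-- The complementary trace, in which exactly the other vertices are covered, if the names of the
hub and the tip are exchanged. -/
def compl : Coarse → Coarse
  | empty => full
  | single s r => single s (!r)
  | full => empty

lemma compl_involutive : Function.Involutive compl := by
  intro κ; revert κ; decide

lemma hub_compl (κ : Coarse) : κ.compl.hub = κ.spoke := by revert κ; decide
lemma spoke_compl (κ : Coarse) : κ.compl.spoke = κ.hub := by revert κ; decide
lemma corner_compl (r : Bool) (κ : Coarse) : κ.corner r + κ.compl.corner r = 1 := by
  revert κ r; decide

end Coarse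

namespace CellGraph

variable {C Q P D Y R : Type*} (G : CellGraph C Q P D Y)

/-- The set of edges with prescribed traces on the cells in `C₀` and prescribed additional edges. -/
def build (C₀ : Finset C) (l : C₀ → Loc) (y : Finset Y) : Finset (CEdge C Y) :=
  ((Finset.univ.sigma fun c ↦ (l c).edges).map
    ⟨fun x : (_ : C₀) × Option (Bool × Bool) ↦ ((x.1 : C), x.2), by
      rintro ⟨⟨c, hc⟩, o⟩ ⟨⟨c', hc'⟩, o'⟩ h
      simp only [Prod.mk.injEq] at h
      obtain ⟨rfl, rfl⟩ := h
      rfl⟩).disjSum y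

lemma prod_build [CommMonoid R] (C₀ : Finset C) (l : C₀ → Loc) (y : Finset Y)
    (f : CEdge C Y → R) :
    ∏ e ∈ build C₀ l y, f e =
      (∏ c : C₀, ∏ o ∈ (l c).edges, f (Sum.inl (c, o))) * ∏ b ∈ y, f (Sum.inr b) := by
  unfold build
  rw [Finset.prod_disjSum, Finset.prod_map, Finset.prod_sigma]
  rfl

lemma sum_build [AddCommMonoid R] (C₀ : Finset C) (l : C₀ → Loc) (y : Finset Y)
    (f : CEdge C Y → R) :
    ∑ e ∈ build C₀ l y, f e =
      (∑ c : C₀, ∑ o ∈ (l c).edges, f (Sum.inl (c, o))) + ∑ b ∈ y, f (Sum.inr b) := by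
  unfold build
  rw [Finset.sum_disjSum, Finset.sum_map, Finset.sum_sigma]
  rfl

lemma inl_mem_build {C₀ : Finset C} {l : C₀ → Loc} {y : Finset Y} {c : C}
    {o : Option (Bool × Bool)} :
    Sum.inl (c, o) ∈ build C₀ l y ↔ ∃ h : c ∈ C₀, o ∈ (l ⟨c, h⟩).edges := by
  simp only [build, Finset.inl_mem_disjSum, Finset.mem_map, Finset.mem_sigma, Finset.mem_univ,
    true_and]
  constructor
  · rintro ⟨⟨⟨c', hc'⟩, o'⟩, h, h'⟩
    cases h'
    exact ⟨hc', h⟩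
  · rintro ⟨hc, h⟩
    exact ⟨⟨⟨c, hc⟩, o⟩, h, rfl⟩

lemma inr_mem_build {C₀ : Finset C} {l : C₀ → Loc} {y : Finset Y} {b : Y} :
    Sum.inr b ∈ build C₀ l y ↔ b ∈ y := by
  simp [build]

lemma build_injective {C₀ : Finset C} {l l' : C₀ → Loc} {y y' : Finset Y}
    (h : build C₀ l y = build C₀ l' y') : l = l' ∧ y = y' := by
  constructor
  · funext ⟨c, hc⟩
    apply Loc.edges_injective
    ext o
    have h1 : Sum.inl (c, o) ∈ build C₀ l y ↔ Sum.inl (c, o) ∈ build C₀ l' y' := by rw [h]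
    simpa [inl_mem_build, hc] using h1
  · ext b
    rw [← inr_mem_build (l := l), h, inr_mem_build]

open Classical in
/-- The conditions under which given traces on the cells in `C₀` and additional edges form a perfect
matching of `U`. -/
def Coherent (U : Set (Vert C Q P D)) (C₀ : Finset C) (κ : C₀ → Coarse) (y : Finset Y) : Prop :=
  (∀ x, ∑ c : C₀, ((if G.corner false c = x then (κ c).corner false else 0) +
    (if G.corner true c = x then (κ c).corner true else 0)) = if .q x ∈ U then 1 else 0) ∧
  (∀ x, ∑ c : C₀, (if G.hub c = x then (κ c).hub else 0) +
    ∑ b ∈ y, (if G.yHub b = x then 1 else 0) = if .p x ∈ U then 1 else 0) ∧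
  (∀ x, ∑ c : C₀, (if G.spoke c = x then (κ c).spoke else 0) +
    ∑ b ∈ y, (if G.ySpoke b = x then 1 else 0) = if .d x ∈ U then 1 else 0)

lemma isPM_build {U : Set (Vert C Q P D)} {C₀ : Finset C} (hC : ∀ c, .t c ∈ U ↔ c ∈ C₀)
    (l : C₀ → Loc) (y : Finset Y) :
    IsPM G.ends U (build C₀ l y) ↔ G.Coherent U C₀ (fun c ↦ (l c).coarse) y := by
  classical
  have hv : ∀ (P : Vert C Q P D → Prop), (∀ v, P v) ↔ (∀ x, P (.t x)) ∧ (∀ x, P (.q x)) ∧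
      (∀ x, P (.p x)) ∧ ∀ x, P (.d x) := by
    intro P
    constructor
    · intro h; exact ⟨fun _ ↦ h _, fun _ ↦ h _, fun _ ↦ h _, fun _ ↦ h _⟩
    · rintro ⟨h1, h2, h3, h4⟩ (x | x | x | x)
      exacts [h1 x, h2 x, h3 x, h4 x]
  have ht : ∀ x, ∑ e ∈ build C₀ l y, inc (G.ends e) (.t x) = if .t x ∈ U then 1 else 0 := by
    intro x
    rw [sum_build]
    have h1 : ∀ c : C₀, ∑ o ∈ (l c).edges, inc (G.ends (Sum.inl (c, o))) (.t x) =
        if (c : C) = x then 1 else 0 := by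
      intro c
      rcases l c with _ | ⟨_ | _, r⟩ | r <;> simp [Loc.edges, ends, inc]
    have h2 : ∀ b, inc (G.ends (Sum.inr b)) (.t x) = 0 := by
      intro b; simp [ends, inc]
    simp only [h1, h2, Finset.sum_const_zero, add_zero]
    rw [Finset.sum_coe_sort C₀ (fun c ↦ if c = x then 1 else 0), Finset.sum_ite_eq']
    exact if_congr (hC x).symm rfl rfl
  unfold IsPM
  rw [hv]
  rw [and_iff_right ht]
  unfold Coherent
  have hq : ∀ x (c : C₀), ∑ o ∈ (l c).edges, inc (G.ends (Sum.inl (c, o))) (.q x) =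
      (if G.corner false c = x then (l c).coarse.corner false else 0) +
        (if G.corner true c = x then (l c).coarse.corner true else 0) := by
    intro x c
    rcases l c with _ | ⟨_ | _, _ | _⟩ | _ | _ <;>
      simp [Loc.edges, ends, inc, Loc.coarse, Coarse.corner, add_comm]
  have hp : ∀ x (c : C₀), ∑ o ∈ (l c).edges, inc (G.ends (Sum.inl (c, o))) (.p x) =
      (if G.hub c = x then (l c).coarse.hub else 0) := by
    intro x c
    rcases l c with _ | ⟨_ | _, _ | _⟩ | _ | _ <;>
      simp [Loc.edges, ends, inc, Loc.coarse, Coarse.hub]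
  have hd : ∀ x (c : C₀), ∑ o ∈ (l c).edges, inc (G.ends (Sum.inl (c, o))) (.d x) =
      (if G.spoke c = x then (l c).coarse.spoke else 0) := by
    intro x c
    rcases l c with _ | ⟨_ | _, _ | _⟩ | _ | _ <;>
      simp [Loc.edges, ends, inc, Loc.coarse, Coarse.spoke]
  refine and_congr (forall_congr' fun x ↦ ?_) (and_congr (forall_congr' fun x ↦ ?_)
    (forall_congr' fun x ↦ ?_))
  · rw [sum_build]
    simp only [hq]
    simp [ends, inc]
  · rw [sum_build]
    simp only [hp]
    simp [ends, inc]
  · rw [sum_build]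
    simp only [hd]
    simp [ends, inc]

/-- Every perfect matching is described by its traces on the cells and its additional edges. -/
lemma exists_build {U : Set (Vert C Q P D)} {C₀ : Finset C} (hC : ∀ c, .t c ∈ U ↔ c ∈ C₀)
    (hU : ∀ c r, .p (G.hub c) ∈ U → .q (G.corner r c) ∈ U → c ∈ C₀)
    {M : Finset (CEdge C Y)} (hM : IsPM G.ends U M) : ∃ l y, build C₀ l y = M := by
  classical
  have h1 : ∀ c : C₀, ∃ l : Loc, ∀ o, o ∈ l.edges ↔ Sum.inl ((c : C), o) ∈ M := by
    rintro ⟨c, hc⟩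
    apply Loc.exists_edges
    · obtain ⟨e, he, h⟩ := hM.exists_inc ((hC c).2 hc)
      rcases e with ⟨c', _ | ⟨_ | _, r⟩⟩ | b
      · simp only [ends, Vert.t.injEq, reduceCtorEq, or_false] at h
        subst h
        exact ⟨_, he, by simp⟩
      · simp [ends] at h
      · simp only [ends, Vert.t.injEq, reduceCtorEq, or_false] at h
        subst h
        exact ⟨_, he, by simp⟩
      · simp [ends] at h
    · intro s r r' hr hr'
      have h := hM.eq_of_inc (v := (G.ends (Sum.inl (c, some (s, r)))).1) hr hr' (Or.inl rfl)
        (Or.inl (by cases s <;> rfl))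
      simpa using h
    · intro r hr hr'
      have h := hM.eq_of_inc (v := .t c) hr hr' (Or.inl rfl) (Or.inl rfl)
      simp at h
    · intro r hr hr'
      have h := hM.eq_of_inc (v := .q (G.corner r c)) hr hr' (Or.inr rfl) (Or.inr rfl)
      simp at h
  choose l hl using h1
  refine ⟨l, M.toRight, ?_⟩
  ext e
  rcases e with ⟨c, o⟩ | b
  · rw [inl_mem_build]
    constructor
    · rintro ⟨hc, h⟩
      exact (hl _ _).1 h
    · intro h
      have hc : c ∈ C₀ := by
        rcases o with _ | ⟨_ | _, r⟩
        · exact (hC c).1 (hM.mem_of_inc h (Or.inl rfl))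
        · exact hU c r (hM.mem_of_inc h (Or.inl rfl)) (hM.mem_of_inc h (Or.inr rfl))
        · exact (hC c).1 (hM.mem_of_inc h (Or.inl rfl))
      exact ⟨hc, (hl ⟨c, hc⟩ _).2 h⟩
  · rw [inr_mem_build, Finset.mem_toRight]

/-- The total weight of the matchings with given trace at the cell `c`. -/
def cellWeight [CommSemiring R] (w : CEdge C Y → R) (c : C) (κ : Coarse) : R :=
  ∑ l : Loc with l.coarse = κ, ∏ o ∈ l.edges, w (Sum.inl (c, o))

lemma cellWeight_empty [CommSemiring R] (w : CEdge C Y → R) (c : C) :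
    cellWeight w c .empty = w (Sum.inl (c, none)) := by
  have : (Finset.univ.filter fun l : Loc ↦ l.coarse = .empty) = {.empty} := by decide
  simp [cellWeight, this, Loc.edges]

lemma cellWeight_hub [CommSemiring R] (w : CEdge C Y → R) (c : C) (r : Bool) :
    cellWeight w c (.single false r) =
      w (Sum.inl (c, none)) * w (Sum.inl (c, some (false, r))) := by
  have : (Finset.univ.filter fun l : Loc ↦ l.coarse = .single false r) = {.single false r} := by
    revert r; decide
  simp [cellWeight, this, Loc.edges]

lemma cellWeight_tip [CommSemiring R] (w : CEdge C Y → R) (c : C) (r : Bool) :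
    cellWeight w c (.single true r) = w (Sum.inl (c, some (true, r))) := by
  have : (Finset.univ.filter fun l : Loc ↦ l.coarse = .single true r) = {.single true r} := by
    revert r; decide
  simp [cellWeight, this, Loc.edges]

lemma cellWeight_full [CommSemiring R] (w : CEdge C Y → R) (c : C) :
    cellWeight w c .full =
      w (Sum.inl (c, some (false, false))) * w (Sum.inl (c, some (true, true))) +
      w (Sum.inl (c, some (false, true))) * w (Sum.inl (c, some (true, false))) := by
  have : (Finset.univ.filter fun l : Loc ↦ l.coarse = .full) = {.double false, .double true} := by
    decide
  simp [cellWeight, this, Loc.edges]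

open Classical in
/-- The matching sum as a sum over coarse traces: the sum over the two perfect matchings of each
cell has been carried out. -/
lemma matchingSum_eq_coarse [CommSemiring R] {U : Set (Vert C Q P D)} {C₀ : Finset C}
    {Y₀ : Finset Y} (hC : ∀ c, .t c ∈ U ↔ c ∈ C₀)
    (hU : ∀ c r, .p (G.hub c) ∈ U → .q (G.corner r c) ∈ U → c ∈ C₀)
    (hY : ∀ b, .p (G.yHub b) ∈ U → .d (G.ySpoke b) ∈ U → b ∈ Y₀) (w : CEdge C Y → R) :
    matchingSum G.ends U w = ∑ y ∈ Y₀.powerset, ∑ κ : C₀ → Coarse,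
      if G.Coherent U C₀ κ y then
        (∏ c : C₀, cellWeight w c (κ c)) * ∏ b ∈ y, w (Sum.inr b) else 0 := by
  have h1 : matchingSum G.ends U w = ∑ x ∈ (Y₀.powerset ×ˢ (Finset.univ : Finset (C₀ → Loc))).filter
      (fun x ↦ G.Coherent U C₀ (fun c ↦ (x.2 c).coarse) x.1),
        ((∏ c : C₀, ∏ o ∈ (x.2 c).edges, w (Sum.inl ((c : C), o))) *
          ∏ b ∈ x.1, w (Sum.inr b)) := by
    rw [← finsum_mem_coe_finset]
    symm
    unfold matchingSum
    refine finsum_mem_eq_of_bijOn (t := {M | IsPM G.ends U M}) (fun x ↦ build C₀ x.2 x.1)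
      ⟨?_, ?_, ?_⟩ ?_
    · rintro ⟨y, l⟩ h
      simp only [Finset.coe_filter, Finset.mem_product, Finset.mem_univ] at h
      exact (G.isPM_build hC l y).2 h.2
    · rintro ⟨y, l⟩ - ⟨y', l'⟩ - h
      obtain ⟨h1, h2⟩ := build_injective h
      exact Prod.ext h2 h1
    · intro M hM
      obtain ⟨l, y, rfl⟩ := G.exists_build hC hU hM
      refine ⟨(y, l), ?_, rfl⟩
      simp only [Finset.coe_filter, Finset.mem_product, Finset.mem_univ, and_true,
        Finset.mem_powerset, Set.mem_ofPred_eq]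
      refine ⟨?_, (G.isPM_build hC l y).1 hM⟩
      intro b hb
      have hb' := inr_mem_build (l := l).2 hb
      exact hY b (IsPM.mem_of_inc hM hb' (Or.inl rfl)) (IsPM.mem_of_inc hM hb' (Or.inr rfl))
    · intro x _
      rw [prod_build]
  rw [h1, Finset.sum_filter, Finset.sum_product]
  refine Finset.sum_congr rfl fun y _ ↦ ?_
  have h2 : ∀ κ : C₀ → Coarse, (∏ c : C₀, cellWeight w c (κ c)) =
      ∑ l : C₀ → Loc with (fun c ↦ (l c).coarse) = κ,
        ∏ c : C₀, ∏ o ∈ (l c).edges, w (Sum.inl ((c : C), o)) := by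
    intro κ
    unfold cellWeight
    rw [Finset.prod_univ_sum]
    refine Finset.sum_congr ?_ fun _ _ ↦ rfl
    ext l
    simp [Fintype.mem_piFinset, funext_iff]
  rw [← Finset.sum_fiberwise Finset.univ (fun l : C₀ → Loc ↦ fun c ↦ (l c).coarse)]
  refine Finset.sum_congr rfl fun κ _ ↦ ?_
  rw [h2 κ]
  split_ifs with hκ
  · rw [Finset.sum_mul]
    refine Finset.sum_congr rfl fun l hl ↦ ?_
    rw [Finset.mem_filter] at hl
    rw [if_pos (by rw [hl.2]; exact hκ)]
  · refine Finset.sum_eq_zero fun l hl ↦ ?_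
    rw [Finset.mem_filter] at hl
    rw [if_neg (by rw [hl.2]; exact hκ)]

/-- The weights after shuffling. -/
def shuffleWeight [Field R] (w : CEdge C Y → R) (Δ : C → R) : CEdge C Y → R
  | Sum.inl (_, none) => 1
  | Sum.inl (c, some (false, r)) =>
      w (Sum.inl (c, some (false, !r))) * w (Sum.inl (c, none)) / Δ c
  | Sum.inl (c, some (true, r)) => w (Sum.inl (c, some (true, !r))) / Δ c
  | Sum.inr y => w (Sum.inr y)

open Classical in
/-- Domino shuffling.  In each cell, a coarse trace of a matching of `U` is replaced by its
complement, which gives the coarse traces of the matchings of a region `U'` of the dual graph. -/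
theorem matchingSum_shuffle [Field R] {U : Set (Vert C Q P D)} {U' : Set (Vert C Q D P)}
    {C₀ : Finset C} {Y₀ : Finset Y}
    (hC : ∀ c, .t c ∈ U ↔ c ∈ C₀) (hC' : ∀ c, .t c ∈ U' ↔ c ∈ C₀)
    (hP : ∀ x, .p x ∈ U ↔ .d x ∈ U') (hD : ∀ x, .d x ∈ U ↔ .p x ∈ U')
    (hU : ∀ c r, .p (G.hub c) ∈ U → .q (G.corner r c) ∈ U → c ∈ C₀)
    (hU' : ∀ c r, .d (G.spoke c) ∈ U → .q (G.corner r c) ∈ U' → c ∈ C₀)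
    (hQ : ∀ x, ∑ c ∈ C₀, ((if G.corner false c = x then 1 else 0) +
      (if G.corner true c = x then 1 else 0)) =
        (if .q x ∈ U then 1 else 0) + (if .q x ∈ U' then 1 else 0))
    (hY : ∀ b, .p (G.yHub b) ∈ U → .d (G.ySpoke b) ∈ U → b ∈ Y₀) (w : CEdge C Y → R) (Δ : C → R)
    (hΔ : ∀ c, Δ c = w (Sum.inl (c, some (false, false))) * w (Sum.inl (c, some (true, true))) +
      w (Sum.inl (c, some (false, true))) * w (Sum.inl (c, some (true, false))))
    (hΔ0 : ∀ c, Δ c ≠ 0) :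
    matchingSum G.ends U w =
      (∏ c ∈ C₀, Δ c) * matchingSum G.dual.ends U' (shuffleWeight w Δ) := by
  rw [G.matchingSum_eq_coarse hC hU hY, G.dual.matchingSum_eq_coarse (Y₀ := Y₀) hC'
    (fun c r h1 h2 ↦ hU' c r ((hD _).2 h1) h2) (fun b h1 h2 ↦ hY b ((hP _).2 h2) ((hD _).2 h1)),
    Finset.mul_sum]
  refine Finset.sum_congr rfl fun y _ ↦ ?_
  rw [Finset.mul_sum]
  refine Fintype.sum_equiv (Equiv.arrowCongr (Equiv.refl _)
    (Function.Involutive.toPerm _ Coarse.compl_involutive)) _ _ fun κ ↦ ?_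
  have hκ : ∀ c, (Equiv.arrowCongr (Equiv.refl _)
    (Function.Involutive.toPerm _ Coarse.compl_involutive)) κ c = (κ c).compl := fun c ↦ rfl
  have hcoh : G.Coherent U C₀ κ y ↔ G.dual.Coherent U' C₀ (fun c ↦ (κ c).compl) y := by
    unfold Coherent
    rw [and_comm (b := ∀ x, _ + _ = if .d x ∈ U' then _ else _)]
    refine and_congr (forall_congr' fun x ↦ ?_) (and_congr (forall_congr' fun x ↦ ?_)
      (forall_congr' fun x ↦ ?_))
    · have h1 : ∑ c : C₀, ((if G.corner false c = x then (κ c).corner false else 0) +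
            (if G.corner true c = x then (κ c).corner true else 0)) +
          ∑ c : C₀, ((if G.dual.corner false c = x then (κ c).compl.corner false else 0) +
            (if G.dual.corner true c = x then (κ c).compl.corner true else 0)) =
          (if .q x ∈ U then 1 else 0) + (if .q x ∈ U' then 1 else 0) := by
        rw [← hQ x, ← Finset.sum_add_distrib, ← Finset.sum_coe_sort C₀]
        refine Finset.sum_congr rfl fun c _ ↦ ?_
        have h2 := Coarse.corner_compl false (κ c)
        have h3 := Coarse.corner_compl true (κ c)
        change (_ + _) + ((if G.corner false c = x then _ else _) +
          (if G.corner true c = x then _ else _)) = _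
        split_ifs <;> omega
      beta_reduce
      constructor <;> intro h2 <;> omega
    · simp only [Coarse.spoke_compl, dual, hP x]
      congr!
    · simp only [Coarse.hub_compl, dual, hD x]
      congr!
  have hfun : (Equiv.arrowCongr (Equiv.refl _)
    (Function.Involutive.toPerm _ Coarse.compl_involutive)) κ = fun c ↦ (κ c).compl := rfl
  rw [hfun]
  simp only [hcoh]
  split_ifs
  · rw [← mul_assoc, ← Finset.prod_coe_sort C₀, ← Finset.prod_mul_distrib]
    congr 1
    refine Finset.prod_congr rfl fun c _ ↦ ?_
    have h0 := hΔ0 c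
    have hc := hΔ c
    rcases κ c with _ | ⟨_ | _, r⟩ | _
    · simp only [Coarse.compl, cellWeight_empty, cellWeight_full, shuffleWeight, Bool.not_false,
        Bool.not_true]
      field_simp
      rw [hc]; ring
    · simp only [Coarse.compl, cellWeight_hub, shuffleWeight, Bool.not_not]
      field_simp
    · simp only [Coarse.compl, cellWeight_tip, shuffleWeight, Bool.not_not]
      field_simp
    · simp only [Coarse.compl, cellWeight_empty, cellWeight_full, shuffleWeight, mul_one]
      rw [hc]
  · simp

end CellGraph

/-- The vertices of a `CellGraph` form a disjoint sum of the four classes. -/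
def vertEmbedding (C Q P D : Type*) : (C ⊕ Q) ⊕ (P ⊕ D) ↪ Vert C Q P D where
  toFun := Sum.elim (Sum.elim .t .q) (Sum.elim .p .d)
  inj' := by rintro ((x | x) | (x | x)) ((y | y) | (y | y)) h <;> simp_all

/-- The finite set of vertices with prescribed parts in the four classes. -/
def vertFinset {C Q P D : Type*} (C₀ : Finset C) (Q₀ : Finset Q) (P₀ : Finset P) (D₀ : Finset D) :
    Finset (Vert C Q P D) :=
  ((C₀.disjSum Q₀).disjSum (P₀.disjSum D₀)).map (vertEmbedding C Q P D)

section vertFinset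

variable {C Q P D R : Type*} {C₀ : Finset C} {Q₀ : Finset Q} {P₀ : Finset P} {D₀ : Finset D}

lemma vertEmbedding_apply (x : (C ⊕ Q) ⊕ (P ⊕ D)) :
    vertEmbedding C Q P D x = Sum.elim (Sum.elim .t .q) (Sum.elim .p .d) x := rfl

@[simp] lemma t_mem_vertFinset {x : C} : .t x ∈ vertFinset C₀ Q₀ P₀ D₀ ↔ x ∈ C₀ := by
  simp [vertFinset, vertEmbedding_apply]

@[simp] lemma q_mem_vertFinset {x : Q} : .q x ∈ vertFinset C₀ Q₀ P₀ D₀ ↔ x ∈ Q₀ := by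
  simp [vertFinset, vertEmbedding_apply]

@[simp] lemma p_mem_vertFinset {x : P} : .p x ∈ vertFinset C₀ Q₀ P₀ D₀ ↔ x ∈ P₀ := by
  simp [vertFinset, vertEmbedding_apply]

@[simp] lemma d_mem_vertFinset {x : D} : .d x ∈ vertFinset C₀ Q₀ P₀ D₀ ↔ x ∈ D₀ := by
  simp [vertFinset, vertEmbedding_apply]

lemma prod_vertFinset [CommMonoid R] (f : Vert C Q P D → R) :
    ∏ v ∈ vertFinset C₀ Q₀ P₀ D₀, f v =
      (∏ x ∈ C₀, f (.t x)) * (∏ x ∈ Q₀, f (.q x)) *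
        ((∏ x ∈ P₀, f (.p x)) * ∏ x ∈ D₀, f (.d x)) := by
  simp [vertFinset, Finset.prod_map, Finset.prod_disjSum, vertEmbedding_apply]

end vertFinset

lemma addChar_sum {ι R Γ : Type*} [CommMonoid R] [AddCommGroup Γ] (χ : AddChar Γ R) (s : Finset ι)
    (f : ι → Γ) : χ (∑ i ∈ s, f i) = ∏ i ∈ s, χ (f i) := by
  classical
  induction s using Finset.induction_on with
  | empty => simp
  | insert a s ha ih => rw [Finset.sum_insert ha, Finset.prod_insert ha, χ.map_add_eq_mul, ih]

lemma addChar_ne_zero {R Γ : Type*} [Field R] [AddCommGroup Γ] (χ : AddChar Γ R) (γ : Γ) :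
    χ γ ≠ 0 := fun h ↦ by
  have := χ.map_add_eq_mul γ (-γ)
  rw [h, add_neg_cancel, χ.map_zero_eq_one, zero_mul] at this
  exact one_ne_zero this

namespace CellGraph

variable {C Q P D Y R Γ : Type*} (G : CellGraph C Q P D Y)

/-- The exponents of monomial weights after shuffling, up to a power of the constant `1 + x`, where
`x` is the ratio of the two perfect matchings of a cell. -/
def shuffleExp [AddCommGroup Γ] (w : CEdge C Y → Γ) : CEdge C Y → Γ
  | Sum.inl (_, none) => 0
  | Sum.inl (c, some (false, r)) => w (Sum.inl (c, some (false, !r))) + w (Sum.inl (c, none)) -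
      (w (Sum.inl (c, some (false, true))) + w (Sum.inl (c, some (true, false))))
  | Sum.inl (c, some (true, r)) => w (Sum.inl (c, some (true, !r))) -
      (w (Sum.inl (c, some (false, true))) + w (Sum.inl (c, some (true, false))))
  | Sum.inr y => w (Sum.inr y)

open Classical in
/-- Domino shuffling for monomial weights with the same face weight `χ x` at all cells. -/
theorem matchingSum_shuffle_monomial [Field R] [AddCommGroup Γ] (χ : AddChar Γ R)
    {C₀ : Finset C} {Q₀ Q₁ : Finset Q} {P₀ : Finset P} {D₀ : Finset D} {Y₀ : Finset Y}
    (hU : ∀ c r, G.hub c ∈ P₀ → G.corner r c ∈ Q₀ → c ∈ C₀)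
    (hU' : ∀ c r, G.spoke c ∈ D₀ → G.corner r c ∈ Q₁ → c ∈ C₀)
    (hQ : ∀ x, ∑ c ∈ C₀, ((if G.corner false c = x then 1 else 0) +
      (if G.corner true c = x then 1 else 0)) =
        (if x ∈ Q₀ then 1 else 0) + (if x ∈ Q₁ then 1 else 0))
    (hY : ∀ b, G.yHub b ∈ P₀ → G.ySpoke b ∈ D₀ → b ∈ Y₀) (w : CEdge C Y → Γ) (x : Γ)
    (hx : 1 + χ x ≠ 0)
    (hw : ∀ c, w (Sum.inl (c, some (false, false))) + w (Sum.inl (c, some (true, true))) =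
      x + (w (Sum.inl (c, some (false, true))) + w (Sum.inl (c, some (true, false))))) :
    ∃ μ, matchingSum G.ends (vertFinset C₀ Q₀ P₀ D₀) (fun e ↦ χ (w e)) * (1 + χ x) ^ D₀.card =
      χ μ * (1 + χ x) ^ P₀.card *
        matchingSum G.dual.ends (vertFinset C₀ Q₁ D₀ P₀) (fun e ↦ χ (shuffleExp w e)) := by
  set μ : C → Γ := fun c ↦ w (Sum.inl (c, some (false, true))) + w (Sum.inl (c, some (true, false)))
    with hμ
  set κ := 1 + χ x with hκ
  refine ⟨∑ c ∈ C₀, μ c, ?_⟩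
  have h1 := G.matchingSum_shuffle (U := vertFinset C₀ Q₀ P₀ D₀) (U' := vertFinset C₀ Q₁ D₀ P₀)
    (C₀ := C₀) (Y₀ := Y₀) (by simp) (by simp) (by simp) (by simp) (by simpa using hU)
    (by simpa using hU') (by simpa using hQ) (by simpa using hY) (fun e ↦ χ (w e))
    (fun c ↦ χ (μ c) * κ) (fun c ↦ by
      rw [← χ.map_add_eq_mul, ← χ.map_add_eq_mul, hw c, χ.map_add_eq_mul x]
      rw [hκ, hμ]; ring) (fun c ↦ mul_ne_zero (addChar_ne_zero χ _) hx)
  -- the factor `1 + χ x` in the weights of the cell edges is removed by a gauge transformation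
  set g : Vert C Q D P → R := fun v ↦ match v with
    | .t _ => κ⁻¹
    | .q _ => 1
    | .p _ => κ⁻¹
    | .d _ => κ
    with hg
  have h2 : (shuffleWeight (fun e ↦ χ (w e)) fun c ↦ χ (μ c) * κ) =
      fun e ↦ χ (shuffleExp w e) * (g (G.dual.ends e).1 * g (G.dual.ends e).2) := by
    funext e
    rcases e with ⟨c, _ | ⟨_ | _, r⟩⟩ | b
    · simp [shuffleWeight, shuffleExp, g, ends, hx]
    · simp only [shuffleWeight, shuffleExp, g, ends, mul_one, AddChar.map_sub_eq_div,
        AddChar.map_add_eq_mul, hμ, div_eq_mul_inv, mul_inv]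
      ring
    · simp only [shuffleWeight, shuffleExp, g, ends, mul_one, AddChar.map_sub_eq_div,
        AddChar.map_add_eq_mul, hμ, div_eq_mul_inv, mul_inv]
      ring
    · simp [shuffleWeight, shuffleExp, g, ends, hx]
  rw [h1, h2, matchingSum_gauge, prod_vertFinset, addChar_sum, Finset.prod_mul_distrib]
  simp only [hg, Finset.prod_const, one_pow, inv_pow]
  field_simp

end CellGraph

/-! ### The lattice as a graph made of 4-cycles -/

/-- The lattice, with the NW squares (`false`) and the SE squares (`true`) as cells.  A vertex `p A`
is the centre of the hexagon `A`, and `d A`, `q (false, A)`, `q (true, A)` are the midpoints of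
its sides in the directions 60°, 120° and 0°. -/
def lat : CellGraph (Bool × ℤ × ℤ) (Bool × ℤ × ℤ) (ℤ × ℤ) (ℤ × ℤ) (Bool × ℤ × ℤ) where
  hub c := c.2
  spoke c := if c.1 then (c.2.1 + 1, c.2.2 - 1) else (c.2.1 - 1, c.2.2)
  corner r c :=
    if r then (if c.1 then (true, c.2) else (true, c.2.1 - 1, c.2.2))
    else (if c.1 then (false, c.2.1 + 1, c.2.2 - 1) else (false, c.2))
  yHub b := if b.1 then (b.2.1, b.2.2 + 1) else b.2
  ySpoke b := b.2

/-- The vertices of the lattice. -/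
abbrev LVert : Type := Vert (Bool × ℤ × ℤ) (Bool × ℤ × ℤ) (ℤ × ℤ) (ℤ × ℤ)

/-- The edges of the lattice. -/
abbrev LEdge : Type := CEdge (Bool × ℤ × ℤ) (Bool × ℤ × ℤ)

/-- A box that contains the regions with the parameters `p` and `r`. -/
noncomputable def box (p r : ℤ) : Finset (ℤ × ℤ) :=
  Finset.Icc (-p - r) (p + r) ×ˢ Finset.Icc (-p - r) (p + r)

/-- The tips in the region with parameters `p` and `r`. -/
noncomputable def regT (p r : ℤ) : Finset (Bool × ℤ × ℤ) :=
  (Finset.univ ×ˢ box p r).filter fun c ↦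
    if c.1 then (c.2.2 ≤ 0 ∧ c.2.1 ≤ p - 1 ∧ 1 ≤ c.2.1 + c.2.2) ∨
      (1 ≤ c.2.2 ∧ 0 ≤ c.2.1 ∧ c.2.1 + c.2.2 ≤ r)
    else (c.2.2 ≤ 0 ∧ c.2.1 ≤ p ∧ 1 ≤ c.2.1 + c.2.2) ∨
      (1 ≤ c.2.2 ∧ 1 ≤ c.2.1 ∧ c.2.1 + c.2.2 ≤ r)

/-- The corners of cells in the region with parameters `p` and `r`. -/
noncomputable def regQ (p r : ℤ) : Finset (Bool × ℤ × ℤ) :=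
  (Finset.univ ×ˢ box p r).filter fun c ↦
    if c.1 then (c.2.2 ≤ 0 ∧ c.2.1 ≤ p - 1 ∧ 0 ≤ c.2.1 + c.2.2) ∨
      (1 ≤ c.2.2 ∧ 0 ≤ c.2.1 ∧ c.2.1 + c.2.2 ≤ r)
    else (c.2.2 ≤ 0 ∧ c.2.1 ≤ p ∧ 1 ≤ c.2.1 + c.2.2) ∨
      (1 ≤ c.2.2 ∧ 1 ≤ c.2.1 ∧ c.2.1 + c.2.2 ≤ r)

/-- The hubs in the region with parameters `p` and `r`. -/
noncomputable def regP (p r : ℤ) : Finset (ℤ × ℤ) :=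
  (box p r).filter fun A ↦ (A.2 ≤ 0 ∧ A.1 ≤ p ∧ 1 ≤ A.1 + A.2) ∨
    (1 ≤ A.2 ∧ 0 ≤ A.1 ∧ A.1 + A.2 ≤ r)

/-- The spokes in the region with parameters `p` and `r`. -/
noncomputable def regD (p r : ℤ) : Finset (ℤ × ℤ) :=
  (box p r).filter fun A ↦ (A.2 < 0 ∧ A.1 ≤ p - 1 ∧ 0 ≤ A.1 + A.2) ∨
    (0 ≤ A.2 ∧ 1 ≤ A.1 ∧ A.1 + A.2 ≤ r)

/-- The region with the parameters `p = ⌈m / 2⌉` and `r = ⌊m / 2⌋` is, up to a symmetry of the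
lattice, the diamond of order `m / 2`.  It consists of two triangles, one above the other. -/
noncomputable def region (p r : ℤ) : Finset LVert :=
  vertFinset (regT p r) (regQ p r) (regP p r) (regD p r)

section mem

variable {p r x y : ℤ}

lemma mem_regT_false (hp : 0 ≤ p) (hr : 0 ≤ r) : (false, x, y) ∈ regT p r ↔
    (y ≤ 0 ∧ x ≤ p ∧ 1 ≤ x + y) ∨ (1 ≤ y ∧ 1 ≤ x ∧ x + y ≤ r) := by
  simp only [regT, box, Finset.mem_filter, Finset.mem_product, Finset.mem_univ, Finset.mem_Icc,
    Bool.false_eq_true, if_false, true_and]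
  omega

lemma mem_regT_true (hp : 0 ≤ p) (hr : 0 ≤ r) : (true, x, y) ∈ regT p r ↔
    (y ≤ 0 ∧ x ≤ p - 1 ∧ 1 ≤ x + y) ∨ (1 ≤ y ∧ 0 ≤ x ∧ x + y ≤ r) := by
  simp only [regT, box, Finset.mem_filter, Finset.mem_product, Finset.mem_univ, Finset.mem_Icc,
    if_true, true_and]
  omega

lemma mem_regQ_false (hp : 0 ≤ p) (hr : 0 ≤ r) : (false, x, y) ∈ regQ p r ↔
    (y ≤ 0 ∧ x ≤ p ∧ 1 ≤ x + y) ∨ (1 ≤ y ∧ 1 ≤ x ∧ x + y ≤ r) := by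
  simp only [regQ, box, Finset.mem_filter, Finset.mem_product, Finset.mem_univ, Finset.mem_Icc,
    Bool.false_eq_true, if_false, true_and]
  omega

lemma mem_regQ_true (hp : 0 ≤ p) (hr : 0 ≤ r) : (true, x, y) ∈ regQ p r ↔
    (y ≤ 0 ∧ x ≤ p - 1 ∧ 0 ≤ x + y) ∨ (1 ≤ y ∧ 0 ≤ x ∧ x + y ≤ r) := by
  simp only [regQ, box, Finset.mem_filter, Finset.mem_product, Finset.mem_univ, Finset.mem_Icc,
    if_true, true_and]
  omega

lemma mem_regP (hp : 0 ≤ p) (hr : 0 ≤ r) : (x, y) ∈ regP p r ↔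
    (y ≤ 0 ∧ x ≤ p ∧ 1 ≤ x + y) ∨ (1 ≤ y ∧ 0 ≤ x ∧ x + y ≤ r) := by
  simp only [regP, box, Finset.mem_filter, Finset.mem_product, Finset.mem_Icc]
  omega

lemma mem_regD (hp : 0 ≤ p) (hr : 0 ≤ r) : (x, y) ∈ regD p r ↔
    (y < 0 ∧ x ≤ p - 1 ∧ 0 ≤ x + y) ∨ (0 ≤ y ∧ 1 ≤ x ∧ x + y ≤ r) := by
  simp only [regD, box, Finset.mem_filter, Finset.mem_product, Finset.mem_Icc]
  omega

end mem

/-- There are `p` more hubs than spokes: only the hubs in row `0` are left over when the spokes are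
paired with the hubs to the east of them in the lower triangle, and to the north-west in the upper
triangle. -/
lemma card_regP {p r : ℤ} (hp : 0 ≤ p) (hr : 0 ≤ r) :
    (regP p r).card = (regD p r).card + p.toNat := by
  classical
  have h1 : regP p r = (regD p r).image (fun A ↦ if A.2 < 0 then (A.1 + 1, A.2) else
      (A.1 - 1, A.2 + 1)) ∪ (Finset.Icc 1 p).image (fun x ↦ (x, 0)) := by
    ext ⟨x, y⟩
    simp only [mem_regP hp hr, Finset.mem_union, Finset.mem_image, Prod.exists, Finset.mem_Icc]
    constructor
    · intro h
      rcases lt_trichotomy y 0 with hy | hy | hy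
      · left
        refine ⟨x - 1, y, (mem_regD hp hr).2 (by omega), ?_⟩
        rw [if_pos hy]; ext <;> simp
      · right
        exact ⟨x, by omega, by rw [hy]⟩
      · left
        refine ⟨x + 1, y - 1, (mem_regD hp hr).2 (by omega), ?_⟩
        rw [if_neg (by omega)]; ext <;> simp
    · rintro (⟨x', y', h, h'⟩ | ⟨x', h, h'⟩)
      · rw [mem_regD hp hr] at h
        split_ifs at h' <;> simp only [Prod.mk.injEq] at h' <;> omega
      · simp only [Prod.mk.injEq] at h'
        omega
  rw [h1, Finset.card_union_of_disjoint, Finset.card_image_of_injOn, Finset.card_image_of_injective]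
  · simp
  · intro x x' h
    simpa using h
  · rintro ⟨x, y⟩ h ⟨x', y'⟩ h' he
    rw [Finset.mem_coe, mem_regD hp hr] at h h'
    beta_reduce at he
    split_ifs at he <;> simp only [Prod.mk.injEq] at he ⊢ <;> omega
  · rw [Finset.disjoint_left]
    rintro ⟨x, y⟩ h h'
    simp only [Finset.mem_image, Prod.exists, Finset.mem_Icc] at h h'
    obtain ⟨x', y', h, he⟩ := h
    obtain ⟨x'', h', he'⟩ := h'
    simp only [Prod.mk.injEq] at he'
    split_ifs at he <;> simp only [Prod.mk.injEq] at he <;> rw [mem_regD hp hr] at h <;> omega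

/-! ### One step of the shuffling of a diamond -/

/-- The lattice dual to `lat` is the lattice again, by an isomorphism that is a reflection up to
translations of the classes of vertices.  On vertices: -/
def dualVert : Vert (Bool × ℤ × ℤ) (Bool × ℤ × ℤ) (ℤ × ℤ) (ℤ × ℤ) ≃ LVert where
  toFun
    | .t (false, x, y) => .t (false, x + y, -y)
    | .t (true, x, y) => .t (true, x + y - 1, -y + 1)
    | .q (false, x, y) => .q (true, x + y - 1, -y)
    | .q (true, x, y) => .d (x + y, -y)
    | .p (x, y) => .p (x + y, -y)
    | .d (x, y) => .q (false, x + y, -y)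
  invFun
    | .t (false, x, y) => .t (false, x + y, -y)
    | .t (true, x, y) => .t (true, x + y, -y + 1)
    | .q (true, x, y) => .q (false, x + y + 1, -y)
    | .d (x, y) => .q (true, x + y, -y)
    | .p (x, y) => .p (x + y, -y)
    | .q (false, x, y) => .d (x + y, -y)
  left_inv := by
    rintro (⟨_ | _, x, y⟩ | ⟨_ | _, x, y⟩ | ⟨x, y⟩ | ⟨x, y⟩) <;> simp; ring
  right_inv := by
    rintro (⟨_ | _, x, y⟩ | ⟨_ | _, x, y⟩ | ⟨x, y⟩ | ⟨x, y⟩) <;> simp; ring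

/-- The isomorphism between the dual of `lat` and `lat` on edges. -/
def dualEdge : LEdge ≃ LEdge where
  toFun
    | .inl ((false, x, y), none) => .inl ((false, x + y, -y), some (true, false))
    | .inl ((true, x, y), none) => .inl ((true, x + y - 1, -y + 1), some (true, false))
    | .inl ((false, x, y), some (false, false)) => .inl ((true, x + y - 1, -y), some (false, true))
    | .inl ((false, x, y), some (false, true)) => .inr (false, x + y - 1, -y)
    | .inl ((false, x, y), some (true, false)) => .inl ((false, x + y, -y), some (true, true))
    | .inl ((false, x, y), some (true, true)) => .inl ((false, x + y, -y), none)
    | .inl ((true, x, y), some (false, false)) => .inl ((false, x + y, -y + 1), some (false, true))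
    | .inl ((true, x, y), some (false, true)) => .inr (true, x + y, -y)
    | .inl ((true, x, y), some (true, false)) =>
        .inl ((true, x + y - 1, -y + 1), some (true, true))
    | .inl ((true, x, y), some (true, true)) => .inl ((true, x + y - 1, -y + 1), none)
    | .inr (false, x, y) => .inl ((false, x + y, -y), some (false, false))
    | .inr (true, x, y) => .inl ((true, x + y, -y), some (false, false))
  invFun
    | .inl ((false, x, y), some (false, false)) => .inr (false, x + y, -y)
    | .inl ((false, x, y), some (false, true)) =>
        .inl ((true, x + y - 1, -y + 1), some (false, false))
    | .inl ((false, x, y), some (true, false)) => .inl ((false, x + y, -y), none)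
    | .inl ((false, x, y), some (true, true)) => .inl ((false, x + y, -y), some (true, false))
    | .inl ((false, x, y), none) => .inl ((false, x + y, -y), some (true, true))
    | .inl ((true, x, y), some (false, false)) => .inr (true, x + y, -y)
    | .inl ((true, x, y), some (false, true)) => .inl ((false, x + y + 1, -y), some (false, false))
    | .inl ((true, x, y), some (true, false)) => .inl ((true, x + y, -y + 1), none)
    | .inl ((true, x, y), some (true, true)) => .inl ((true, x + y, -y + 1), some (true, false))
    | .inl ((true, x, y), none) => .inl ((true, x + y, -y + 1), some (true, true))
    | .inr (false, x, y) => .inl ((false, x + y + 1, -y), some (false, true))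
    | .inr (true, x, y) => .inl ((true, x + y, -y), some (false, true))
  left_inv := by
    rintro (⟨⟨_ | _, x, y⟩, _ | ⟨_ | _, _ | _⟩⟩ | ⟨_ | _, x, y⟩) <;> simp <;> ring
  right_inv := by
    rintro (⟨⟨_ | _, x, y⟩, _ | ⟨_ | _, _ | _⟩⟩ | ⟨_ | _, x, y⟩) <;> simp <;> ring

lemma ends_dualEdge (e : LEdge) :
    lat.ends (dualEdge e) = Prod.map dualVert dualVert (lat.dual.ends e) ∨
      lat.ends (dualEdge e) = (Prod.map dualVert dualVert (lat.dual.ends e)).swap := by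
  rcases e with ⟨⟨_ | _, x, y⟩, _ | ⟨_ | _, _ | _⟩⟩ | ⟨_ | _, x, y⟩ <;>
    simp [dualEdge, dualVert, CellGraph.ends, CellGraph.dual, lat] <;> omega

/-- The exponents `w` of monomial edge weights give the faces of the lattice the weights with the
exponents `X` (NW and SE squares), `Y` (N and S squares) and `Z` (NE and SW squares).  The weight of
a square is the product of the weights of the edges crossed by the arrows that leave it, divided
by the product of the weights of the edges crossed by the arrows that enter it. -/
structure FaceCond {Γ : Type*} [AddCommGroup Γ] (w : LEdge → Γ) (X Y Z : Γ) : Prop where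
  cell : ∀ c, w (.inl (c, some (false, false))) + w (.inl (c, some (true, true))) =
    X + (w (.inl (c, some (false, true))) + w (.inl (c, some (true, false))))
  n : ∀ x y x' y', x' = x - 1 → y' = y + 1 →
    w (.inr (false, x, y)) + w (.inl ((true, x', y'), some (true, false))) =
    Y + (w (.inl ((false, x, y), some (false, false))) + w (.inl ((true, x', y'), none)))
  s : ∀ x y x' y', x' = x + 1 → y' = y - 1 →
    w (.inr (true, x, y')) + w (.inl ((false, x', y'), some (true, false))) =
    Y + (w (.inl ((true, x, y), some (false, false))) + w (.inl ((false, x', y'), none)))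
  ne : ∀ x y x', x' = x + 1 →
    w (.inl ((true, x, y), some (false, true))) + w (.inl ((false, x', y), none)) =
    Z + (w (.inr (false, x, y)) + w (.inl ((false, x', y), some (true, true))))
  sw : ∀ x y x' y', x' = x - 1 → y' = y - 1 →
    w (.inl ((false, x, y), some (false, true))) + w (.inl ((true, x', y), none)) =
    Z + (w (.inr (true, x, y')) + w (.inl ((true, x', y), some (true, true))))

/-- Shuffling at the cells mutates the weights of the faces. -/
lemma FaceCond.shuffle {Γ : Type*} [CommRing Γ] {w : LEdge → Γ} {X Y Z : Γ}
    (h : FaceCond w X Y Z) :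
    FaceCond (fun e ↦ CellGraph.shuffleExp w (dualEdge.symm e)) (X + Y) (X + Z) (-X) where
  cell := by
    rintro ⟨_ | _, x, y⟩
    · simp only [dualEdge, Equiv.coe_fn_symm_mk, CellGraph.shuffleExp, Bool.not_false]
      linear_combination h.cell (false, x + y, -y) + h.n (x + y) (-y) (x + y - 1) (-y + 1) rfl rfl
    · simp only [dualEdge, Equiv.coe_fn_symm_mk, CellGraph.shuffleExp, Bool.not_false]
      linear_combination h.cell (true, x + y, -y + 1) +
        h.s (x + y) (-y + 1) (x + y + 1) (-y) rfl (by ring)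
  n := by
    rintro x y _ _ rfl rfl
    simp only [dualEdge, Equiv.coe_fn_symm_mk, CellGraph.shuffleExp, Bool.not_true]
    have e1 : x - 1 + (y + 1) = x + y := by ring
    have e2 : -(y + 1) + 1 = -y := by ring
    rw [e1, e2]
    linear_combination h.cell (false, x + y + 1, -y) + h.ne (x + y) (-y) (x + y + 1) rfl
  s := by
    rintro x y _ _ rfl rfl
    simp only [dualEdge, Equiv.coe_fn_symm_mk, CellGraph.shuffleExp, Bool.not_true]
    have e1 : x + 1 + (y - 1) = x + y := by ring
    have e2 : x + (y - 1) = x + y - 1 := by ring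
    have e3 : -(y - 1) = -y + 1 := by ring
    rw [e1, e2, e3]
    linear_combination h.cell (true, x + y - 1, -y + 1) +
      h.sw (x + y) (-y + 1) (x + y - 1) (-y) rfl (by ring)
  ne := by
    rintro x y _ rfl
    simp only [dualEdge, Equiv.coe_fn_symm_mk, CellGraph.shuffleExp, Bool.not_false, Bool.not_true]
    have e1 : x + 1 + y = x + y + 1 := by ring
    rw [e1]
    linear_combination -h.cell (false, x + y + 1, -y)
  sw := by
    rintro x y _ _ rfl rfl
    simp only [dualEdge, Equiv.coe_fn_symm_mk, CellGraph.shuffleExp, Bool.not_false, Bool.not_true]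
    have e1 : x - 1 + y = x + y - 1 := by ring
    have e2 : x + (y - 1) = x + y - 1 := by ring
    have e3 : -(y - 1) = -y + 1 := by ring
    rw [e1, e2, e3]
    linear_combination -h.cell (true, x + y - 1, -y + 1)

open Classical in
lemma sum_two {C : Type*} (C₀ : Finset C) {c₁ c₂ : C} (h : c₁ ≠ c₂) :
    ∑ c ∈ C₀, (if c = c₁ ∨ c = c₂ then 1 else 0) =
      (if c₁ ∈ C₀ then 1 else 0) + (if c₂ ∈ C₀ then 1 else 0) := by
  rw [← Finset.sum_ite_eq' C₀ c₁ (fun _ ↦ 1), ← Finset.sum_ite_eq' C₀ c₂ (fun _ ↦ 1),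
    ← Finset.sum_add_distrib]
  refine Finset.sum_congr rfl fun c _ ↦ ?_
  by_cases h1 : c = c₁ <;> by_cases h2 : c = c₂ <;> simp_all

open Classical in
/-- The corners that belong to two cells of the region.  Only these are corners of the shuffled
region: shuffling removes the corners that belong to only one cell of the region. -/
noncomputable def regQ' (p r : ℤ) : Finset (Bool × ℤ × ℤ) :=
  (Finset.univ ×ˢ box (p + 1) (r + 1)).filter fun c ↦
    if c.1 then (true, c.2) ∈ regT p r ∧ (false, c.2.1 + 1, c.2.2) ∈ regT p r
    else (false, c.2) ∈ regT p r ∧ (true, c.2.1 - 1, c.2.2 + 1) ∈ regT p r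

section

variable {p r : ℤ}

lemma mem_regQ'_false (hp : 0 ≤ p) (hr : 0 ≤ r) (x y : ℤ) : (false, x, y) ∈ regQ' p r ↔
    (false, x, y) ∈ regT p r ∧ (true, x - 1, y + 1) ∈ regT p r := by
  simp only [regQ', box, Finset.mem_filter, Finset.mem_product, Finset.mem_univ, Finset.mem_Icc,
    Bool.false_eq_true, if_false, true_and, mem_regT_false hp hr, mem_regT_true hp hr]
  omega

lemma mem_regQ'_true (hp : 0 ≤ p) (hr : 0 ≤ r) (x y : ℤ) : (true, x, y) ∈ regQ' p r ↔
    (true, x, y) ∈ regT p r ∧ (false, x + 1, y) ∈ regT p r := by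
  simp only [regQ', box, Finset.mem_filter, Finset.mem_product, Finset.mem_univ, Finset.mem_Icc,
    if_true, true_and, mem_regT_false hp hr, mem_regT_true hp hr]
  omega

end

/-- The cells whose tips are forced to be matched with the hubs after shuffling. -/
noncomputable def forcedCells (p r : ℤ) : Finset (Bool × ℤ × ℤ) :=
  (regT p r).filter fun c ↦
    if c.1 then c.2.1 = 0 ∧ 1 ≤ c.2.2 else c.2.1 = p ∧ c.2.2 ≤ 0 ∧ (c.2.2 < 0 ∨ r < p)

/-- Shuffling leads from the region with parameters `p, r` to that with parameters `r, p - 1`. -/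
theorem matchingSum_region_step {K Γ : Type*} [Field K] [CommRing Γ] (χ : AddChar Γ K) {p r : ℤ}
    (hr : 0 ≤ r) (hrp : r ≤ p) (hpr : p ≤ r + 1) (hp : 1 ≤ p) {w : LEdge → Γ} {X Y Z : Γ}
    (h : FaceCond w X Y Z) (hX : 1 + χ X ≠ 0) :
    ∃ μ w', FaceCond w' (X + Y) (X + Z) (-X) ∧
      matchingSum lat.ends (region p r) (fun e ↦ χ (w e)) =
        χ μ * (1 + χ X) ^ p.toNat *
          matchingSum lat.ends (region r (p - 1)) (fun e ↦ χ (w' e)) := by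
  classical
  have hp0 : 0 ≤ p := by omega
  obtain ⟨μ, hμ⟩ := lat.matchingSum_shuffle_monomial χ (C₀ := regT p r) (Q₀ := regQ p r)
    (Q₁ := regQ' p r) (P₀ := regP p r) (D₀ := regD p r)
    (Y₀ := Finset.univ ×ˢ regD p r)
    (by
      rintro ⟨_ | _, x, y⟩ (_ | _) <;>
        simp only [lat, Bool.false_eq_true, if_true, if_false, mem_regT_false hp0 hr,
          mem_regT_true hp0 hr, mem_regP hp0 hr, mem_regQ_false hp0 hr, mem_regQ_true hp0 hr] <;>
        omega)
    (by
      rintro ⟨_ | _, x, y⟩ (_ | _) <;>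
        simp only [lat, Bool.false_eq_true, if_true, if_false, mem_regT_false hp0 hr,
          mem_regT_true hp0 hr, mem_regD hp0 hr, mem_regQ'_false hp0 hr, mem_regQ'_true hp0 hr] <;>
        omega)
    (by
      rintro ⟨_ | _, x, y⟩
      · refine ((Finset.sum_congr rfl ?_).trans (sum_two (c₁ := (false, x, y))
          (c₂ := (true, x - 1, y + 1)) _ (by simp))).trans ?_
        · rintro ⟨_ | _, x', y'⟩ - <;> simp [lat, eq_sub_iff_add_eq, sub_eq_iff_eq_add]
        simp only [mem_regQ'_false hp0 hr, mem_regT_false hp0 hr, mem_regT_true hp0 hr,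
          mem_regQ_false hp0 hr]
        split_ifs <;> omega
      · refine ((Finset.sum_congr rfl ?_).trans (sum_two (c₁ := (true, x, y))
          (c₂ := (false, x + 1, y)) _ (by simp))).trans ?_
        · rintro ⟨_ | _, x', y'⟩ - <;> simp [lat, sub_eq_iff_eq_add]
        simp only [mem_regQ'_true hp0 hr, mem_regT_false hp0 hr, mem_regT_true hp0 hr,
          mem_regQ_true hp0 hr]
        split_ifs <;> omega)
    (by
      rintro ⟨b, x, y⟩ h1 h2
      simpa [lat] using h2)
    w X hX h.cell
  -- the factor `(1 + χ X) ^ p` comes from the surplus `p` of hubs over spokes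
  refine ⟨μ, fun e ↦ CellGraph.shuffleExp w (dualEdge.symm e), h.shuffle, ?_⟩
  -- the dual lattice is the lattice in another position
  have h1 := matchingSum_map (U := dualVert ⁻¹' (region r (p - 1))) dualEdge dualVert.injective
    ends_dualEdge (fun e ↦ χ (CellGraph.shuffleExp w (dualEdge.symm e)))
  rw [Equiv.image_preimage] at h1
  simp only [Equiv.symm_apply_apply] at h1
  rw [h1]
  -- on the boundary of the shuffled region, each tip in `forcedCells` is the only neighbour left
  -- for its hub; without these pairs, the region is that with the parameters `r, p - 1`
  have h2 := matchingSum_forced (ends := lat.dual.ends)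
    (U := vertFinset (regT p r) (regQ' p r) (regD p r) (regP p r))
    (U' := dualVert ⁻¹' (region r (p - 1))) ((forcedCells p r).image fun c ↦ .inl (c, none))
    (fun e ↦ χ (CellGraph.shuffleExp w e)) ?_ ?_
  · have h3 : ∏ e ∈ (forcedCells p r).image (fun c ↦ (.inl (c, none) : LEdge)),
        χ (CellGraph.shuffleExp w e) = 1 := by
      refine Finset.prod_eq_one fun e he ↦ ?_
      obtain ⟨c, -, rfl⟩ := Finset.mem_image.1 he
      simp [CellGraph.shuffleExp]
    rw [h3, one_mul] at h2
    rw [h2, card_regP hp0 hr, pow_add] at hμ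
    have h4 := pow_ne_zero (regD p r).card hX
    refine mul_right_cancel₀ h4 ?_
    rw [region, hμ]
    ring
  · intro M hM e he
    obtain ⟨c, hc, rfl⟩ := Finset.mem_image.1 he
    rw [forcedCells, Finset.mem_filter] at hc
    obtain ⟨hc, hc'⟩ := hc
    have hcP : c.2 ∈ regP p r := by
      rcases c with ⟨_ | _, x, y⟩ <;>
        simp only [mem_regT_false hp0 hr, mem_regT_true hp0 hr, mem_regP hp0 hr] at hc ⊢ <;> omega
    obtain ⟨e, he, hv⟩ := hM.exists_inc (v := .d c.2) (by simpa using hcP)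
    have he1 := hM.mem_of_inc he (Or.inl rfl)
    rcases e with ⟨c', _ | ⟨_ | _, r'⟩⟩ | b
    · simp only [CellGraph.ends, CellGraph.dual, lat, reduceCtorEq, Vert.d.injEq, false_or] at hv
      simp only [CellGraph.ends, CellGraph.dual, SetLike.mem_coe, t_mem_vertFinset] at he1
      convert he
      rcases c with ⟨_ | _, x, y⟩ <;> rcases c' with ⟨_ | _, x', y'⟩ <;>
        simp only [Bool.false_eq_true, if_true, if_false, Prod.mk.injEq, mem_regT_false hp0 hr,
          mem_regT_true hp0 hr, true_and, false_and, reduceCtorEq] at hv hc hc' he1 ⊢ <;> omega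
    · simp [CellGraph.ends] at hv
    · simp [CellGraph.ends] at hv
    · simp only [CellGraph.ends, CellGraph.dual, lat, reduceCtorEq, Vert.d.injEq, false_or] at hv
      simp only [CellGraph.ends, CellGraph.dual, lat, SetLike.mem_coe, p_mem_vertFinset] at he1
      rcases c with ⟨_ | _, x, y⟩ <;> rcases b with ⟨_ | _, x', y'⟩ <;>
        simp only [Bool.false_eq_true, if_true, if_false, Prod.mk.injEq, mem_regT_false hp0 hr,
          mem_regT_true hp0 hr, mem_regD hp0 hr] at hv hc hc' he1 <;> omega
  · have hp1 : 0 ≤ p - 1 := by omega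
    intro v
    rw [Finset.sum_image (by intro c _ c' _ h; simpa using h)]
    rcases v with ⟨_ | _, x, y⟩ | ⟨_ | _, x, y⟩ | ⟨x, y⟩ | ⟨x, y⟩
    · simp only [CellGraph.ends, inc, Vert.t.injEq, reduceCtorEq, if_false, add_zero,
        Finset.sum_ite_eq', SetLike.mem_coe, t_mem_vertFinset, Set.mem_preimage, dualVert,
        Equiv.coe_fn_mk, region,
        mem_regT_false hp0 hr, mem_regT_false hr hp1, forcedCells, Finset.mem_filter,
        Bool.false_eq_true]
      split_ifs <;> omega
    · simp only [CellGraph.ends, inc, Vert.t.injEq, reduceCtorEq, if_false, add_zero,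
        Finset.sum_ite_eq', SetLike.mem_coe, t_mem_vertFinset, Set.mem_preimage, dualVert,
        Equiv.coe_fn_mk, region,
        mem_regT_true hp0 hr, mem_regT_true hr hp1, forcedCells, Finset.mem_filter, if_true]
      split_ifs <;> omega
    · simp only [CellGraph.ends, inc, reduceCtorEq, if_false, add_zero,
        Finset.sum_const_zero, zero_add, SetLike.mem_coe, q_mem_vertFinset,
        Set.mem_preimage, dualVert, Equiv.coe_fn_mk, region,
        mem_regQ'_false hp0 hr, mem_regT_false hp0 hr, mem_regT_true hp0 hr, mem_regQ_true hr hp1]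
      split_ifs <;> omega
    · simp only [CellGraph.ends, inc, reduceCtorEq, if_false, add_zero,
        Finset.sum_const_zero, zero_add, SetLike.mem_coe, q_mem_vertFinset,
        d_mem_vertFinset, Set.mem_preimage, dualVert,
        Equiv.coe_fn_mk, region,
        mem_regQ'_true hp0 hr, mem_regT_false hp0 hr, mem_regT_true hp0 hr, mem_regD hr hp1]
      split_ifs <;> omega
    · simp only [CellGraph.ends, inc, reduceCtorEq, if_false, add_zero,
        Finset.sum_const_zero, zero_add, SetLike.mem_coe, p_mem_vertFinset,
        Set.mem_preimage, dualVert,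
        Equiv.coe_fn_mk, region, mem_regD hp0 hr, mem_regP hr hp1]
      split_ifs <;> omega
    · have h3 : ∑ c ∈ forcedCells p r, inc (lat.dual.ends (Sum.inl (c, none))) (.d (x, y)) = _ :=
        (Finset.sum_congr rfl ?_).trans (sum_two (c₁ := (false, x, y)) (c₂ := (true, x, y)) _
          (by simp))
      · rw [h3]
        simp only [SetLike.mem_coe, d_mem_vertFinset, q_mem_vertFinset, Set.mem_preimage, dualVert,
          Equiv.coe_fn_mk, region, forcedCells, Finset.mem_filter, Bool.false_eq_true, if_false,
          if_true, mem_regT_false hp0 hr, mem_regT_true hp0 hr, mem_regP hp0 hr,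
          mem_regQ_false hr hp1]
        split_ifs <;> omega
      · rintro ⟨_ | _, x', y'⟩ - <;> simp [lat, inc, CellGraph.ends, CellGraph.dual]

/-! ### The product formula -/

/-- The product on the right-hand side for the diamond of order `m / 2`; the variable `x` belongs to
the squares that are flipped in the next step of the shuffling, `y` to the N and S squares, `z` to
the other ones. -/
def dragonProd {R : Type*} [CommSemiring R] (m : ℕ) (x y z : R) : R :=
  (∏ i ∈ Finset.range ((m + 1) / 2), (1 + x ^ (i + 1) * y ^ i * z ^ i) ^ ((m + 1) / 2 - i)) *
    ∏ i ∈ Finset.range (m / 2), (1 + x ^ (i + 1) * y ^ (i + 1) * z ^ i) ^ (m / 2 - i)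

/-- The recursion of the product under the mutation of the variables by which shuffling changes the
weights of the faces. -/
lemma dragonProd_succ {K : Type*} [Field K] (m : ℕ) {x : K} (hx : x ≠ 0) (y z : K) :
    dragonProd (m + 1) x y z = (1 + x) ^ ((m + 2) / 2) * dragonProd m (x * y) (x * z) x⁻¹ := by
  unfold dragonProd
  have e : (m + 1 + 1) / 2 = m / 2 + 1 := by omega
  rw [e, Finset.prod_range_succ']
  have h1 : ∀ i, (x * y) ^ (i + 1) * (x * z) ^ i * x⁻¹ ^ i = x ^ (i + 1) * y ^ (i + 1) * z ^ i := by
    intro i; rw [inv_pow, mul_pow, mul_pow]; field_simp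
  have h2 : ∀ i, (x * y) ^ (i + 1) * (x * z) ^ (i + 1) * x⁻¹ ^ i =
      x ^ (i + 1 + 1) * y ^ (i + 1) * z ^ (i + 1) := by
    intro i; rw [inv_pow, mul_pow, mul_pow, pow_succ x (i + 1)]; field_simp; ring
  simp only [h1, h2, Nat.add_sub_add_right, zero_add, pow_one, pow_zero, mul_one, Nat.sub_zero]
  ring

/-- Inverting the variables changes the product by a monomial. -/
lemma dragonProd_inv {K Γ : Type*} [Field K] [CommRing Γ] (χ : AddChar Γ K) (m : ℕ) (X Y Z : Γ) :
    ∃ μ, dragonProd m (χ (-X)) (χ (-Y)) (χ (-Z)) = χ μ * dragonProd m (χ X) (χ Y) (χ Z) := by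
  have key : ∀ (s : Finset ℕ) (f : ℕ → Γ) (k : ℕ → ℕ), ∃ μ,
      ∏ i ∈ s, (1 + χ (-f i)) ^ k i = χ μ * ∏ i ∈ s, (1 + χ (f i)) ^ k i := by
    intro s f k
    refine ⟨∑ i ∈ s, k i • (-f i), ?_⟩
    rw [addChar_sum, ← Finset.prod_mul_distrib]
    refine Finset.prod_congr rfl fun i _ ↦ ?_
    rw [χ.map_nsmul_eq_pow, ← mul_pow, mul_add, mul_one, ← χ.map_add_eq_mul, neg_add_cancel,
      χ.map_zero_eq_one, add_comm]
  have hmon : ∀ (i j k : ℕ) (X Y Z : Γ), χ X ^ i * χ Y ^ j * χ Z ^ k =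
      χ (i • X + j • Y + k • Z) := by
    intro i j k X Y Z
    simp only [χ.map_add_eq_mul, χ.map_nsmul_eq_pow]
  have hneg : ∀ (i j k : ℕ), i • (-X) + j • (-Y) + k • (-Z) = -(i • X + j • Y + k • Z) := by
    intro i j k; simp only [smul_neg]; abel
  unfold dragonProd
  simp only [hmon, hneg]
  obtain ⟨μ, hμ⟩ := key (Finset.range ((m + 1) / 2)) (fun i ↦ (i + 1) • X + i • Y + i • Z)
    (fun i ↦ (m + 1) / 2 - i)
  obtain ⟨ν, hν⟩ := key (Finset.range (m / 2)) (fun i ↦ (i + 1) • X + (i + 1) • Y + i • Z)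
    (fun i ↦ m / 2 - i)
  refine ⟨μ + ν, ?_⟩
  rw [hμ, hν, χ.map_add_eq_mul]
  ring

lemma region_zero : region 0 0 = ∅ := by
  ext v
  simp only [Finset.notMem_empty, iff_false]
  rcases v with ⟨_ | _, x, y⟩ | ⟨_ | _, x, y⟩ | ⟨x, y⟩ | ⟨x, y⟩
  · rw [region, t_mem_vertFinset, mem_regT_false le_rfl le_rfl]; omega
  · rw [region, t_mem_vertFinset, mem_regT_true le_rfl le_rfl]; omega
  · rw [region, q_mem_vertFinset, mem_regQ_false le_rfl le_rfl]; omega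
  · rw [region, q_mem_vertFinset, mem_regQ_true le_rfl le_rfl]; omega
  · rw [region, p_mem_vertFinset, mem_regP le_rfl le_rfl]; omega
  · rw [region, d_mem_vertFinset, mem_regD le_rfl le_rfl]; omega

/-- The product formula for the matching sum of a region with monomial weights, up to a monomial
factor. -/
theorem matchingSum_region {K Γ : Type*} [Field K] [CommRing Γ] (χ : AddChar Γ K)
    (hχ : ∀ γ, 1 + χ γ ≠ 0) (m : ℕ) {w : LEdge → Γ} {X Y Z : Γ} (h : FaceCond w X Y Z) :
    ∃ μ, matchingSum lat.ends (region (((m + 1) / 2 : ℕ) : ℤ) ((m / 2 : ℕ) : ℤ))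
      (fun e ↦ χ (w e)) = χ μ * dragonProd m (χ X) (χ Y) (χ Z) := by
  induction m generalizing w X Y Z with
  | zero =>
    refine ⟨0, ?_⟩
    simp [region_zero, matchingSum_empty, dragonProd]
  | succ m ih =>
    obtain ⟨μ, w', hw', hs⟩ := matchingSum_region_step χ (p := ((m + 1 + 1) / 2 : ℕ))
      (r := ((m + 1) / 2 : ℕ)) (by omega) (by omega) (by omega) (by omega) h (hχ X)
    obtain ⟨ν, hν⟩ := ih hw'
    refine ⟨μ + ν, ?_⟩
    have e : (((m + 1 + 1) / 2 : ℕ) : ℤ) - 1 = ((m / 2 : ℕ) : ℤ) := by omega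
    rw [hs, e, hν, dragonProd_succ m (addChar_ne_zero χ X), χ.map_add_eq_mul, χ.map_add_eq_mul,
      χ.map_add_eq_mul, χ.map_neg_eq_inv, Int.toNat_natCast]
    ring

/-! ### Faces, circulation and potentials -/

/-- The faces of the lattice, named by the hexagon in which they lie and by their orientation. -/
inductive LFace
  | ne (x y : ℤ)
  | n (x y : ℤ)
  | nw (x y : ℤ)
  | sw (x y : ℤ)
  | s (x y : ℤ)
  | se (x y : ℤ)

/-- The face in which the arrow crossing an edge starts.  It lies on the left of the edge if this is
traversed from its white end, in `P ∪ T`, to its black end. -/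
def lsrc : LEdge → LFace
  | .inl ((false, x, y), some (false, false)) => .nw x y
  | .inl ((false, x, y), some (false, true)) => .sw x y
  | .inl ((false, x, y), some (true, false)) => .s (x - 1) (y + 1)
  | .inl ((false, x, y), some (true, true)) => .nw x y
  | .inl ((false, x, y), none) => .ne (x - 1) y
  | .inl ((true, x, y), some (false, false)) => .se x y
  | .inl ((true, x, y), some (false, true)) => .ne x y
  | .inl ((true, x, y), some (true, false)) => .n (x + 1) (y - 1)
  | .inl ((true, x, y), some (true, true)) => .se x y
  | .inl ((true, x, y), none) => .sw (x + 1) y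
  | .inr (false, x, y) => .n x y
  | .inr (true, x, y) => .s x (y + 1)

/-- The face in which the arrow crossing an edge ends.  It lies on the right of the edge if this is
traversed from its white end, in `P ∪ T`, to its black end. -/
def ltgt : LEdge → LFace
  | .inl ((false, x, y), some (false, false)) => .n x y
  | .inl ((false, x, y), some (false, true)) => .nw x y
  | .inl ((false, x, y), some (true, false)) => .nw x y
  | .inl ((false, x, y), some (true, true)) => .ne (x - 1) y
  | .inl ((false, x, y), none) => .s (x - 1) (y + 1)
  | .inl ((true, x, y), some (false, false)) => .s x y
  | .inl ((true, x, y), some (false, true)) => .se x y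
  | .inl ((true, x, y), some (true, false)) => .se x y
  | .inl ((true, x, y), some (true, true)) => .sw (x + 1) y
  | .inl ((true, x, y), none) => .n (x + 1) (y - 1)
  | .inr (false, x, y) => .ne x y
  | .inr (true, x, y) => .sw x (y + 1)

/-- The height change across an edge. -/
def lheight : LEdge → ℤ
  | .inl (_, some (false, _)) => 1
  | .inl (_, some (true, _)) => 2
  | .inl (_, none) => 2
  | .inr _ => 1

/-- The vertices of a face. -/
def lverts : LFace → Set LVert
  | .ne x y => {.p (x, y), .q (true, x, y), .t (false, x + 1, y), .d (x, y)}
  | .n x y => {.p (x, y), .d (x, y), .t (true, x - 1, y + 1), .q (false, x, y)}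
  | .nw x y => {.p (x, y), .q (false, x, y), .t (false, x, y), .q (true, x - 1, y)}
  | .sw x y => {.p (x, y), .q (true, x - 1, y), .t (true, x - 1, y), .d (x, y - 1)}
  | .s x y => {.p (x, y), .d (x, y - 1), .t (false, x + 1, y - 1), .q (false, x + 1, y - 1)}
  | .se x y => {.p (x, y), .q (false, x + 1, y - 1), .t (true, x, y), .q (true, x, y)}

/-- The horizontal line through the midpoints of a row of faces, counted from south to north. -/
def LFace.line : LFace → ℤ
  | .ne _ y | .n _ y | .nw _ y => 2 * y + 1
  | .sw _ y | .s _ y | .se _ y => 2 * y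

/-- The position of a face in its row, counted from west to east. -/
def LFace.place : LFace → ℤ
  | .nw x _ | .sw x _ => 3 * x - 1
  | .n x _ | .s x _ => 3 * x
  | .ne x _ | .se x _ => 3 * x + 1

/-- The eastern neighbour of a face in its row. -/
def LFace.next : LFace → LFace
  | .nw x y => .n x y
  | .n x y => .ne x y
  | .ne x y => .nw (x + 1) y
  | .sw x y => .s x y
  | .s x y => .se x y
  | .se x y => .sw (x + 1) y

/-- The edge between a face and its eastern neighbour. -/
def LFace.nextEdge : LFace → LEdge
  | .nw x y => .inl ((false, x, y), some (false, false))
  | .n x y => .inr (false, x, y)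
  | .ne x y => .inl ((false, x + 1, y), some (true, true))
  | .sw x y => .inr (true, x, y - 1)
  | .s x y => .inl ((true, x, y), some (false, false))
  | .se x y => .inl ((true, x, y), some (true, true))

lemma LFace.ext_line {q q' : LFace} (h : q.line = q'.line) (h' : q.place = q'.place) : q = q' := by
  rcases q with ⟨x, y⟩ | ⟨x, y⟩ | ⟨x, y⟩ | ⟨x, y⟩ | ⟨x, y⟩ | ⟨x, y⟩ <;>
  rcases q' with ⟨x', y'⟩ | ⟨x', y'⟩ | ⟨x', y'⟩ | ⟨x', y'⟩ | ⟨x', y'⟩ | ⟨x', y'⟩ <;>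
  simp only [LFace.line, LFace.place] at h h' <;>
  first
  | (exfalso; omega)
  | (have hx : x = x' := by omega
     have hy : y = y' := by omega
     rw [hx, hy])

lemma LFace.line_next (q : LFace) : q.next.line = q.line := by cases q <;> rfl

lemma LFace.place_next (q : LFace) : q.next.place = q.place + 1 := by
  cases q <;> simp only [LFace.next, LFace.place] <;> ring

lemma LFace.nextEdge_eq (q : LFace) :
    (lsrc q.nextEdge = q ∧ ltgt q.nextEdge = q.next) ∨
      (lsrc q.nextEdge = q.next ∧ ltgt q.nextEdge = q) := by
  cases q <;> simp [LFace.next, LFace.nextEdge, lsrc, ltgt]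

/-- The edges at a vertex. -/
def edgesAt : LVert → List LEdge
  | .p (x, y) => [.inl ((false, x, y), some (false, false)),
      .inl ((false, x, y), some (false, true)),
      .inl ((true, x, y), some (false, false)), .inl ((true, x, y), some (false, true)),
      .inr (false, x, y), .inr (true, x, y - 1)]
  | .q (false, x, y) => [.inl ((false, x, y), some (false, false)),
      .inl ((false, x, y), some (true, false)), .inl ((true, x - 1, y + 1), some (false, false)),
      .inl ((true, x - 1, y + 1), some (true, false))]
  | .q (true, x, y) => [.inl ((true, x, y), some (false, true)),
      .inl ((true, x, y), some (true, true)), .inl ((false, x + 1, y), some (false, true)),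
      .inl ((false, x + 1, y), some (true, true))]
  | .d (x, y) => [.inr (false, x, y), .inr (true, x, y), .inl ((false, x + 1, y), none),
      .inl ((true, x - 1, y + 1), none)]
  | .t c => [.inl (c, none), .inl (c, some (true, false)), .inl (c, some (true, true))]

lemma nodup_edgesAt (v : LVert) : (edgesAt v).Nodup := by
  rcases v with ⟨_ | _, x, y⟩ | ⟨_ | _, x, y⟩ | ⟨x, y⟩ | ⟨x, y⟩ <;> simp [edgesAt]

lemma mem_edgesAt {e : LEdge} {v : LVert} :
    e ∈ edgesAt v ↔ (lat.ends e).1 = v ∨ (lat.ends e).2 = v := by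
  rcases v with ⟨_ | _, x, y⟩ | ⟨_ | _, x, y⟩ | ⟨x, y⟩ | ⟨x, y⟩ <;>
  rcases e with ⟨⟨_ | _, x', y'⟩, _ | ⟨_ | _, _ | _⟩⟩ | ⟨_ | _, x', y'⟩ <;>
  simp [edgesAt, lat, CellGraph.ends] <;> try omega

lemma ends_ne (e : LEdge) : (lat.ends e).1 ≠ (lat.ends e).2 := by
  rcases e with ⟨c, _ | ⟨_ | _, r⟩⟩ | b <;> simp [CellGraph.ends]

/-- The faces around a vertex are passed by the edges at this vertex in a cycle. -/
lemma circulation_edgesAt (v : LVert) (m : LFace → ℤ) :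
    ((edgesAt v).map fun e ↦ m (ltgt e) - m (lsrc e)).sum = 0 := by
  rcases v with ⟨_ | _, x, y⟩ | ⟨_ | _, x, y⟩ | ⟨x, y⟩ | ⟨x, y⟩ <;>
  simp [edgesAt, lsrc, ltgt] <;> ring

/-! ### Matchings of the same region have the same flux across closed curves -/

/-- The line of the faces on both sides of an edge, if these are neighbours in a row; the value at
the other edges is irrelevant. -/
def eline : LEdge → ℤ
  | .inl ((false, _, y), some _) => 2 * y + 1
  | .inl ((true, _, y), some _) => 2 * y
  | .inl (_, none) => 0
  | .inr (false, _, y) => 2 * y + 1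
  | .inr (true, _, y) => 2 * y + 2

/-- The place of the eastern one of the faces on both sides of an edge, if these are neighbours in a
row. -/
def eplace : LEdge → ℤ
  | .inl ((false, x, _), some (false, _)) => 3 * x
  | .inl ((false, x, _), some (true, _)) => 3 * x - 1
  | .inl ((true, x, _), some (false, _)) => 3 * x + 1
  | .inl ((true, x, _), some (true, _)) => 3 * x + 2
  | .inl (_, none) => 0
  | .inr (false, x, _) => 3 * x + 1
  | .inr (true, x, _) => 3 * x

/-- An edge between neighbours in a row has the sign `1` if its source is the western one, and `-1`
otherwise.  The other edges have the sign `0`. -/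
def esign : LEdge → ℤ
  | .inl ((false, _), some (false, false)) => 1
  | .inl ((false, _), some (true, true)) => -1
  | .inl ((true, _), some (false, false)) => -1
  | .inl ((true, _), some (true, true)) => 1
  | .inl _ => 0
  | .inr (false, _) => 1
  | .inr (true, _) => -1

/-- The strip between two successive lines that contains a vertex; the strip `i` lies between the
lines `i` and `i + 1`. -/
def strip : LVert → ℤ
  | .p (_, y) => 2 * y
  | .q (true, _, y) => 2 * y
  | .q (false, _, y) => 2 * y + 1
  | .d (_, y) => 2 * y + 1
  | .t (false, _, y) => 2 * y + 1
  | .t (true, _, y) => 2 * y - 1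

/-- The position of a vertex in its strip, from west to east. -/
def absc : LVert → ℤ
  | .p (x, _) => 4 * x
  | .q (true, x, _) => 4 * x + 2
  | .q (false, x, _) => 4 * x - 1
  | .d (x, _) => 4 * x + 1
  | .t (false, x, _) => 4 * x - 2
  | .t (true, x, _) => 4 * x + 4

/-- The signed number of crossings of an edge with the ray that runs in a row from the far west to
the face `q`. -/
def crossing (q : LFace) (e : LEdge) : ℤ :=
  if q.line = eline e ∧ eplace e ≤ q.place then esign e else 0

/-- The constant and the cut that describe the vertices enclosed by the rays to the two faces at an
edge that is not crossed by a row. -/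
def cut : LEdge → ℤ × ℤ × ℤ
  | .inl ((false, x, y), some (false, true)) => (1, 2 * y, 4 * x - 2)
  | .inl ((true, x, y), some (false, true)) => (-1, 2 * y, 4 * x)
  | .inl ((false, x, y), some (true, false)) => (-1, 2 * y + 1, 4 * x - 2)
  | .inl ((false, x, y), none) => (1, 2 * y + 1, 4 * x - 3)
  | .inl ((true, x, y), some (true, false)) => (1, 2 * y - 1, 4 * x + 3)
  | .inl ((true, x, y), none) => (-1, 2 * y - 1, 4 * x + 4)
  | _ => (0, 0, 0)

/-- The indicator function, with a sign, of the set of the vertices that are enclosed by the rays to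
the two faces at the edge `e`. -/
def enclosed (e : LEdge) (v : LVert) : ℤ :=
  if strip v = (cut e).2.1 ∧ absc v ≤ (cut e).2.2 then (cut e).1 else 0

open Classical in
set_option maxHeartbeats 4000000 in
/-- The curve formed by the rays to the two faces at the edge `e` and the passage across `e` is
closed: an edge `e'` crosses it as often as required by the positions of its ends. -/
lemma crossing_sub (e e' : LEdge) :
    crossing (ltgt e) e' - crossing (lsrc e) e' =
      (if e = e' then 1 else 0) + enclosed e (lat.ends e').1 - enclosed e (lat.ends e').2 := by
  rcases e with ⟨⟨_ | _, x, y⟩, _ | ⟨_ | _, _ | _⟩⟩ | ⟨_ | _, x, y⟩ <;>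
  rcases e' with ⟨⟨_ | _, x', y'⟩, _ | ⟨_ | _, _ | _⟩⟩ | ⟨_ | _, x', y'⟩ <;>
  simp only [crossing, enclosed, cut, ltgt, lsrc, eline, eplace, esign, LFace.line, LFace.place,
    strip, absc, lat, CellGraph.ends, Sum.inl.injEq, Sum.inr.injEq, Prod.mk.injEq, reduceCtorEq,
    and_true, true_and, and_false, false_and, if_false, Option.some.injEq, ite_self, if_true,
    Bool.false_eq_true] <;>
  (try split_ifs) <;> omega

/-- Every vertex of `U` is an end of exactly one edge of a perfect matching of `U`. -/
lemma IsPM.sum_ends {E V A : Type*} [AddCommMonoid A] {ends : E → V × V} {U : Finset V}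
    {F : Finset E} (h : IsPM ends U F) (f : V → A) :
    ∑ e ∈ F, (f (ends e).1 + f (ends e).2) = ∑ v ∈ U, f v := by
  classical
  have h1 : ∀ e ∈ F, f (ends e).1 + f (ends e).2 = ∑ v ∈ U, inc (ends e) v • f v := by
    intro e he
    have h2 := h.mem_of_inc he (Or.inl rfl)
    have h3 := h.mem_of_inc he (Or.inr rfl)
    simp only [inc, add_smul, Finset.sum_add_distrib, ite_smul, one_smul, zero_smul]
    rw [Finset.sum_ite_eq, Finset.sum_ite_eq, if_pos (by simpa using h2),
      if_pos (by simpa using h3)]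
  rw [Finset.sum_congr rfl h1, Finset.sum_comm]
  refine Finset.sum_congr rfl fun v hv ↦ ?_
  rw [← Finset.sum_smul, h v, if_pos (by simpa using hv), one_smul]

/-- The sign of a vertex; it is `1` for the first end of an edge, and `-1` for the second one. -/
def vsign : LVert → ℤ
  | .p _ | .t _ => 1
  | .q _ | .d _ => -1

/-- The flux of a perfect matching through the boundary of a set of vertices, here with the
indicator function `f`, is the difference of the numbers of white and of black vertices in the
intersection of this set with the region, and so the same for all perfect matchings. -/
lemma IsPM.flux_eq {U : Finset LVert} {F F' : Finset LEdge} (h : IsPM lat.ends U F)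
    (h' : IsPM lat.ends U F') (f : LVert → ℤ) :
    ∑ e ∈ F, (f (lat.ends e).1 - f (lat.ends e).2) =
      ∑ e ∈ F', (f (lat.ends e).1 - f (lat.ends e).2) := by
  have h1 : ∀ e, f (lat.ends e).1 - f (lat.ends e).2 =
      vsign (lat.ends e).1 * f (lat.ends e).1 + vsign (lat.ends e).2 * f (lat.ends e).2 := by
    rintro (⟨c, _ | ⟨_ | _, r⟩⟩ | b) <;> simp only [CellGraph.ends, vsign] <;> ring
  simp only [h1]
  rw [h.sum_ends fun v ↦ vsign v * f v, h'.sum_ends fun v ↦ vsign v * f v]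

/-- An edge crosses a line if and only if its ends lie on different sides of it. -/
lemma esign_eq (l : ℤ) (e : LEdge) : (if l = eline e then esign e else 0) =
    (if l ≤ strip (lat.ends e).2 then 1 else 0) - (if l ≤ strip (lat.ends e).1 then 1 else 0) := by
  rcases e with ⟨⟨_ | _, x, y⟩, _ | ⟨_ | _, _ | _⟩⟩ | ⟨_ | _, x, y⟩ <;>
  simp only [eline, esign, lat, CellGraph.ends, strip, Bool.false_eq_true, if_true, if_false] <;>
  split_ifs <;> omega

open Classical in
/-- The difference of two perfect matchings of the same region is the boundary of a function on the
faces. -/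
theorem exists_potential {U : Finset LVert} {F F' : Finset LEdge} (h : IsPM lat.ends U F)
    (h' : IsPM lat.ends U F') : ∃ g : LFace → ℤ, (Function.support g).Finite ∧
      ∀ e, g (ltgt e) + (if e ∈ F then 1 else 0) = g (lsrc e) + (if e ∈ F' then 1 else 0) := by
  refine ⟨fun q ↦ ∑ e ∈ F', crossing q e - ∑ e ∈ F, crossing q e, ?_, ?_⟩
  · set B := F ∪ F'
    have hB : {q : LFace | ∃ e ∈ B, ∃ e' ∈ B, q.line = eline e ∧ eplace e ≤ q.place ∧
        q.place < eplace e'}.Finite := by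
      have h1 : (⋃ e ∈ B, ⋃ e' ∈ B, ((fun q : LFace ↦ (q.line, q.place)) ⁻¹'
          ({eline e} ×ˢ Set.Ico (eplace e) (eplace e')))).Finite := by
        refine Set.Finite.biUnion B.finite_toSet fun e _ ↦ Set.Finite.biUnion B.finite_toSet
          fun e' _ ↦ Set.Finite.preimage ?_ ((Set.finite_singleton _).prod (Set.finite_Ico _ _))
        intro q _ q' _ hq
        exact LFace.ext_line (Prod.ext_iff.1 hq).1 (Prod.ext_iff.1 hq).2
      refine h1.subset ?_
      rintro q ⟨e, he, e', he', h2⟩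
      simp only [Set.mem_iUnion]
      exact ⟨e, he, e', he', by simpa using h2⟩
    refine hB.subset fun q hq ↦ ?_
    rw [Function.mem_support] at hq
    have h1 : ∃ e ∈ B, crossing q e ≠ 0 := by
      by_contra hne
      push Not at hne
      apply hq
      rw [Finset.sum_eq_zero fun e he ↦ hne e (Finset.mem_union_right _ he),
        Finset.sum_eq_zero fun e he ↦ hne e (Finset.mem_union_left _ he), sub_zero]
    obtain ⟨e, he, h1⟩ := h1
    have h2 : q.line = eline e ∧ eplace e ≤ q.place := by
      by_contra hne
      exact h1 (if_neg hne)
    -- east of all edges, the ray crosses the edges with ends on different sides of the line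
    have h3 : ∃ e' ∈ B, q.place < eplace e' := by
      by_contra hne
      push Not at hne
      have h4 : ∀ e ∈ B, crossing q e =
          (if q.line ≤ strip (lat.ends e).2 then 1 else 0) -
            (if q.line ≤ strip (lat.ends e).1 then 1 else 0) := by
        intro e he
        rw [← esign_eq, crossing]
        simp only [hne e he, and_true]
      apply hq
      rw [Finset.sum_congr rfl fun e he ↦ h4 e (Finset.mem_union_right _ he),
        Finset.sum_congr rfl fun e he ↦ h4 e (Finset.mem_union_left _ he)]
      have h5 := h.flux_eq h' fun v ↦ if q.line ≤ strip v then 1 else 0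
      simp only [Finset.sum_sub_distrib] at h5 ⊢
      omega
    obtain ⟨e', he', h3⟩ := h3
    exact ⟨e, he, e', he', h2.1, h2.2, h3⟩
  · intro e
    have key : ∀ F : Finset LEdge, ∑ e' ∈ F, crossing (ltgt e) e' - ∑ e' ∈ F, crossing (lsrc e) e' =
        (if e ∈ F then 1 else 0) +
          ∑ e' ∈ F, (enclosed e (lat.ends e').1 - enclosed e (lat.ends e').2) := by
      intro F
      rw [← Finset.sum_sub_distrib, Finset.sum_congr rfl fun e' _ ↦ crossing_sub e e']
      simp only [add_sub_assoc, Finset.sum_add_distrib, Finset.sum_ite_eq]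
    have h1 := key F
    have h2 := key F'
    have h3 := h.flux_eq h' (enclosed e)
    simp only
    linarith

/-! ### Regions with a well-behaved theory of heights -/

open Classical in
/-- The properties of a region `U` of a planar graph on which the theory of its height functions
rests.  The edge `e` has the ends `ends e` and is crossed by the arrow of the dual quiver from the
face `src e` to the face `tgt e`, along which the height increases by `H e` modulo six; `fv` gives
the vertices of the faces. -/
structure GoodRegion {E V S : Type*} (ends : E → V × V) (src tgt : E → S) (H : E → ℤ)
    (fv : S → Set V) (U : Set V) : Prop where
  /-- The region is finite. -/
  finite : U.Finite
  /-- The arrows around a vertex form a cycle. -/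
  circ : ∀ v ∈ U, ∃ I : Finset E, (∀ e, inc (ends e) v = if e ∈ I then 1 else 0) ∧
    ∀ m : S → ℤ, ∑ e ∈ I, (m (tgt e) - m (src e)) = 0
  /-- The difference of two perfect matchings is the boundary of a function on the faces. -/
  exact : ∀ F F' : Finset E, IsPM ends U F → IsPM ends U F' →
    ∃ g : S → ℤ, (Function.support g).Finite ∧
      ∀ e, g (tgt e) + (if e ∈ F then 1 else 0) = g (src e) + (if e ∈ F' then 1 else 0)
  /-- The region is connected: one can pass between any two faces that meet the region across edges
  that meet the region. -/
  conn : ∀ d : S → ℤ, (∀ e, (ends e).1 ∈ U ∨ (ends e).2 ∈ U → d (tgt e) = d (src e)) →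
    ∀ q q', (fv q ∩ U).Nonempty → (fv q' ∩ U).Nonempty → d q = d q'
  /-- There is a perfect matching with a height function. -/
  ref : ∃ (F : Finset E) (h : S → ℤ), IsPM ends U F ∧
    ∀ e, (ends e).1 ∈ U ∨ (ends e).2 ∈ U → h (tgt e) = h (src e) + H e - if e ∈ F then 6 else 0
  /-- The complement of the region is connected: one can pass from every face outside of the region
  to infinity without crossing an edge of the region. -/
  outer : ∀ g : S → ℤ, (Function.support g).Finite →
    (∀ e, ¬((ends e).1 ∈ U ∧ (ends e).2 ∈ U) → g (tgt e) = g (src e)) → ∀ q, ¬fv q ⊆ U → g q = 0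
  /-- One can pass from every face to infinity. -/
  unique : ∀ g : S → ℤ, (Function.support g).Finite → (∀ e, g (tgt e) = g (src e)) → g = 0

/-- A function with finite support on the faces vanishes at a face if it does not change between
this face and infinity, in one of the two directions along the row. -/
lemma eq_zero_of_row {g : LFace → ℤ} (hg : (Function.support g).Finite) {q : LFace}
    (h : (∀ q', q'.line = q.line → q.place ≤ q'.place → g q'.next = g q') ∨
      (∀ q', q'.line = q.line → q'.place < q.place → g q'.next = g q')) : g q = 0 := by
  by_contra hq
  rcases h with h | h
  · have h1 : ∀ k : ℕ, (LFace.next^[k] q).line = q.line ∧ (LFace.next^[k] q).place = q.place + k ∧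
        g (LFace.next^[k] q) = g q := by
      intro k
      induction k with
      | zero => simp
      | succ k ih =>
        obtain ⟨h1, h2, h3⟩ := ih
        rw [Function.iterate_succ_apply', LFace.line_next, LFace.place_next, h1, h2,
          h _ h1 (by omega)]
        exact ⟨rfl, by push_cast; ring, h3⟩
    refine Set.infinite_of_injective_forall_mem (f := fun k : ℕ ↦ LFace.next^[k] q) ?_ ?_ hg
    · intro k k' hk
      have h2 := (h1 k).2.1
      simp only at hk
      rw [hk, (h1 k').2.1] at h2
      omega
    · intro k
      rw [Function.mem_support, (h1 k).2.2]
      exact hq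
  · have hs : ∀ q : LFace, ∃ q' : LFace, q'.next = q := by
      rintro (⟨x, y⟩ | ⟨x, y⟩ | ⟨x, y⟩ | ⟨x, y⟩ | ⟨x, y⟩ | ⟨x, y⟩)
      exacts [⟨.n x y, rfl⟩, ⟨.nw x y, rfl⟩, ⟨.ne (x - 1) y, by simp [LFace.next]⟩,
        ⟨.se (x - 1) y, by simp [LFace.next]⟩, ⟨.sw x y, rfl⟩, ⟨.s x y, rfl⟩]
    choose prev hprev using hs
    have h1 : ∀ k : ℕ, (prev^[k] q).line = q.line ∧ (prev^[k] q).place = q.place - k ∧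
        g (prev^[k] q) = g q := by
      intro k
      induction k with
      | zero => simp
      | succ k ih =>
        obtain ⟨h1, h2, h3⟩ := ih
        have h4 := LFace.line_next (prev (prev^[k] q))
        have h5 := LFace.place_next (prev (prev^[k] q))
        rw [hprev] at h4 h5
        rw [Function.iterate_succ_apply', ← h4, ← h (prev (prev^[k] q)) (by omega) (by omega),
          hprev]
        exact ⟨h1, by push_cast; omega, h3⟩
    refine Set.infinite_of_injective_forall_mem (f := fun k : ℕ ↦ prev^[k] q) ?_ ?_ hg
    · intro k k' hk
      have h2 := (h1 k).2.1
      simp only at hk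
      rw [hk, (h1 k').2.1] at h2
      omega
    · intro k
      rw [Function.mem_support, (h1 k).2.2]
      exact hq

lemma next_eq_of_nextEdge {g : LFace → ℤ} {q : LFace}
    (h : g (ltgt q.nextEdge) = g (lsrc q.nextEdge)) : g q.next = g q := by
  rcases q.nextEdge_eq with ⟨h1, h2⟩ | ⟨h1, h2⟩ <;> rw [h1, h2] at h
  exacts [h, h.symm]

section region

variable {p r : ℤ} {x y : ℤ}

lemma mem_region_tf (hp : 0 ≤ p) (hr : 0 ≤ r) : .t (false, x, y) ∈ region p r ↔
    (y ≤ 0 ∧ x ≤ p ∧ 1 ≤ x + y) ∨ (1 ≤ y ∧ 1 ≤ x ∧ x + y ≤ r) := by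
  rw [region, t_mem_vertFinset, mem_regT_false hp hr]

lemma mem_region_tt (hp : 0 ≤ p) (hr : 0 ≤ r) : .t (true, x, y) ∈ region p r ↔
    (y ≤ 0 ∧ x ≤ p - 1 ∧ 1 ≤ x + y) ∨ (1 ≤ y ∧ 0 ≤ x ∧ x + y ≤ r) := by
  rw [region, t_mem_vertFinset, mem_regT_true hp hr]

lemma mem_region_qf (hp : 0 ≤ p) (hr : 0 ≤ r) : .q (false, x, y) ∈ region p r ↔
    (y ≤ 0 ∧ x ≤ p ∧ 1 ≤ x + y) ∨ (1 ≤ y ∧ 1 ≤ x ∧ x + y ≤ r) := by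
  rw [region, q_mem_vertFinset, mem_regQ_false hp hr]

lemma mem_region_qt (hp : 0 ≤ p) (hr : 0 ≤ r) : .q (true, x, y) ∈ region p r ↔
    (y ≤ 0 ∧ x ≤ p - 1 ∧ 0 ≤ x + y) ∨ (1 ≤ y ∧ 0 ≤ x ∧ x + y ≤ r) := by
  rw [region, q_mem_vertFinset, mem_regQ_true hp hr]

lemma mem_region_p (hp : 0 ≤ p) (hr : 0 ≤ r) : .p (x, y) ∈ region p r ↔
    (y ≤ 0 ∧ x ≤ p ∧ 1 ≤ x + y) ∨ (1 ≤ y ∧ 0 ≤ x ∧ x + y ≤ r) := by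
  rw [region, p_mem_vertFinset, mem_regP hp hr]

lemma mem_region_d (hp : 0 ≤ p) (hr : 0 ≤ r) : .d (x, y) ∈ region p r ↔
    (y < 0 ∧ x ≤ p - 1 ∧ 0 ≤ x + y) ∨ (0 ≤ y ∧ 1 ≤ x ∧ x + y ≤ r) := by
  rw [region, d_mem_vertFinset, mem_regD hp hr]

/-- East of this place, the row of faces on the line `l` is crossed by no edge of the region. -/
def rowEast (p r l : ℤ) : ℤ :=
  if l % 2 = 1 then (if 3 ≤ l then 3 * (r - l / 2) + 1 else if l = 1 then 2 * p + r + 1 else 3 * p)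
  else (if 2 ≤ l then 3 * (r - l / 2) + 2 else 3 * p - 1)

/-- West of this place, the row of faces on the line `l` is crossed by no edge of the region. -/
def rowWest (l : ℤ) : ℤ :=
  if l % 2 = 1 then (if 3 ≤ l then 1 else 1 - 3 * (l / 2))
  else (if 2 ≤ l then 0 else 2 - 3 * (l / 2))

/-- The complement of a region meets each row of faces in an initial and a final part of the row:
beyond `rowEast` and `rowWest` one can walk to infinity along the row without crossing an edge of
the region. -/
lemma nextEdge_not_inside (hr : 0 ≤ r) (hp : r ≤ p) (hp' : p ≤ r + 1) (q : LFace)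
    (hq : rowEast p r q.line ≤ q.place ∨ q.place < rowWest q.line) :
    ¬((lat.ends q.nextEdge).1 ∈ region p r ∧ (lat.ends q.nextEdge).2 ∈ region p r) := by
  have hp0 : 0 ≤ p := hr.trans hp
  rcases q with ⟨x, y⟩ | ⟨x, y⟩ | ⟨x, y⟩ | ⟨x, y⟩ | ⟨x, y⟩ | ⟨x, y⟩ <;>
  simp only [LFace.line, LFace.place, rowEast, rowWest] at hq <;>
  simp only [LFace.nextEdge, lat, CellGraph.ends, Bool.false_eq_true, if_true, if_false,
    mem_region_tf hp0 hr, mem_region_tt hp0 hr, mem_region_qf hp0 hr,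
    mem_region_qt hp0 hr, mem_region_p hp0 hr, mem_region_d hp0 hr] <;>
  split_ifs at hq <;> omega

/-- A face that is not contained in the region lies beyond one of the ends of the region in its row.
-/
lemma outside_of_not_subset (hr : 0 ≤ r) (hp : r ≤ p) (hp' : p ≤ r + 1) (q : LFace)
    (hq : ¬lverts q ⊆ region p r) :
    rowEast p r q.line ≤ q.place ∨ q.place ≤ rowWest q.line := by
  have hp0 : 0 ≤ p := hr.trans hp
  rcases q with ⟨x, y⟩ | ⟨x, y⟩ | ⟨x, y⟩ | ⟨x, y⟩ | ⟨x, y⟩ | ⟨x, y⟩ <;>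
  simp only [lverts, Set.insert_subset_iff, Set.singleton_subset_iff, Finset.mem_coe,
    mem_region_tf hp0 hr, mem_region_tt hp0 hr, mem_region_qf hp0 hr,
    mem_region_qt hp0 hr, mem_region_p hp0 hr, mem_region_d hp0 hr] at hq <;>
  simp only [LFace.line, LFace.place, rowEast, rowWest] <;>
  split_ifs <;> omega

end region

/-- A choice of an edge at each vertex in `U` defines a perfect matching if the two ends of each of
the chosen edges belong to `U` and choose the same edge. -/
lemma isPM_image {E V : Type*} [DecidableEq E] {ends : E → V × V} (U : Finset V) (f : V → E)
    (h1 : ∀ v ∈ U, (ends (f v)).1 = v ∨ (ends (f v)).2 = v)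
    (h2 : ∀ v ∈ U, (ends (f v)).1 ∈ U ∧ f (ends (f v)).1 = f v)
    (h3 : ∀ v ∈ U, (ends (f v)).2 ∈ U ∧ f (ends (f v)).2 = f v)
    (h4 : ∀ e, (ends e).1 ≠ (ends e).2) : IsPM ends U (U.image f) := by
  have key : ∀ v ∈ U, ∀ v', (ends (f v)).1 = v' ∨ (ends (f v)).2 = v' → v' ∈ U ∧ f v' = f v := by
    rintro v hv v' (rfl | rfl)
    exacts [h2 v hv, h3 v hv]
  intro v
  by_cases hv : v ∈ U
  · rw [if_pos (by simpa using hv), Finset.sum_eq_single_of_mem (f v)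
      (Finset.mem_image_of_mem _ hv)]
    · have := h4 (f v)
      unfold inc
      rcases h1 v hv with h | h
      · rw [if_pos h, if_neg (fun h' ↦ this (h.trans h'.symm))]
      · rw [if_pos h, if_neg (fun h' ↦ this (h'.trans h.symm))]
    · intro e he hne
      obtain ⟨u, hu, rfl⟩ := Finset.mem_image.1 he
      rw [inc_eq_zero, ← not_or]
      exact fun h ↦ hne (key u hu v h).2.symm
  · rw [if_neg (by simpa using hv), Finset.sum_eq_zero_iff]
    intro e he
    obtain ⟨u, hu, rfl⟩ := Finset.mem_image.1 he
    rw [inc_eq_zero, ← not_or]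
    exact fun h ↦ hv (key u hu v h).1

/-- The edge at a vertex in the reference matching, a perfect matching of the whole lattice that is
invariant under translations along the rows. -/
def refEdge : LVert → LEdge
  | .p (x, y) => if 1 ≤ y then .inl ((true, x, y), some (false, true))
      else .inl ((false, x, y), some (false, true))
  | .q (true, x, y) => if 1 ≤ y then .inl ((true, x, y), some (false, true))
      else .inl ((false, x + 1, y), some (false, true))
  | .d (x, y) => if 0 ≤ y then .inl ((true, x - 1, y + 1), none) else .inl ((false, x + 1, y), none)
  | .q (false, x, y) => if 0 ≤ y then .inl ((false, x, y), some (true, false))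
      else .inl ((true, x - 1, y + 1), some (true, false))
  | .t (false, x, y) => if 0 ≤ y then .inl ((false, x, y), some (true, false))
      else .inl ((false, x, y), none)
  | .t (true, x, y) => if 1 ≤ y then .inl ((true, x, y), none)
      else .inl ((true, x, y), some (true, false))

/-- The height function of the reference matching. -/
def refHeight : LFace → ℤ
  | .ne _ y => 3 * |2 * y| + 1
  | .n _ y => 3 * |2 * y|
  | .nw _ y => 3 * |2 * y| - 1
  | .sw _ y => 3 * |2 * y - 1| + 1
  | .s _ y => 3 * |2 * y - 1|
  | .se _ y => 3 * |2 * y - 1| - 1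

lemma refEdge_ends (v : LVert) :
    ((lat.ends (refEdge v)).1 = v ∨ (lat.ends (refEdge v)).2 = v) ∧
      refEdge (lat.ends (refEdge v)).1 = refEdge v ∧
      refEdge (lat.ends (refEdge v)).2 = refEdge v := by
  rcases v with ⟨_ | _, x, y⟩ | ⟨_ | _, x, y⟩ | ⟨x, y⟩ | ⟨x, y⟩ <;>
  simp only [refEdge] <;> split_ifs <;> simp [lat, CellGraph.ends] <;> omega

/-- The reference matching covers each vertex once, so that an edge belongs to it if and only if it
is the edge chosen at its first end. -/
lemma refHeight_eq (e : LEdge) [Decidable (e = refEdge (lat.ends e).1)] :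
    refHeight (ltgt e) = refHeight (lsrc e) + lheight e -
      if e = refEdge (lat.ends e).1 then 6 else 0 := by
  rcases e with ⟨⟨_ | _, x, y⟩, _ | ⟨_ | _, _ | _⟩⟩ | ⟨_ | _, x, y⟩ <;>
  simp only [refHeight, abs_eq_max_neg, ltgt, lsrc, lheight, lat, CellGraph.ends, refEdge] <;>
  split_ifs <;>
  simp_all <;> omega

variable {p r : ℤ}

/-- The region is a union of edges of the reference matching. -/
lemma region_ref (hr : 0 ≤ r) (hp : r ≤ p) (hp' : p ≤ r + 1) (v : LVert) (hv : v ∈ region p r) :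
    (lat.ends (refEdge v)).1 ∈ region p r ∧ (lat.ends (refEdge v)).2 ∈ region p r := by
  have hp0 : 0 ≤ p := hr.trans hp
  rcases v with ⟨_ | _, x, y⟩ | ⟨_ | _, x, y⟩ | ⟨x, y⟩ | ⟨x, y⟩ <;>
  simp only [mem_region_tf hp0 hr, mem_region_tt hp0 hr, mem_region_qf hp0 hr,
    mem_region_qt hp0 hr, mem_region_p hp0 hr, mem_region_d hp0 hr] at hv <;>
  simp only [refEdge] <;> split_ifs <;>
  simp only [lat, CellGraph.ends, Bool.false_eq_true, if_true, if_false,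
    mem_region_tf hp0 hr, mem_region_tt hp0 hr, mem_region_qf hp0 hr,
    mem_region_qt hp0 hr, mem_region_p hp0 hr, mem_region_d hp0 hr] <;> omega

/-- One of the faces at a vertex. -/
def baseFace : LVert → LFace
  | .p (x, y) | .d (x, y) => .n x y
  | .q (false, x, y) | .t (false, x, y) => .nw x y
  | .q (true, x, y) => .ne x y
  | .t (true, x, y) => .se x y

/-- A function on the faces that does not change across the edges at the vertex `v` is constant on
the faces around `v`. -/
lemma eq_baseFace {d : LFace → ℤ} {v : LVert} (h : ∀ e ∈ edgesAt v, d (ltgt e) = d (lsrc e))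
    {q : LFace} (hv : v ∈ lverts q) : d q = d (baseFace v) := by
  rcases q with ⟨x', y'⟩ | ⟨x', y'⟩ | ⟨x', y'⟩ | ⟨x', y'⟩ | ⟨x', y'⟩ | ⟨x', y'⟩ <;>
  simp only [lverts, Set.mem_insert_iff, Set.mem_singleton_iff] at hv <;>
  rcases hv with rfl | rfl | rfl | rfl <;>
  simp [edgesAt, lsrc, ltgt, baseFace] at h ⊢ <;> omega

/-- A function on the faces that does not change across the edges at the vertices of the region is
constant on the faces that meet the region. -/
lemma conn_region (hr : 0 ≤ r) (hp : r ≤ p) (hp' : p ≤ r + 1) {d : LFace → ℤ}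
    (hd : ∀ v ∈ region p r, ∀ e ∈ edgesAt v, d (ltgt e) = d (lsrc e)) {q : LFace} {v : LVert}
    (hv : v ∈ region p r) (hq : v ∈ lverts q) : d q = d (.n 1 0) := by
  have hp0 : 0 ≤ p := hr.trans hp
  -- the hubs in row 0
  have h0 : ∀ k : ℕ, .p (1 + k, 0) ∈ region p r → d (.n (1 + k) 0) = d (.n 1 0) := by
    intro k
    induction k with
    | zero => intro _; norm_num
    | succ k ih =>
      intro h
      rw [mem_region_p hp0 hr] at h
      push_cast at h ⊢
      have h1 : .p (1 + (k : ℤ), 0) ∈ region p r := by rw [mem_region_p hp0 hr]; omega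
      have h2 : .p (1 + ((k : ℤ) + 1), 0) ∈ region p r := by rw [mem_region_p hp0 hr]; omega
      have h3 : .q (true, 1 + (k : ℤ), 0) ∈ region p r := by rw [mem_region_qt hp0 hr]; omega
      rw [← ih h1]
      have e1 := eq_baseFace (hd _ h1) (q := .ne (1 + k) 0) (by simp [lverts])
      have e2 := eq_baseFace (hd _ h2) (q := .nw (1 + (k + 1)) 0) (by simp [lverts])
      have e3 := eq_baseFace (hd _ h3) (q := .nw (1 + (k + 1)) 0) (by simp [lverts]; omega)
      simp only [baseFace] at e1 e2 e3
      omega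
  -- the step between the hubs along an antidiagonal
  have hstep : ∀ x y, .p (x, y) ∈ region p r → .p (x - 1, y + 1) ∈ region p r →
      .q (false, x, y) ∈ region p r → d (.n x y) = d (.n (x - 1) (y + 1)) := by
    intro x y h1 h2 h3
    have e1 := eq_baseFace (hd _ h1) (q := .nw x y) (by simp [lverts])
    have e2 := eq_baseFace (hd _ h2) (q := .s (x - 1) (y + 1)) (by simp [lverts])
    have e3 := eq_baseFace (hd _ h3) (q := .s (x - 1) (y + 1)) (by simp [lverts])
    simp only [baseFace] at e1 e2 e3
    omega
  have hlow : ∀ k : ℕ, ∀ x, .p (x, -(k : ℤ)) ∈ region p r → d (.n x (-k)) = d (.n 1 0) := by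
    intro k
    induction k with
    | zero =>
      intro x h
      have h1 := h
      rw [mem_region_p hp0 hr] at h1
      have h2 := h0 (x - 1).toNat
      have e : 1 + (((x - 1).toNat : ℕ) : ℤ) = x := by omega
      rw [e] at h2
      simpa using h2 (by simpa using h)
    | succ k ih =>
      intro x h
      have h1 := h
      rw [mem_region_p hp0 hr] at h1
      push_cast at h h1 ⊢
      have h2 : .p (x - 1, -((k : ℤ) + 1) + 1) ∈ region p r := by rw [mem_region_p hp0 hr]; omega
      rw [hstep _ _ h h2 (by rw [mem_region_qf hp0 hr]; omega)]
      have e : -((k : ℤ) + 1) + 1 = -k := by ring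
      rw [e] at h2 ⊢
      exact ih _ h2
  have hup : ∀ k : ℕ, ∀ x, .p (x, (k : ℤ)) ∈ region p r → d (.n x k) = d (.n 1 0) := by
    intro k
    induction k with
    | zero => intro x h; simpa using hlow 0 x (by simpa using h)
    | succ k ih =>
      intro x h
      have h1 := h
      rw [mem_region_p hp0 hr] at h1
      push_cast at h h1 ⊢
      have h2 : .p (x + 1, (k : ℤ)) ∈ region p r := by rw [mem_region_p hp0 hr]; omega
      rw [← ih _ h2, hstep (x + 1) k h2 (by rw [mem_region_p hp0 hr]; omega)
        (by rw [mem_region_qf hp0 hr]; omega), add_sub_cancel_right]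
  have hhub : ∀ x y, .p (x, y) ∈ region p r → d (.n x y) = d (.n 1 0) := by
    intro x y h
    rcases le_total 0 y with hy | hy
    · lift y to ℕ using hy
      exact hup y x h
    · obtain ⟨k, rfl⟩ : ∃ k : ℕ, y = -(k : ℤ) := ⟨(-y).toNat, by omega⟩
      exact hlow k x h
  rw [eq_baseFace (hd v hv) hq]
  -- every vertex of the region lies on a face with a hub in the region
  rcases v with ⟨_ | _, x, y⟩ | ⟨_ | _, x, y⟩ | ⟨x, y⟩ | ⟨x, y⟩
  · have h := hv
    rw [mem_region_tf hp0 hr] at h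
    have h1 : .p (x, y) ∈ region p r := by rw [mem_region_p hp0 hr]; omega
    rw [← hhub x y h1]
    exact eq_baseFace (hd _ h1) (by simp [lverts, baseFace])
  · have h := hv
    rw [mem_region_tt hp0 hr] at h
    have h1 : .p (x, y) ∈ region p r := by rw [mem_region_p hp0 hr]; omega
    rw [← hhub x y h1]
    exact eq_baseFace (hd _ h1) (by simp [lverts, baseFace])
  · have h := hv
    rw [mem_region_qf hp0 hr] at h
    have h1 : .p (x, y) ∈ region p r := by rw [mem_region_p hp0 hr]; omega
    rw [← hhub x y h1]
    exact eq_baseFace (hd _ h1) (by simp [lverts, baseFace])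
  · have h := hv
    rw [mem_region_qt hp0 hr] at h
    by_cases hy : 1 ≤ y
    · have h1 : .p (x, y) ∈ region p r := by rw [mem_region_p hp0 hr]; omega
      rw [← hhub x y h1]
      exact eq_baseFace (hd _ h1) (by simp [lverts, baseFace])
    · have h1 : .p (x + 1, y) ∈ region p r := by rw [mem_region_p hp0 hr]; omega
      rw [← hhub (x + 1) y h1, ← eq_baseFace (hd _ hv) (q := .nw (x + 1) y) (by simp [lverts])]
      exact eq_baseFace (hd _ h1) (by simp [lverts])
  · exact hhub x y hv
  · have h := hv
    rw [mem_region_d hp0 hr] at h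
    by_cases hy : 0 ≤ y
    · have h1 : .p (x, y) ∈ region p r := by rw [mem_region_p hp0 hr]; omega
      exact hhub x y h1
    · have h1 : .p (x, y + 1) ∈ region p r := by rw [mem_region_p hp0 hr]; omega
      rw [← hhub x (y + 1) h1, ← eq_baseFace (hd _ hv) (q := .s x (y + 1)) (by simp [lverts])]
      exact eq_baseFace (hd _ h1) (by simp [lverts])

/-- Besides connectedness, the properties of the shape that matter are that the reference matching
of the lattice restricts to the region, and that each row of faces meets the region in an interval.
-/
theorem goodRegion_region (hr : 0 ≤ r) (hp : r ≤ p) (hp' : p ≤ r + 1) :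
    GoodRegion lat.ends lsrc ltgt lheight lverts (region p r : Set LVert) where
  finite := (region p r).finite_toSet
  circ v _ := by
    classical
    refine ⟨(edgesAt v).toFinset, fun e ↦ ?_, fun m ↦ ?_⟩
    · have := ends_ne e
      simp only [List.mem_toFinset, mem_edgesAt, inc]
      by_cases h1 : (lat.ends e).1 = v
      · have h2 : (lat.ends e).2 ≠ v := fun h ↦ this (h1.trans h.symm)
        simp [h1, h2]
      · by_cases h2 : (lat.ends e).2 = v <;> simp [h1, h2]
    · rw [List.sum_toFinset _ (nodup_edgesAt v), circulation_edgesAt]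
  exact F F' h h' := by
    obtain ⟨g, h1, h2⟩ := exists_potential h h'
    exact ⟨g, h1, fun e ↦ by convert h2 e⟩
  conn d hd q q' := by
    rintro ⟨v, hq, hv⟩ ⟨v', hq', hv'⟩
    have h1 : ∀ v ∈ region p r, ∀ e ∈ edgesAt v, d (ltgt e) = d (lsrc e) := by
      intro v hv e he
      refine hd e ?_
      rcases mem_edgesAt.1 he with h | h <;> rw [h]
      exacts [Or.inl hv, Or.inr hv]
    rw [conn_region hr hp hp' h1 hv hq, conn_region hr hp hp' h1 hv' hq']
  ref := by
    classical
    refine ⟨(region p r).image refEdge, refHeight, ?_, ?_⟩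
    · refine isPM_image _ _ (fun v _ ↦ (refEdge_ends v).1)
        (fun v hv ↦ ⟨(region_ref hr hp hp' v hv).1, (refEdge_ends v).2.1⟩)
        (fun v hv ↦ ⟨(region_ref hr hp hp' v hv).2, (refEdge_ends v).2.2⟩) ends_ne
    · intro e he
      have hm : e = refEdge (lat.ends e).1 ↔ e ∈ (region p r).image refEdge := by
        rw [Finset.mem_image]
        constructor
        · intro h
          rcases he with he | he
          · exact ⟨_, he, h.symm⟩
          · refine ⟨_, he, ?_⟩
            have := (refEdge_ends (lat.ends e).1).2.2
            rw [← h] at this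
            exact this
        · rintro ⟨v, -, rfl⟩
          exact (refEdge_ends v).2.1.symm
      rw [refHeight_eq e]
      by_cases h : e = refEdge (lat.ends e).1
      · rw [if_pos h, if_pos (hm.1 h)]
      · rw [if_neg h, if_neg (mt hm.2 h)]
  outer g hg h q hq := by
    refine eq_zero_of_row hg ?_
    rcases outside_of_not_subset hr hp hp' q hq with h1 | h1
    · refine Or.inl fun q' hl hq' ↦ next_eq_of_nextEdge (h _ ?_)
      refine nextEdge_not_inside hr hp hp' q' (Or.inl ?_)
      rw [hl]; omega
    · refine Or.inr fun q' hl hq' ↦ next_eq_of_nextEdge (h _ ?_)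
      refine nextEdge_not_inside hr hp hp' q' (Or.inr ?_)
      rw [hl]; omega
  unique g hg h := by
    funext q
    exact eq_zero_of_row hg (Or.inl fun q' _ _ ↦ next_eq_of_nextEdge (h _))

/-! ### The pile of tiles of a perfect matching -/

namespace GoodRegion

variable {E V S : Type*} {ends : E → V × V} {src tgt : E → S} {H : E → ℤ} {fv : S → Set V}
  {U : Set V}

/-- Reversal of all arrows turns height functions into their negatives. -/
lemma flip (h : GoodRegion ends src tgt H fv U) : GoodRegion ends tgt src H fv U where
  finite := h.finite
  circ v hv := by
    obtain ⟨I, h1, h2⟩ := h.circ v hv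
    refine ⟨I, h1, fun m ↦ ?_⟩
    rw [← neg_eq_zero, ← h2 m, ← Finset.sum_neg_distrib]
    exact Finset.sum_congr rfl fun e _ ↦ by ring
  exact F F' hF hF' := by
    obtain ⟨g, hg, h1⟩ := h.exact F' F hF' hF
    exact ⟨g, hg, fun e ↦ (h1 e).symm⟩
  conn d hd := h.conn d fun e he ↦ (hd e he).symm
  ref := by
    obtain ⟨F, g, hF, hg⟩ := h.ref
    refine ⟨F, fun q ↦ -g q, hF, fun e he ↦ ?_⟩
    have := hg e he
    linarith
  outer g hg h1 := h.outer g hg fun e he ↦ (h1 e he).symm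
  unique g hg h1 := h.unique g hg fun e ↦ (h1 e).symm

/-- The theory of heights is transported by isomorphisms of plane graphs. -/
lemma map {E' V' S' : Type*} {ends' : E' → V' × V'} {src' tgt' : E' → S'} {H' : E' → ℤ}
    {fv' : S' → Set V'} (h : GoodRegion ends src tgt H fv U) (φE : E ≃ E') {φV : V → V'}
    (hφ : Function.Injective φV) (φS : S ≃ S')
    (he : ∀ e, ends' (φE e) = Prod.map φV φV (ends e) ∨
      ends' (φE e) = (Prod.map φV φV (ends e)).swap)
    (hsrc : ∀ e, src' (φE e) = φS (src e)) (htgt : ∀ e, tgt' (φE e) = φS (tgt e))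
    (hH : ∀ e, H' (φE e) = H e) (hfv : ∀ q, fv' (φS q) = φV '' fv q) :
    GoodRegion ends' src' tgt' H' fv' (φV '' U) := by
  classical
  have hor : ∀ e, ((ends' (φE e)).1 ∈ φV '' U ∨ (ends' (φE e)).2 ∈ φV '' U) ↔
      (ends e).1 ∈ U ∨ (ends e).2 ∈ U := by
    intro e
    rcases he e with h1 | h1 <;> simp [h1, hφ.mem_set_image, or_comm]
  have hand : ∀ e, ((ends' (φE e)).1 ∈ φV '' U ∧ (ends' (φE e)).2 ∈ φV '' U) ↔
      (ends e).1 ∈ U ∧ (ends e).2 ∈ U := by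
    intro e
    rcases he e with h1 | h1 <;> simp [h1, hφ.mem_set_image, and_comm]
  have hinc : ∀ e v, inc (ends' (φE e)) (φV v) = inc (ends e) v := by
    intro e v
    rcases he e with h1 | h1 <;> rw [h1]
    · rw [inc_map hφ]
    · rw [inc_swap, inc_map hφ]
  have hsupp : ∀ g : S' → ℤ, (Function.support g).Finite → (Function.support (g ∘ φS)).Finite := by
    intro g hg
    exact (hg.preimage φS.injective.injOn).subset (by intro q hq; simpa using hq)
  have hPM : ∀ F : Finset E', IsPM ends' (φV '' U) F →
      IsPM ends U (F.map φE.symm.toEmbedding) := by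
    intro F hF
    rw [← isPM_map φE hφ he]
    convert hF
    ext e
    simp
  have hmem : ∀ (F : Finset E') (e : E), e ∈ F.map φE.symm.toEmbedding ↔ φE e ∈ F := by
    intro F e
    simp [Finset.mem_map_equiv]
  refine ⟨h.finite.image _, ?_, ?_, ?_, ?_, ?_, ?_⟩
  · rintro _ ⟨v, hv, rfl⟩
    obtain ⟨I, h1, h2⟩ := h.circ v hv
    refine ⟨I.map φE.toEmbedding, fun e ↦ ?_, fun m ↦ ?_⟩
    · obtain ⟨e, rfl⟩ := φE.surjective e
      rw [hinc, h1]
      simp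
    · simpa only [Finset.sum_map, Equiv.coe_toEmbedding, hsrc, htgt,
        Function.comp_apply] using h2 (m ∘ φS)
  · intro F F' hF hF'
    obtain ⟨g, hg, h1⟩ := h.exact _ _ (hPM F hF) (hPM F' hF')
    refine ⟨g ∘ φS.symm, ?_, fun e ↦ ?_⟩
    · exact (hg.image φS).subset (by intro q hq; exact ⟨φS.symm q, by simpa using hq, by simp⟩)
    · obtain ⟨e, rfl⟩ := φE.surjective e
      have := h1 e
      simp only [hmem] at this
      simpa only [hsrc, htgt, Function.comp_apply, Equiv.symm_apply_apply] using this
  · intro d hd q q' hq hq'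
    obtain ⟨q, rfl⟩ := φS.surjective q
    obtain ⟨q', rfl⟩ := φS.surjective q'
    rw [hfv, ← Set.image_inter hφ, Set.image_nonempty] at hq hq'
    refine h.conn (d ∘ φS) (fun e h1 ↦ ?_) q q' hq hq'
    simpa only [hsrc, htgt, Function.comp_apply] using hd (φE e) ((hor e).2 h1)
  · obtain ⟨F, g, hF, hg⟩ := h.ref
    refine ⟨F.map φE.toEmbedding, g ∘ φS.symm, (isPM_map φE hφ he).2 hF, fun e h1 ↦ ?_⟩
    obtain ⟨e, rfl⟩ := φE.surjective e
    have := hg e ((hor e).1 h1)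
    simpa [hsrc, htgt, hH] using this
  · intro g hg h1 q hq
    obtain ⟨q, rfl⟩ := φS.surjective q
    rw [hfv, Set.image_subset_image_iff hφ] at hq
    refine h.outer (g ∘ φS) (hsupp g hg) (fun e h2 ↦ ?_) q hq
    simpa only [hsrc, htgt, Function.comp_apply] using h1 (φE e) (fun h3 ↦ h2 ((hand e).1 h3))
  · intro g hg h1
    have := h.unique (g ∘ φS) (hsupp g hg) (fun e ↦ by
      simpa only [hsrc, htgt, Function.comp_apply] using h1 (φE e))
    funext q
    obtain ⟨q, rfl⟩ := φS.surjective q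
    exact congrFun this q

/-- Only finitely many edges meet the region, since the arrows around a vertex form a finite cycle.
-/
lemma finite_isPM (h : GoodRegion ends src tgt H fv U) : {F : Finset E | IsPM ends U F}.Finite := by
  classical
  have h1 : {e : E | (ends e).1 ∈ U}.Finite := by
    choose! I hI _ using h.circ
    refine (h.finite.biUnion (t := fun v ↦ (I v : Set E)) fun v _ ↦ (I v).finite_toSet).subset ?_
    intro e he
    rw [Set.mem_iUnion₂]
    refine ⟨_, he, ?_⟩
    by_contra hne
    have h2 := hI _ he e
    rw [if_neg (by simpa using hne)] at h2
    exact (inc_pos (Or.inl rfl)).ne' h2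
  refine (h1.toFinset.powerset.finite_toSet).subset fun F hF ↦ ?_
  rw [Finset.mem_coe, Finset.mem_powerset]
  intro e he
  simpa using IsPM.mem_of_inc hF he (Or.inl rfl)

open Classical in
/-- There is a perfect matching with the least height function.  The point is that the minimum of
two height functions is the height function of a perfect matching. -/
theorem exists_minimal (h : GoodRegion ends src tgt H fv U) :
    ∃ F₁ : Finset E, IsPM ends U F₁ ∧ ∀ F, IsPM ends U F →
      ∃ τ : S → ℕ, (Function.support τ).Finite ∧ (∀ q, ¬fv q ⊆ U → τ q = 0) ∧
        ∀ e, (τ (tgt e) : ℤ) + (if e ∈ F then 1 else 0) = τ (src e) + if e ∈ F₁ then 1 else 0 := by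
  obtain ⟨F₀, -, hF₀, -⟩ := h.ref
  have h0 : ∀ F, ∃ g : S → ℤ, IsPM ends U F → (Function.support g).Finite ∧
      ∀ e, g (tgt e) + (if e ∈ F then 1 else 0) = g (src e) + (if e ∈ F₀ then 1 else 0) := by
    intro F
    by_cases hF : IsPM ends U F
    · obtain ⟨g, hg⟩ := h.exact F F₀ hF hF₀
      exact ⟨g, fun _ ↦ hg⟩
    · exact ⟨0, fun h ↦ (hF h).elim⟩
  choose g hg using h0
  -- the matching `F₁` has the least total height; if `F` lay below it somewhere, the minimum of
  -- both would have a smaller one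
  obtain ⟨F₁, hF₁, hmin⟩ := h.finite_isPM.exists_minimalFor (fun F ↦ ∑ᶠ q, g F q) _ ⟨F₀, hF₀⟩
  refine ⟨F₁, hF₁, fun F hF ↦ ?_⟩
  obtain ⟨hs, he⟩ := hg F hF
  obtain ⟨hs₁, he₁⟩ := hg F₁ hF₁
  set u : S → ℤ := fun q ↦ g F q - g F₁ q with hu
  have hus : (Function.support u).Finite := (hs.union hs₁).subset (Function.support_sub _ _)
  have hue : ∀ e, u (tgt e) + (if e ∈ F then 1 else 0) = u (src e) + if e ∈ F₁ then 1 else 0 := by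
    intro e
    have h1 := he e
    have h2 := he₁ e
    simp only [hu]
    linarith
  set m : S → ℤ := fun q ↦ min (u q) 0 with hm
  have hms : (Function.support m).Finite := by
    refine hus.subset fun q hq hq' ↦ hq ?_
    simp only [hm, hq', min_self]
  -- the matching whose height is the minimum of the two heights
  set F' : Finset E := (F ∪ F₁).filter fun e ↦
    m (src e) + (if e ∈ F₁ then 1 else 0) = m (tgt e) + 1 with hF'
  have hme : ∀ e, m (tgt e) + (if e ∈ F' then 1 else 0) =
      m (src e) + if e ∈ F₁ then 1 else 0 := by
    intro e
    have h1 := hue e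
    simp only [hF', Finset.mem_filter, Finset.mem_union, hm]
    by_cases h2 : e ∈ F <;> by_cases h3 : e ∈ F₁ <;>
      simp only [h2, h3, if_true, if_false, or_true, or_false, true_and, false_and, add_zero]
        at h1 ⊢ <;> (try split_ifs) <;> omega
  have hPM : IsPM ends U F' := by
    intro v
    by_cases hv : v ∈ U
    · rw [if_pos hv]
      obtain ⟨I, hI, hc⟩ := h.circ v hv
      have hcount : ∀ F : Finset E, ∑ e ∈ F, inc (ends e) v = ∑ e ∈ I, if e ∈ F then 1 else 0 := by
        intro F
        simp only [hI]
        rw [Finset.sum_ite_mem, Finset.sum_ite_mem, Finset.inter_comm]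
      have h1 := hc m
      have h2 := hF₁ v
      rw [if_pos hv, hcount] at h2
      rw [hcount]
      have h3 : (∑ e ∈ I, if e ∈ F' then (1 : ℤ) else 0) =
          ∑ e ∈ I, (if e ∈ F₁ then (1 : ℤ) else 0) - ∑ e ∈ I, (m (tgt e) - m (src e)) := by
        rw [← Finset.sum_sub_distrib]
        refine Finset.sum_congr rfl fun e _ ↦ ?_
        have := hme e
        linarith
      rw [h1, sub_zero] at h3
      zify at h2 ⊢
      rw [h3, h2]
    · rw [if_neg hv, Finset.sum_eq_zero_iff]
      intro e he'
      rw [inc_eq_zero, ← not_or]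
      intro hv'
      rcases Finset.mem_union.1 (Finset.mem_filter.1 he').1 with h1 | h1
      exacts [hv (hF.mem_of_inc h1 hv'), hv (hF₁.mem_of_inc h1 hv')]
  obtain ⟨hs', he'⟩ := hg F' hPM
  have hgF' : g F' = fun q ↦ g F₁ q + m q := by
    have h1 := h.unique (fun q ↦ g F' q - (g F₁ q + m q)) ?_ fun e ↦ ?_
    · funext q
      have := congrFun h1 q
      simp only [Pi.zero_apply] at this
      linarith
    · refine ((hs'.union (hs₁.union hms)).subset ?_)
      refine (Function.support_sub _ _).trans (Set.union_subset_union_right _ ?_)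
      exact Function.support_add _ _
    · have h1 := he' e
      have h2 := he₁ e
      have h3 := hme e
      linarith
  have hsum : 0 ≤ ∑ᶠ q, m q := by
    have h1 : ∑ᶠ q, g F' q = ∑ᶠ q, g F₁ q + ∑ᶠ q, m q := by
      rw [hgF', finsum_add_distrib hs₁ hms]
    rcases le_total (∑ᶠ q, g F₁ q) (∑ᶠ q, g F' q) with h2 | h2
    · linarith
    · have := hmin hPM h2
      simp only at this
      linarith
  have hm0 : ∀ q, m q = 0 := by
    rw [finsum_eq_sum m hms] at hsum
    have hle : ∀ q ∈ hms.toFinset, m q ≤ 0 := fun q _ ↦ min_le_right _ _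
    have h1 := (Finset.sum_eq_zero_iff_of_nonpos hle).1
      (le_antisymm (Finset.sum_nonpos hle) hsum)
    intro q
    by_contra hq
    exact hq (h1 q (by simpa using hq))
  have hu0 : ∀ q, ((u q).toNat : ℤ) = u q := by
    intro q
    have := hm0 q
    simp only [hm] at this
    omega
  refine ⟨fun q ↦ (u q).toNat, ?_, fun q hq ↦ ?_, fun e ↦ ?_⟩
  · refine hus.subset fun q hq hq' ↦ hq ?_
    simp only [hq', Int.toNat_zero]
  · beta_reduce
    rw [h.outer u hus (fun e h1 ↦ ?_) q hq, Int.toNat_zero]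
    have h2 := hue e
    rw [if_neg, if_neg] at h2
    · linarith
    · exact fun h3 ↦ h1 ⟨hF₁.mem_of_inc h3 (Or.inl rfl), hF₁.mem_of_inc h3 (Or.inr rfl)⟩
    · exact fun h3 ↦ h1 ⟨hF.mem_of_inc h3 (Or.inl rfl), hF.mem_of_inc h3 (Or.inr rfl)⟩
  · rw [hu0, hu0]
    exact hue e

end GoodRegion

open Classical in
/-- The weights of two matchings differ by the weights of the faces over which the heights differ;
this is the discrete form of Stokes' theorem. -/
lemma sum_eq_add_finsum {E S Γ : Type*} [AddCommGroup Γ] {src tgt : E → S} {F F₁ : Finset E}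
    {τ : S → ℕ} (hτ : (Function.support τ).Finite)
    (he : ∀ e, (τ (tgt e) : ℤ) + (if e ∈ F then 1 else 0) = τ (src e) + if e ∈ F₁ then 1 else 0)
    (w : E → Γ) (φ : S → Γ) (out inn : S → Finset E) (hout : ∀ e q, e ∈ out q ↔ src e = q)
    (hinn : ∀ e q, e ∈ inn q ↔ tgt e = q)
    (hφ : ∀ q, ∑ e ∈ out q, w e = φ q + ∑ e ∈ inn q, w e) :
    ∑ e ∈ F, w e = ∑ e ∈ F₁, w e + ∑ q ∈ hτ.toFinset, τ q • φ q := by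
  set s := hτ.toFinset
  set B := F ∪ F₁ ∪ s.biUnion out ∪ s.biUnion inn with hB
  have h1 : ∀ F ⊆ B, ∑ e ∈ F, w e = ∑ e ∈ B, (if e ∈ F then (1 : ℤ) else 0) • w e := by
    intro F hF
    simp only [ite_smul, one_smul, zero_smul]
    rw [Finset.sum_ite_mem, Finset.inter_eq_right.2 hF]
  have h2 : ∀ (f : E → S) (o : S → Finset E), (∀ e q, e ∈ o q ↔ f e = q) → s.biUnion o ⊆ B →
      ∑ e ∈ B, (τ (f e) : ℤ) • w e = ∑ q ∈ s, τ q • ∑ e ∈ o q, w e := by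
    intro f o ho hoB
    have h3 : ∀ e, (τ (f e) : ℤ) • w e = ∑ q ∈ s, if f e = q then τ q • w e else 0 := by
      intro e
      rw [Finset.sum_ite_eq]
      split_ifs with h
      · rw [natCast_zsmul]
      · have : τ (f e) = 0 := by simpa [s] using h
        rw [this, Nat.cast_zero, zero_smul]
    rw [Finset.sum_congr rfl fun e _ ↦ h3 e, Finset.sum_comm]
    refine Finset.sum_congr rfl fun q hq ↦ ?_
    rw [← Finset.sum_filter, ← Finset.smul_sum]
    congr 1
    refine Finset.sum_congr ?_ fun _ _ ↦ rfl
    ext e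
    rw [Finset.mem_filter, ho]
    exact ⟨fun h ↦ h.2, fun h ↦ ⟨hoB (Finset.mem_biUnion.2 ⟨q, hq, (ho e q).2 h⟩), h⟩⟩
  have h4 : ∀ e, (if e ∈ F then (1 : ℤ) else 0) =
      (if e ∈ F₁ then 1 else 0) + τ (src e) - τ (tgt e) :=
    fun e ↦ by have := he e; linarith
  rw [h1 F (by intro e he; simp [hB, he]), h1 F₁ (by intro e he; simp [hB, he]),
    Finset.sum_congr rfl fun e _ ↦ congrArg (· • w e) (h4 e)]
  simp only [sub_smul, add_smul, Finset.sum_sub_distrib, Finset.sum_add_distrib]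
  rw [h2 src out hout (by
      intro e he; rw [hB, Finset.mem_union, Finset.mem_union]; exact Or.inl (Or.inr he)),
    h2 tgt inn hinn (by intro e he; rw [hB, Finset.mem_union]; exact Or.inr he)]
  simp only [hφ, smul_add, Finset.sum_add_distrib]
  abel

/-! ### The coordinates of the lattice -/

/-- The two ends of the lattice edge crossed by an arrow, the white one first. -/
def aends : Arrow → (ℤ × ℤ) × (ℤ × ℤ)
  | .long A k => (center A, mid A k)
  | .short A k => (corner A k, mid A k)

lemma edge_eq (e : Arrow) : e.edge = s((aends e).1, (aends e).2) := by cases e <;> rfl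

lemma mem_edge {e : Arrow} {v : ℤ × ℤ} : v ∈ e.edge ↔ (aends e).1 = v ∨ (aends e).2 = v := by
  rw [edge_eq, Sym2.mem_iff, eq_comm, eq_comm (a := v)]

lemma zmod6_cases (k : ZMod 6) : k = 0 ∨ k = 1 ∨ k = 2 ∨ k = 3 ∨ k = 4 ∨ k = 5 := by
  revert k; decide

lemma dir0 : dir 0 = (1, 0) := rfl
lemma dir1 : dir 1 = (0, 1) := rfl
lemma dir2 : dir 2 = (-1, 1) := rfl
lemma dir3 : dir 3 = (-1, 0) := rfl
lemma dir4 : dir 4 = (0, -1) := rfl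
lemma dir5 : dir 5 = (1, -1) := rfl

lemma center_mk (x y : ℤ) : center (x, y) = (6 * x, 6 * y) := rfl

lemma mid0 (x y : ℤ) : mid (x, y) 0 = (6 * x + 3, 6 * y) := by
  simp [mid, dir0]

lemma mid1 (x y : ℤ) : mid (x, y) 1 = (6 * x, 6 * y + 3) := by
  simp [mid, dir1]

lemma mid2 (x y : ℤ) : mid (x, y) 2 = (6 * x - 3, 6 * y + 3) := by
  simp [mid, dir2, sub_eq_add_neg]

lemma mid3 (x y : ℤ) : mid (x, y) 3 = (6 * x - 3, 6 * y) := by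
  simp [mid, dir3, sub_eq_add_neg]

lemma mid4 (x y : ℤ) : mid (x, y) 4 = (6 * x, 6 * y - 3) := by
  simp [mid, dir4, sub_eq_add_neg]

lemma mid5 (x y : ℤ) : mid (x, y) 5 = (6 * x + 3, 6 * y - 3) := by
  simp [mid, dir5, sub_eq_add_neg]

lemma corner0 (x y : ℤ) : corner (x, y) 0 = (6 * x + 2, 6 * y + 2) := by
  change (6 : ℤ) • ((x, y) : ℤ × ℤ) + (2 : ℤ) • (dir 0 + dir 1) = _
  simp [dir0, dir1]

lemma corner1 (x y : ℤ) : corner (x, y) 1 = (6 * x - 2, 6 * y + 4) := by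
  change (6 : ℤ) • ((x, y) : ℤ × ℤ) + (2 : ℤ) • (dir 1 + dir 2) = _
  simp [dir1, dir2, sub_eq_add_neg]

lemma corner2 (x y : ℤ) : corner (x, y) 2 = (6 * x - 4, 6 * y + 2) := by
  change (6 : ℤ) • ((x, y) : ℤ × ℤ) + (2 : ℤ) • (dir 2 + dir 3) = _
  simp [dir2, dir3, sub_eq_add_neg]

lemma corner3 (x y : ℤ) : corner (x, y) 3 = (6 * x - 2, 6 * y - 2) := by
  change (6 : ℤ) • ((x, y) : ℤ × ℤ) + (2 : ℤ) • (dir 3 + dir 4) = _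
  simp [dir3, dir4, sub_eq_add_neg]

lemma corner4 (x y : ℤ) : corner (x, y) 4 = (6 * x + 2, 6 * y - 4) := by
  change (6 : ℤ) • ((x, y) : ℤ × ℤ) + (2 : ℤ) • (dir 4 + dir 5) = _
  simp [dir4, dir5, sub_eq_add_neg]

lemma corner5 (x y : ℤ) : corner (x, y) 5 = (6 * x + 4, 6 * y - 2) := by
  change (6 : ℤ) • ((x, y) : ℤ × ℤ) + (2 : ℤ) • (dir 5 + dir 0) = _
  simp [dir5, dir0, sub_eq_add_neg]

/-- The position of a vertex of `lat` in the plane. -/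
def pos : LVert → ℤ × ℤ
  | .p (x, y) => (6 * x, 6 * y)
  | .d (x, y) => (6 * x, 6 * y + 3)
  | .q (false, x, y) => (6 * x - 3, 6 * y + 3)
  | .q (true, x, y) => (6 * x + 3, 6 * y)
  | .t (false, x, y) => (6 * x - 4, 6 * y + 2)
  | .t (true, x, y) => (6 * x + 4, 6 * y - 2)

lemma pos_injective : Function.Injective pos := by
  rintro (⟨_ | _, x, y⟩ | ⟨_ | _, x, y⟩ | ⟨x, y⟩ | ⟨x, y⟩)
    (⟨_ | _, x', y'⟩ | ⟨_ | _, x', y'⟩ | ⟨x', y'⟩ | ⟨x', y'⟩) h <;>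
  simp only [pos, Prod.mk.injEq] at h <;>
  first
  | (exfalso; omega)
  | (obtain rfl : x = x' := by omega
     obtain rfl : y = y' := by omega
     rfl)

/-- The arrow that crosses an edge of `lat`. -/
def arrow : LEdge → Arrow
  | .inl ((false, x, y), some (false, false)) => .long (x, y) 2
  | .inl ((false, x, y), some (false, true)) => .long (x, y) 3
  | .inl ((false, x, y), some (true, false)) => .short (x, y) 2
  | .inl ((false, x, y), some (true, true)) => .short (x - 1, y) 0
  | .inl ((false, x, y), none) => .short (x - 1, y + 1) 4
  | .inl ((true, x, y), some (false, false)) => .long (x, y) 5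
  | .inl ((true, x, y), some (false, true)) => .long (x, y) 0
  | .inl ((true, x, y), some (true, false)) => .short (x, y) 5
  | .inl ((true, x, y), some (true, true)) => .short (x + 1, y) 3
  | .inl ((true, x, y), none) => .short (x + 1, y - 1) 1
  | .inr (false, x, y) => .long (x, y) 1
  | .inr (true, x, y) => .long (x, y + 1) 4

lemma aends_arrow (e : LEdge) : aends (arrow e) = Prod.map pos pos (lat.ends e) := by
  rcases e with ⟨⟨_ | _, x, y⟩, _ | ⟨_ | _, _ | _⟩⟩ | ⟨_ | _, x, y⟩ <;>
  simp [arrow, aends, center_mk, mid0, mid1, mid2, mid3, mid4, mid5, corner0, corner1, corner2,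
    corner3, corner4, corner5, lat, CellGraph.ends, pos] <;> omega

lemma ends_injective : Function.Injective lat.ends := by
  rintro (⟨⟨_ | _, x, y⟩, _ | ⟨_ | _, _ | _⟩⟩ | ⟨_ | _, x, y⟩)
    (⟨⟨_ | _, x', y'⟩, _ | ⟨_ | _, _ | _⟩⟩ | ⟨_ | _, x', y'⟩) h <;>
  simp [lat, CellGraph.ends] at h ⊢ <;> omega

lemma arrow_bijective : Function.Bijective arrow := by
  constructor
  · intro e e' h
    have h1 := aends_arrow e
    rw [h, aends_arrow e'] at h1
    exact ends_injective ((pos_injective.prodMap pos_injective) h1.symm)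
  · rintro (⟨⟨x, y⟩, k⟩ | ⟨⟨x, y⟩, k⟩) <;>
    rcases zmod6_cases k with rfl | rfl | rfl | rfl | rfl | rfl
    exacts [⟨.inl ((true, x, y), some (false, true)), rfl⟩, ⟨.inr (false, x, y), rfl⟩,
      ⟨.inl ((false, x, y), some (false, false)), rfl⟩,
      ⟨.inl ((false, x, y), some (false, true)), rfl⟩,
      ⟨.inr (true, x, y - 1), by simp [arrow]⟩, ⟨.inl ((true, x, y), some (false, false)), rfl⟩,
      ⟨.inl ((false, x + 1, y), some (true, true)), by simp [arrow]⟩,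
      ⟨.inl ((true, x - 1, y + 1), none), by simp [arrow]⟩,
      ⟨.inl ((false, x, y), some (true, false)), rfl⟩,
      ⟨.inl ((true, x - 1, y), some (true, true)), by simp [arrow]⟩,
      ⟨.inl ((false, x + 1, y - 1), none), by simp [arrow]⟩,
      ⟨.inl ((true, x, y), some (true, false)), rfl⟩]

/-- The edges of `lat` and the arrows correspond to each other. -/
noncomputable def arrowEquiv : LEdge ≃ Arrow := Equiv.ofBijective arrow arrow_bijective

/-- The square that is a face of `lat`. -/
def toSquare : LFace → Square
  | .ne x y => ((x, y), 0)
  | .n x y => ((x, y), 1)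
  | .nw x y => ((x, y), 2)
  | .sw x y => ((x, y), 3)
  | .s x y => ((x, y), 4)
  | .se x y => ((x, y), 5)

lemma toSquare_bijective : Function.Bijective toSquare := by
  constructor
  · rintro (⟨x, y⟩ | ⟨x, y⟩ | ⟨x, y⟩ | ⟨x, y⟩ | ⟨x, y⟩ | ⟨x, y⟩)
      (⟨x', y'⟩ | ⟨x', y'⟩ | ⟨x', y'⟩ | ⟨x', y'⟩ | ⟨x', y'⟩ | ⟨x', y'⟩) h <;>
    simp +decide [toSquare] at h ⊢ <;> exact h
  · rintro ⟨⟨x, y⟩, k⟩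
    rcases zmod6_cases k with rfl | rfl | rfl | rfl | rfl | rfl
    exacts [⟨.ne x y, rfl⟩, ⟨.n x y, rfl⟩, ⟨.nw x y, rfl⟩, ⟨.sw x y, rfl⟩, ⟨.s x y, rfl⟩,
      ⟨.se x y, rfl⟩]

/-- The faces of `lat` and the squares correspond to each other. -/
noncomputable def squareEquiv : LFace ≃ Square := Equiv.ofBijective toSquare toSquare_bijective

lemma source_arrow (e : LEdge) : (arrow e).source = toSquare (lsrc e) := by
  rcases e with ⟨⟨_ | _, x, y⟩, _ | ⟨_ | _, _ | _⟩⟩ | ⟨_ | _, x, y⟩ <;>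
  simp +decide [arrow, Arrow.source, lsrc, toSquare, dir0, dir1, dir2, dir3, dir4, dir5] <;> ring

lemma target_arrow (e : LEdge) : (arrow e).target = toSquare (ltgt e) := by
  rcases e with ⟨⟨_ | _, x, y⟩, _ | ⟨_ | _, _ | _⟩⟩ | ⟨_ | _, x, y⟩ <;>
  simp +decide [arrow, Arrow.target, ltgt, toSquare]

lemma heightChange_arrow (e : LEdge) : (arrow e).heightChange = lheight e := by
  rcases e with ⟨⟨_ | _, x, y⟩, _ | ⟨_ | _, _ | _⟩⟩ | ⟨_ | _, x, y⟩ <;> rfl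

lemma squareVerts_mk {A : ℤ × ℤ} {k k' : ZMod 6} (h : k + 1 = k') :
    squareVerts (A, k) = {center A, mid A k, corner A k, mid A k'} := by
  rw [squareVerts, h]

lemma squareVerts_toSquare (q : LFace) : squareVerts (toSquare q) = pos '' lverts q := by
  rcases q with ⟨x, y⟩ | ⟨x, y⟩ | ⟨x, y⟩ | ⟨x, y⟩ | ⟨x, y⟩ | ⟨x, y⟩ <;>
  simp only [lverts, Set.image_insert_eq, Set.image_singleton, pos]
  · rw [toSquare, squareVerts_mk (k' := 1) rfl, center_mk, mid0, corner0, mid1]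
    ext ⟨u, v⟩; simp only [Set.mem_insert_iff, Set.mem_singleton_iff, Prod.mk.injEq]; omega
  · rw [toSquare, squareVerts_mk (k' := 2) rfl, center_mk, mid1, corner1, mid2]
    ext ⟨u, v⟩; simp only [Set.mem_insert_iff, Set.mem_singleton_iff, Prod.mk.injEq]; omega
  · rw [toSquare, squareVerts_mk (k' := 3) rfl, center_mk, mid2, corner2, mid3]
    ext ⟨u, v⟩; simp only [Set.mem_insert_iff, Set.mem_singleton_iff, Prod.mk.injEq]; omega
  · rw [toSquare, squareVerts_mk (k' := 4) rfl, center_mk, mid3, corner3, mid4]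
    ext ⟨u, v⟩; simp only [Set.mem_insert_iff, Set.mem_singleton_iff, Prod.mk.injEq]; omega
  · rw [toSquare, squareVerts_mk (k' := 5) rfl, center_mk, mid4, corner4, mid5]
    ext ⟨u, v⟩; simp only [Set.mem_insert_iff, Set.mem_singleton_iff, Prod.mk.injEq]; omega
  · rw [toSquare, squareVerts_mk (k' := 0) rfl, center_mk, mid5, corner5, mid0]
    ext ⟨u, v⟩; simp only [Set.mem_insert_iff, Set.mem_singleton_iff, Prod.mk.injEq]; omega

/-! ### Reflections of the lattice -/

lemma dir_add_three (k : ZMod 6) : dir (k + 3) = -dir k := by revert k; decide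

section reflection

variable (σ : ℤ × ℤ →+ ℤ × ℤ) (t : ZMod 6) (s : ℤ × ℤ)

/-- The reflection, or glide reflection, with the linear part `σ` that moves the hexagon `0` to the
hexagon `s`, on vertices. -/
def reflVert (v : ℤ × ℤ) : ℤ × ℤ := σ v + (6 : ℤ) • s

/-- A reflection that maps the direction `k` to the direction `t - k`, on arrows.  It reverses the
arrows. -/
def reflArrow : Arrow → Arrow
  | .long A k => .long (σ A + s) (t - k)
  | .short A k => .short (σ A + s + dir (t - k)) (t - k + 3)

/-- A reflection that maps the direction `k` to the direction `t - k`, on squares. -/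
def reflSquare (q : Square) : Square := (σ q.1 + s, t - 1 - q.2)

variable {σ t}

lemma reflVert_injective (hσ : ∀ A, σ (σ A) = A) : Function.Injective (reflVert σ s) := by
  intro v v' h
  have := add_right_cancel h
  rw [← hσ v, this, hσ]

lemma reflArrow_reflArrow (hσ : ∀ A, σ (σ A) = A) (ht : ∀ k, σ (dir k) = dir (t - k)) (e : Arrow) :
    reflArrow σ t (-σ s) (reflArrow σ t s e) = e := by
  rcases e with ⟨A, k⟩ | ⟨A, k⟩
  · simp only [reflArrow, map_add, hσ, sub_sub_cancel, add_neg_cancel_right]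
  · have h1 : t - (t - k + 3) = k + 3 := by
      have : (6 : ZMod 6) = 0 := rfl
      linear_combination this * (-1)
    have h2 : k + 3 + 3 = k := by
      have : (6 : ZMod 6) = 0 := rfl
      linear_combination this
    simp only [reflArrow, map_add, hσ, ht, sub_sub_cancel, h1, h2, dir_add_three]
    congr 1
    abel

/-- A reflection as a permutation of the arrows. -/
def reflArrowEquiv (hσ : ∀ A, σ (σ A) = A) (ht : ∀ k, σ (dir k) = dir (t - k)) : Arrow ≃ Arrow where
  toFun := reflArrow σ t s
  invFun := reflArrow σ t (-σ s)
  left_inv := reflArrow_reflArrow s hσ ht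
  right_inv e := by
    have := reflArrow_reflArrow (-σ s) hσ ht e
    rwa [map_neg, hσ, neg_neg] at this

/-- A reflection as a permutation of the squares. -/
def reflSquareEquiv (hσ : ∀ A, σ (σ A) = A) : Square ≃ Square where
  toFun := reflSquare σ t s
  invFun := reflSquare σ t (-σ s)
  left_inv q := by simp [reflSquare, hσ]
  right_inv q := by simp [reflSquare, hσ]

lemma reflVert_mid (ht : ∀ k, σ (dir k) = dir (t - k)) (A : ℤ × ℤ) (k : ZMod 6) :
    reflVert σ s (mid A k) = mid (σ A + s) (t - k) := by
  simp only [reflVert, mid, map_add, map_zsmul, ht, smul_add]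
  abel

lemma reflVert_center (A : ℤ × ℤ) : reflVert σ s (center A) = center (σ A + s) := by
  simp only [reflVert, center, map_zsmul, smul_add]

lemma reflVert_corner (ht : ∀ k, σ (dir k) = dir (t - k)) (A : ℤ × ℤ) (k : ZMod 6) :
    reflVert σ s (corner A k) = corner (σ A + s) (t - 1 - k) := by
  have h1 : t - 1 - k + 1 = t - k := by ring
  have h2 : t - (k + 1) = t - 1 - k := by ring
  simp only [reflVert, corner, map_add, map_zsmul, ht, smul_add, h1, h2]
  abel

lemma corner_add_dir (A : ℤ × ℤ) (k : ZMod 6) : corner (A + dir k) (k + 3) = corner A (k - 1) := by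
  have h : ∀ k : ZMod 6, (6 : ℤ) • dir k + (2 : ℤ) • (dir (k + 3) + dir (k + 3 + 1)) =
      (2 : ℤ) • (dir (k - 1) + dir (k - 1 + 1)) := by decide
  rw [corner, corner, smul_add, add_assoc, h]

lemma mid_add_dir (A : ℤ × ℤ) (k : ZMod 6) : mid (A + dir k) (k + 3) = mid A k := by
  have h : ∀ k : ZMod 6, (6 : ℤ) • dir k + (3 : ℤ) • dir (k + 3) = (3 : ℤ) • dir k := by decide
  rw [mid, mid, smul_add, add_assoc, h]

lemma aends_reflArrow (ht : ∀ k, σ (dir k) = dir (t - k)) (e : Arrow) :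
    aends (reflArrow σ t s e) = Prod.map (reflVert σ s) (reflVert σ s) (aends e) := by
  rcases e with ⟨A, k⟩ | ⟨A, k⟩
  · simp only [aends, reflArrow, Prod.map, reflVert_center, reflVert_mid s ht]
  · simp only [aends, reflArrow, Prod.map, reflVert_corner s ht, reflVert_mid s ht, corner_add_dir,
      mid_add_dir]
    congr 2
    ring

lemma source_reflArrow (e : Arrow) :
    (reflArrow σ t s e).source = reflSquare σ t s e.target := by
  rcases e with ⟨A, k⟩ | ⟨A, k⟩
  · simp only [reflArrow, Arrow.source, Arrow.target, reflSquare]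
    congr 1; ring
  · have h : t - k + 3 + 2 = t - 1 - k := by
      have : (6 : ZMod 6) = 0 := rfl
      linear_combination this
    simp only [reflArrow, Arrow.source, Arrow.target, reflSquare, dir_add_three, h,
      add_neg_cancel_right]

lemma target_reflArrow (ht : ∀ k, σ (dir k) = dir (t - k)) (e : Arrow) :
    (reflArrow σ t s e).target = reflSquare σ t s e.source := by
  rcases e with ⟨A, k⟩ | ⟨A, k⟩
  · simp only [reflArrow, Arrow.source, Arrow.target, reflSquare]
    congr 1; ring
  · have h : t - k + 3 = t - 1 - (k + 2) := by
      have : (6 : ZMod 6) = 0 := rfl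
      linear_combination this
    simp only [reflArrow, Arrow.source, Arrow.target, reflSquare, map_add, ht, h]
    congr 1
    abel

lemma heightChange_reflArrow (e : Arrow) : (reflArrow σ t s e).heightChange = e.heightChange := by
  cases e <;> rfl

lemma squareVerts_reflSquare (ht : ∀ k, σ (dir k) = dir (t - k)) (q : Square) :
    squareVerts (reflSquare σ t s q) = reflVert σ s '' squareVerts q := by
  have h1 : t - 1 - q.2 + 1 = t - q.2 := by ring
  have h2 : t - (q.2 + 1) = t - 1 - q.2 := by ring
  simp only [squareVerts, reflSquare, Set.image_insert_eq, Set.image_singleton, reflVert_center,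
    reflVert_mid s ht, reflVert_corner s ht, h1, h2]
  ext v
  simp only [Set.mem_insert_iff, Set.mem_singleton_iff]
  tauto

end reflection

/-! ### Heights and weights in the plane -/

/-- The regions of the plane with a well-behaved theory of heights. -/
abbrev GoodPlaneRegion (V : Set (ℤ × ℤ)) : Prop :=
  GoodRegion aends Arrow.source Arrow.target Arrow.heightChange squareVerts V

lemma goodPlaneRegion_image {p r : ℤ} (hr : 0 ≤ r) (hp : r ≤ p) (hp' : p ≤ r + 1) :
    GoodPlaneRegion (pos '' region p r) :=
  (goodRegion_region hr hp hp').map arrowEquiv pos_injective squareEquiv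
    (fun e ↦ Or.inl (aends_arrow e)) source_arrow target_arrow heightChange_arrow
    squareVerts_toSquare

/-- A reflection reverses the arrows; the theory of heights is symmetric under this reversal. -/
lemma GoodRegion.reflect {V : Set (ℤ × ℤ)} (h : GoodPlaneRegion V) {σ : ℤ × ℤ →+ ℤ × ℤ} {t : ZMod 6}
    (s : ℤ × ℤ) (hσ : ∀ A, σ (σ A) = A) (ht : ∀ k, σ (dir k) = dir (t - k)) :
    GoodPlaneRegion (reflVert σ s '' V) :=
  h.flip.map (reflArrowEquiv s hσ ht) (reflVert_injective s hσ) (reflSquareEquiv (t := t) s hσ)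
    (fun e ↦ Or.inl (aends_reflArrow s ht e)) (source_reflArrow s) (target_reflArrow s ht)
    (heightChange_reflArrow s) (squareVerts_reflSquare s ht)

/-- The exponents `w` of monomial edge weights give the squares of orientation `k` the weight with
the exponent `φ k`, where the edges crossed by the two arrows that leave the square contribute with
the sign `1`, and the edges crossed by the two arrows that enter it with the sign `-1`. -/
def SquareCond {Γ : Type*} [AddCommGroup Γ] (w : Arrow → Γ) (φ : ZMod 6 → Γ) : Prop :=
  ∀ A k, w (.long A k) + w (.short (A - dir (k - 2)) (k - 2)) =
    φ k + (w (.long A (k + 1)) + w (.short A k))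

section weights

variable {Γ : Type*} [AddCommGroup Γ] {w : Arrow → Γ} {φ : ZMod 6 → Γ}

/-- A reflection reverses the arrows, and so inverts the weights of the squares. -/
lemma SquareCond.reflect (h : SquareCond w φ) {σ : ℤ × ℤ →+ ℤ × ℤ} {t : ZMod 6} (s : ℤ × ℤ)
    (ht : ∀ k, σ (dir k) = dir (t - k)) :
    SquareCond (fun e ↦ w (reflArrow σ t s e)) (fun k ↦ -φ (t - 1 - k)) := by
  intro A k
  have h6 : (6 : ZMod 6) = 0 := rfl
  have h1 := h (σ A + s) (t - 1 - k)
  have e1 : t - 1 - k - 2 = t - k + 3 := by linear_combination -h6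
  have e2 : t - 1 - k + 1 = t - k := by ring
  have e3 : t - (k + 1) = t - 1 - k := by ring
  have e4 : t - (k - 2) + 3 = t - 1 - k := by linear_combination h6
  simp only [reflArrow, map_sub, ht, e3, e4]
  rw [e1, e2, dir_add_three, sub_neg_eq_add] at h1
  have e5 : σ A - dir (t - (k - 2)) + s + dir (t - (k - 2)) = σ A + s := by abel
  rw [e5]
  rw [eq_neg_add_iff_add_eq, ← h1]

/-- In the coordinates of `lat`, opposite orientations having the same weight. -/
lemma SquareCond.faceCond (h : SquareCond w φ) (hφ : ∀ k, φ (k + 3) = φ k) :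
    FaceCond (fun e ↦ w (arrow e)) (φ 2) (φ 1) (φ 0) := by
  have h' : ∀ x y k k₁ k₂, k + 1 = k₁ → k - 2 = k₂ →
      w (.long (x, y) k) + w (.short (x - (dir k₂).1, y - (dir k₂).2) k₂) =
      φ k + (w (.long (x, y) k₁) + w (.short (x, y) k)) := by
    rintro x y k _ _ rfl rfl
    exact h (x, y) k
  have e3 : φ 0 = φ 3 := (hφ 0).symm
  have e4 : φ 1 = φ 4 := (hφ 1).symm
  have e5 : φ 2 = φ 5 := (hφ 2).symm
  refine ⟨?_, ?_, ?_, ?_, ?_⟩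
  · rintro ⟨_ | _, x, y⟩
    · simpa [arrow, dir0] using h' x y 2 3 0 rfl rfl
    · simpa [arrow, dir3, e5] using h' x y 5 0 3 rfl rfl
  · rintro x y _ _ rfl rfl
    simpa [arrow, dir5] using h' x y 1 2 5 rfl rfl
  · rintro x y _ _ rfl rfl
    simpa [arrow, dir2, e4] using h' x y 4 5 2 rfl rfl
  · rintro x y _ rfl
    simpa [arrow, dir4] using h' x y 0 1 4 rfl rfl
  · rintro x y _ _ rfl rfl
    simpa [arrow, dir1, e3] using h' x y 3 4 1 rfl rfl

/-- There are edge weights with prescribed weights of the squares. -/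
lemma exists_squareCond (φ : ZMod 6 → Γ) (hφ : ∀ k, φ (k + 3) = φ k) :
    ∃ w : Arrow → Γ, SquareCond w φ := by
  have h3 : φ 3 = φ 0 := hφ 0
  have h4 : φ 4 = φ 1 := hφ 1
  have h5 : φ 5 = φ 2 := hφ 2
  set Φ : Γ := φ 0 + φ 1 + φ 2 with hΦ
  -- weights that are invariant under all translations would make the exponents of the six squares
  -- of a hexagon add up to zero instead of `2 • Φ`; the weights here grow from west to east
  refine ⟨fun e ↦ match e with
    | .long A k => (![0, (2 * A.1) • Φ - φ 0, (2 * A.1) • Φ - φ 0 - φ 1, Φ, Φ - φ 0,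
        Φ - φ 0 - φ 1] : Fin 6 → Γ) k
    | .short A k => (![-((2 * A.1) • Φ), 0, 0, 0, 0, 0] : Fin 6 → Γ) k, ?_⟩
  rintro ⟨x, y⟩ k
  rcases zmod6_cases k with rfl | rfl | rfl | rfl | rfl | rfl
  · change 0 + 0 = φ 0 + (((2 * x) • Φ - φ 0) + -((2 * x) • Φ))
    abel
  · change ((2 * x) • Φ - φ 0) + 0 = φ 1 + (((2 * x) • Φ - φ 0 - φ 1) + 0)
    abel
  · change ((2 * x) • Φ - φ 0 - φ 1) + -((2 * (x - 1)) • Φ) = φ 2 + (Φ + 0)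
    rw [mul_sub, sub_smul, hΦ]
    abel
  · change Φ + 0 = φ 3 + ((Φ - φ 0) + 0)
    rw [h3]; abel
  · change (Φ - φ 0) + 0 = φ 4 + ((Φ - φ 0 - φ 1) + 0)
    rw [h4]; abel
  · change (Φ - φ 0 - φ 1) + 0 = φ 5 + (0 + 0)
    rw [h5, hΦ]; abel

end weights

/-! ### Perfect matchings as sets of arrows -/

lemma aends_ne (e : Arrow) : (aends e).1 ≠ (aends e).2 := by
  obtain ⟨e, rfl⟩ := arrow_bijective.2 e
  rw [aends_arrow]
  exact fun h ↦ ends_ne e (pos_injective h)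

lemma edge_injective : Function.Injective Arrow.edge := by
  intro e e' h
  obtain ⟨e, rfl⟩ := arrow_bijective.2 e
  obtain ⟨e', rfl⟩ := arrow_bijective.2 e'
  rw [edge_eq, edge_eq, Sym2.eq_iff, aends_arrow, aends_arrow] at h
  simp only [Prod.map_fst, Prod.map_snd, pos_injective.eq_iff] at h
  rcases h with ⟨h1, h2⟩ | ⟨h1, -⟩
  · rw [ends_injective (Prod.ext h1 h2)]
  · exfalso
    have h3 : ∀ e, vsign (lat.ends e).1 = 1 ∧ vsign (lat.ends e).2 = -1 := by
      rintro (⟨c, _ | ⟨_ | _, r⟩⟩ | b) <;> exact ⟨rfl, rfl⟩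
    have h4 := (h3 e).1
    rw [h1, (h3 e').2] at h4
    omega

lemma adj_iff {u v : ℤ × ℤ} : dP3.Adj u v ↔ ∃ e : Arrow, e.edge = s(u, v) := by
  rw [dP3, SimpleGraph.fromEdgeSet_adj]
  constructor
  · rintro ⟨⟨A, k, h | h⟩, -⟩
    exacts [⟨.long A k, h.symm⟩, ⟨.short A k, h.symm⟩]
  · rintro ⟨e, he⟩
    constructor
    · rcases e with ⟨A, k⟩ | ⟨A, k⟩
      exacts [⟨A, k, Or.inl he.symm⟩, ⟨A, k, Or.inr he.symm⟩]
    · rintro rfl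
      rw [edge_eq, Sym2.eq_iff] at he
      have := aends_ne e
      rcases he with ⟨h1, h2⟩ | ⟨h1, h2⟩ <;> exact this (h1.trans h2.symm)

lemma isPM_of_existsUnique {E V : Type*} {ends : E → V × V} {U : Set V} {F : Finset E}
    (hne : ∀ e, (ends e).1 ≠ (ends e).2) (h1 : ∀ e ∈ F, (ends e).1 ∈ U ∧ (ends e).2 ∈ U)
    (h2 : ∀ v ∈ U, ∃ e ∈ F, ((ends e).1 = v ∨ (ends e).2 = v) ∧
      ∀ e' ∈ F, (ends e').1 = v ∨ (ends e').2 = v → e' = e) : IsPM ends U F := by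
  intro v
  by_cases hv : v ∈ U
  · obtain ⟨e, he, hev, huniq⟩ := h2 v hv
    rw [if_pos hv, Finset.sum_eq_single_of_mem e he]
    · have := hne e
      unfold inc
      rcases hev with h | h
      · rw [if_pos h, if_neg (fun h' ↦ this (h.trans h'.symm))]
      · rw [if_pos h, if_neg (fun h' ↦ this (h'.trans h.symm))]
    · intro e' he' hne'
      rw [inc_eq_zero, ← not_or]
      exact fun h ↦ hne' (huniq e' he' h)
  · rw [if_neg hv, Finset.sum_eq_zero_iff]
    intro e he
    rw [inc_eq_zero, ← not_or]
    rintro (rfl | rfl)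
    exacts [hv (h1 e he).1, hv (h1 e he).2]

/-- The subgraph of the lattice that is induced on a set of vertices. -/
abbrev plane (V : Set (ℤ × ℤ)) : dP3.Subgraph := (⊤ : dP3.Subgraph).induce V

section matching

variable {V : Set (ℤ × ℤ)}

lemma PerfectMatching.verts_eq (M : PerfectMatching (plane V)) : M.1.verts = V := M.2.2.2

lemma PerfectMatching.finite_edges (hV : V.Finite) (M : PerfectMatching (plane V)) :
    {e : Arrow | e.edge ∈ M.1.edgeSet}.Finite := by
  refine Set.Finite.preimage edge_injective.injOn ?_
  refine ((hV.prod hV).image fun p ↦ s(p.1, p.2)).subset ?_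
  intro e
  induction e using Sym2.ind with
  | _ u v =>
    intro he
    rw [SimpleGraph.Subgraph.mem_edgeSet] at he
    refine ⟨(u, v), ⟨?_, ?_⟩, rfl⟩
    · rw [← M.verts_eq]; exact M.1.edge_vert he
    · rw [← M.verts_eq]; exact M.1.edge_vert he.symm

/-- The arrows that cross the edges of a perfect matching. -/
noncomputable def PerfectMatching.arrows (hV : V.Finite) (M : PerfectMatching (plane V)) :
    Finset Arrow := (M.finite_edges hV).toFinset

lemma PerfectMatching.mem_arrows {hV : V.Finite} {M : PerfectMatching (plane V)} {e : Arrow} :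
    e ∈ M.arrows hV ↔ e.edge ∈ M.1.edgeSet := by
  simp [arrows]

lemma PerfectMatching.adj_iff {hV : V.Finite} {M : PerfectMatching (plane V)} {u v : ℤ × ℤ} :
    M.1.Adj u v ↔ ∃ e ∈ M.arrows hV, e.edge = s(u, v) := by
  simp only [mem_arrows]
  constructor
  · intro h
    obtain ⟨e, he⟩ := DP3.adj_iff.1 h.adj_sub
    exact ⟨e, by rw [he]; exact h, he⟩
  · rintro ⟨e, h, he⟩
    rw [he] at h
    exact h

lemma PerfectMatching.isPM_arrows (hV : V.Finite) (M : PerfectMatching (plane V)) :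
    IsPM aends V (M.arrows hV) := by
  refine isPM_of_existsUnique aends_ne ?_ ?_
  · intro e he
    rw [mem_arrows, edge_eq, SimpleGraph.Subgraph.mem_edgeSet] at he
    rw [← M.verts_eq]
    exact ⟨M.1.edge_vert he, M.1.edge_vert he.symm⟩
  · intro v hv
    rw [← M.verts_eq] at hv
    obtain ⟨w, hw, huniq⟩ := M.2.2.1 hv
    obtain ⟨e, he, hev⟩ := (PerfectMatching.adj_iff (hV := hV)).1 hw
    have hv' : v ∈ e.edge := by rw [hev]; simp
    refine ⟨e, he, mem_edge.1 hv', fun e' he' hv' ↦ ?_⟩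
    obtain ⟨w', hw'⟩ := Sym2.mem_iff_exists.1 (mem_edge.2 hv')
    have h1 := huniq w' (PerfectMatching.adj_iff.2 ⟨e', he', hw'⟩)
    exact edge_injective (by rw [hw', hev, h1])

/-- The perfect matchings of an induced subgraph correspond to sets of arrows. -/
lemma PerfectMatching.exists_arrows_eq (hV : V.Finite) {F : Finset Arrow} (hF : IsPM aends V F) :
    ∃ M : PerfectMatching (plane V), M.arrows hV = F := by
  have hvert : ∀ e ∈ F, ∀ v ∈ e.edge, v ∈ V := fun e he v hv ↦ hF.mem_of_inc he (mem_edge.1 hv)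
  let M : dP3.Subgraph :=
    { verts := V
      Adj u v := ∃ e ∈ F, e.edge = s(u, v)
      adj_sub := fun ⟨e, _, he⟩ ↦ DP3.adj_iff.2 ⟨e, he⟩
      edge_vert := fun ⟨e, he, hev⟩ ↦ hvert e he _ (by rw [hev]; simp)
      symm := ⟨fun u v ⟨e, he, hev⟩ ↦ ⟨e, he, by rw [hev, Sym2.eq_swap]⟩⟩ }
  have hM : M ≤ plane V := by
    refine ⟨subset_rfl, fun u v huv ↦ ?_⟩
    obtain ⟨e, he, hev⟩ := huv
    exact ⟨hvert e he _ (by rw [hev]; simp), hvert e he _ (by rw [hev]; simp),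
      DP3.adj_iff.2 ⟨e, hev⟩⟩
  have hmatch : M.IsMatching := by
    intro v hv
    obtain ⟨e, he, hev⟩ := hF.exists_inc hv
    obtain ⟨w, hw⟩ := Sym2.mem_iff_exists.1 (mem_edge.2 hev)
    refine ⟨w, ⟨e, he, hw⟩, ?_⟩
    rintro w' ⟨e', he', hw'⟩
    have h1 : e' = e := hF.eq_of_inc he' he (v := v) (mem_edge.1 (by rw [hw']; simp)) hev
    rw [h1, hw, Sym2.congr_right] at hw'
    exact hw'.symm
  have hverts : M.verts = (plane V).verts := rfl
  refine ⟨⟨M, hM, hmatch, hverts⟩, ?_⟩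
  ext e
  refine PerfectMatching.mem_arrows.trans ?_
  change e.edge ∈ M.edgeSet ↔ _
  constructor
  · intro h
    rw [edge_eq, SimpleGraph.Subgraph.mem_edgeSet] at h
    obtain ⟨e', he', h'⟩ := h
    rw [← edge_eq] at h'
    rwa [← edge_injective h']
  · intro h
    rw [edge_eq, SimpleGraph.Subgraph.mem_edgeSet]
    exact ⟨e, h, edge_eq e⟩

lemma PerfectMatching.arrows_injective (hV : V.Finite) :
    Function.Injective (PerfectMatching.arrows hV) := by
  intro M M' h
  refine Subtype.ext (SimpleGraph.Subgraph.ext (M.verts_eq.trans M'.verts_eq.symm) ?_)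
  funext u v
  rw [eq_iff_iff, PerfectMatching.adj_iff (hV := hV), PerfectMatching.adj_iff (hV := hV), h]

lemma square_le_iff {q : Square} : square q ≤ plane V ↔ squareVerts q ⊆ V :=
  ⟨fun h ↦ h.1, fun h ↦ SimpleGraph.Subgraph.induce_mono_right h⟩

/-- The class of a square: the variable that counts the tiles above it. -/
def squareClass (k : ZMod 6) : Fin 3 := (![0, 1, 2, 0, 1, 2] : Fin 6 → Fin 3) k

/-- The number of tiles above a square, in terms of the functions on the faces whose boundary is the
difference of two matchings. -/
lemma exists_numTiles (h : GoodPlaneRegion V) {o : Square} (ho : IsOuterFace (plane V) o) :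
    ∃ F₁ : Finset Arrow, IsPM aends V F₁ ∧ ∀ M : PerfectMatching (plane V),
      ∃ (τ : Square → ℕ) (_ : (Function.support τ).Finite),
        (∀ q, ¬squareVerts q ⊆ V → τ q = 0) ∧
        (∀ q, squareVerts q ⊆ V → numTiles (plane V) M o q = τ q) ∧
        (M.arrows h.finite = F₁ → τ = 0) ∧
        open Classical in
        ∀ e : Arrow, (τ e.target : ℤ) + (if e ∈ M.arrows h.finite then 1 else 0) =
          τ e.source + if e ∈ F₁ then 1 else 0 := by
  classical
  obtain ⟨F₁, hF₁, hmin⟩ := h.exists_minimal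
  refine ⟨F₁, hF₁, ?_⟩
  have ho' : ¬squareVerts o ⊆ V := fun h ↦ ho.1 (square_le_iff.2 h)
  have hoV : ∀ q, (squareVerts q ∩ V).Nonempty → (squareVerts o ∩ V).Nonempty :=
    fun q hq ↦ ho.2 (hq.mono Set.inter_subset_right)
  -- the height functions exist
  have hheight : ∀ M : PerfectMatching (plane V),
      IsHeightFunction (plane V) M o (height (plane V) M o) := by
    intro M
    obtain ⟨F₀, h₀, hF₀, hh₀⟩ := h.ref
    obtain ⟨g, -, hg⟩ := h.exact _ F₀ (M.isPM_arrows h.finite) hF₀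
    refine Classical.epsilon_spec (p := IsHeightFunction (plane V) M o)
      ⟨fun q ↦ h₀ q + 6 * g q - (h₀ o + 6 * g o), by ring, fun e he ↦ ?_⟩
    have h1 := hg e
    have h2 := hh₀ e (by
      obtain ⟨v, hv, hvV⟩ := he
      rcases mem_edge.1 hv with rfl | rfl
      exacts [Or.inl hvV, Or.inr hvV])
    simp only [PerfectMatching.mem_arrows] at h1
    split_ifs at h1 h2 ⊢ <;> linarith
  obtain ⟨M₁, hM₁⟩ := PerfectMatching.exists_arrows_eq h.finite hF₁
  have hτ : ∀ M : PerfectMatching (plane V), ∃ (τ : Square → ℕ) (_ : (Function.support τ).Finite),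
        (∀ q, ¬squareVerts q ⊆ V → τ q = 0) ∧
        (∀ q, (squareVerts q ∩ V).Nonempty → height (plane V) M o q =
          height (plane V) M₁ o q + 6 * τ q) ∧ (M.arrows h.finite = F₁ → τ = 0) ∧
        ∀ e : Arrow, (τ e.target : ℤ) + (if e ∈ M.arrows h.finite then 1 else 0) =
          τ e.source + if e ∈ F₁ then 1 else 0 := by
    intro M
    obtain ⟨τ, hfin, hout, hτe⟩ := hmin _ (M.isPM_arrows h.finite)
    refine ⟨τ, hfin, hout, fun q hq ↦ ?_, fun hM ↦ ?_, hτe⟩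
    · have h1 := h.conn (fun q ↦ height (plane V) M o q - height (plane V) M₁ o q - 6 * τ q)
        (fun e he ↦ ?_) q o hq (hoV q hq)
      · simp only [(hheight M).1, (hheight M₁).1, hout o ho'] at h1
        push_cast at h1
        linarith
      · have he' : ∃ v ∈ e.edge, v ∈ (plane V).verts := by
          rcases he with he | he
          exacts [⟨_, mem_edge.2 (Or.inl rfl), he⟩, ⟨_, mem_edge.2 (Or.inr rfl), he⟩]
        have h1 := (hheight M).2 e he'
        have h2 := (hheight M₁).2 e he'
        have h3 := hτe e
        simp only [← hM₁, PerfectMatching.mem_arrows] at h3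
        split_ifs at h1 h2 h3 <;> linarith
    · have h1 := h.unique (fun q ↦ (τ q : ℤ)) (hfin.subset fun q hq ↦ by simpa using hq) fun e ↦ ?_
      · funext q
        simpa using congrFun h1 q
      · have := hτe e
        rw [hM] at this
        simpa using this
  intro M
  obtain ⟨τ, hfin, hout, hτq, hτ0, hτe⟩ := hτ M
  refine ⟨τ, hfin, hout, fun q hq ↦ ?_, hτ0, hτe⟩
  have hq' : (squareVerts q ∩ V).Nonempty :=
    ⟨center q.1, by simp [squareVerts], hq (by simp [squareVerts])⟩
  have hle : ∀ M' : PerfectMatching (plane V),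
      height (plane V) M₁ o q ≤ height (plane V) M' o q := by
    intro M'
    obtain ⟨τ', -, -, hτ', -⟩ := hτ M'
    rw [hτ' q hq']
    omega
  have hmin : minHeight (plane V) o q = height (plane V) M₁ o q := by
    have : Nonempty (PerfectMatching (plane V)) := ⟨M₁⟩
    exact le_antisymm (ciInf_le ⟨_, by rintro _ ⟨M', rfl⟩; exact hle M'⟩ M₁) (le_ciInf hle)
  rw [numTiles, hmin, hτq q hq', add_sub_cancel_left, Int.mul_ediv_cancel_left _ (by norm_num),
    Int.toNat_natCast]

end matching

/-! ### Generating functions and matching sums -/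

/-- The field of rational functions in the variables of the generating functions. -/
abbrev RatFun : Type := FractionRing (MvPolynomial (Fin 3) ℤ)

/-- The Laurent monomials, as a character of the group of exponents. -/
noncomputable def laurent : AddChar (Fin 3 → ℤ) RatFun where
  toFun γ := ∏ i, algebraMap (MvPolynomial (Fin 3) ℤ) RatFun (.X i) ^ γ i
  map_zero_eq_one' := by simp
  map_add_eq_mul' γ γ' := by
    rw [← Finset.prod_mul_distrib]
    refine Finset.prod_congr rfl fun i _ ↦ ?_
    rw [Pi.add_apply, zpow_add₀]
    exact (map_ne_zero_iff _ (IsFractionRing.injective _ _)).2 (MvPolynomial.X_ne_zero i)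

lemma laurent_apply (γ : Fin 3 → ℤ) :
    laurent γ = ∏ i, algebraMap (MvPolynomial (Fin 3) ℤ) RatFun (.X i) ^ γ i := rfl

lemma algebraMap_injective :
    Function.Injective (algebraMap (MvPolynomial (Fin 3) ℤ) RatFun) :=
  IsFractionRing.injective _ _

lemma laurent_natCast (d : Fin 3 → ℕ) : laurent (fun i ↦ (d i : ℤ)) =
    algebraMap (MvPolynomial (Fin 3) ℤ) RatFun (∏ i, .X i ^ d i) := by
  rw [map_prod, laurent_apply]
  exact Finset.prod_congr rfl fun i _ ↦ by rw [zpow_natCast, map_pow]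

lemma laurent_single (i : Fin 3) :
    laurent (Pi.single i 1) = algebraMap (MvPolynomial (Fin 3) ℤ) RatFun (.X i) := by
  rw [laurent_apply, Finset.prod_eq_single i]
  · simp
  · intro j _ hj
    simp [hj]
  · simp

lemma laurent_mul_eq_iff {γ : Fin 3 → ℤ} {P G : MvPolynomial (Fin 3) ℤ} :
    algebraMap _ RatFun G = laurent γ * algebraMap _ RatFun P ↔
      (∏ i, .X i ^ (-γ i).toNat) * G = (∏ i, .X i ^ (γ i).toNat) * P := by
  rw [← algebraMap_injective.eq_iff, map_mul, map_mul, ← laurent_natCast, ← laurent_natCast]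
  have h : laurent (fun i ↦ ((γ i).toNat : ℤ)) =
      laurent (fun i ↦ ((-γ i).toNat : ℤ)) * laurent γ := by
    rw [← AddChar.map_add_eq_mul]
    congr 1
    funext i
    simp only [Pi.add_apply]
    omega
  rw [h, mul_assoc, mul_right_inj' (addChar_ne_zero _ _)]

lemma one_add_laurent_ne_zero (γ : Fin 3 → ℤ) : 1 + laurent γ ≠ 0 := by
  intro h
  have h1 : algebraMap (MvPolynomial (Fin 3) ℤ) RatFun (-1) =
      laurent γ * algebraMap (MvPolynomial (Fin 3) ℤ) RatFun 1 := by
    rw [map_neg, map_one, mul_one]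
    linear_combination -h
  rw [laurent_mul_eq_iff] at h1
  have h2 := congrArg (MvPolynomial.eval fun _ ↦ 1) h1
  simp at h2

/-- Polynomials with a constant term that differ by a Laurent monomial factor are equal. -/
lemma eq_of_eq_laurent_mul {γ : Fin 3 → ℤ} {P G : MvPolynomial (Fin 3) ℤ}
    (h : algebraMap _ RatFun G = laurent γ * algebraMap _ RatFun P)
    (hG : MvPolynomial.constantCoeff G ≠ 0) (hP : MvPolynomial.constantCoeff P ≠ 0) : G = P := by
  have hmon : ∀ d : Fin 3 → ℕ, (∏ i, .X i ^ d i : MvPolynomial (Fin 3) ℤ) =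
      MvPolynomial.monomial (Finsupp.equivFunOnFinite.symm d) 1 := by
    intro d
    rw [MvPolynomial.monomial_eq, map_one, one_mul, Finsupp.prod_fintype _ _ (by simp)]
    simp
  -- the exponent of the constant term of `G` occurs on the other side
  have key : ∀ {γ : Fin 3 → ℤ} {P G : MvPolynomial (Fin 3) ℤ},
      (∏ i, .X i ^ (-γ i).toNat) * G = (∏ i, .X i ^ (γ i).toNat) * P →
      MvPolynomial.constantCoeff G ≠ 0 → ∀ i, γ i ≤ 0 := by
    intro γ P G h hG i
    rw [hmon, hmon] at h
    have h1 := congrArg (MvPolynomial.coeff (Finsupp.equivFunOnFinite.symm fun i ↦ (-γ i).toNat)) h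
    rw [MvPolynomial.coeff_monomial_mul', MvPolynomial.coeff_monomial_mul', if_pos le_rfl,
      tsub_self, one_mul] at h1
    split_ifs at h1 with h2
    · have := h2 i
      simp only [Finsupp.equivFunOnFinite_symm_apply_apply] at this
      omega
    · exact (hG h1).elim
  rw [laurent_mul_eq_iff] at h
  have h1 := key h hG
  have h2 := key (γ := -γ) (P := G) (G := P) (by simpa using h.symm) hP
  have h3 : ∀ i, γ i = 0 := fun i ↦ le_antisymm (h1 i) (by simpa using h2 i)
  simpa [h3] using h

/-- The exponent of the weight of a square of orientation `k`: the unit vector of its variable. -/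
def squareExp (k : ZMod 6) : Fin 3 → ℤ := Pi.single (squareClass k) 1

lemma squareExp_add_three (k : ZMod 6) : squareExp (k + 3) = squareExp k := by
  rw [squareExp, squareExp, show squareClass (k + 3) = squareClass k by revert k; decide]

open Classical in
/-- The arrows that leave a square. -/
noncomputable def outArrows (q : Square) : Finset Arrow :=
  {.long q.1 q.2, .short (q.1 - dir (q.2 - 2)) (q.2 - 2)}

open Classical in
/-- The arrows that enter a square. -/
noncomputable def inArrows (q : Square) : Finset Arrow :=
  {.long q.1 (q.2 + 1), .short q.1 q.2}

lemma mem_outArrows (e : Arrow) (q : Square) : e ∈ outArrows q ↔ e.source = q := by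
  classical
  obtain ⟨A, k⟩ := q
  rw [outArrows, Finset.mem_insert, Finset.mem_singleton]
  rcases e with ⟨B, j⟩ | ⟨B, j⟩
  · simp [Arrow.source]
  · simp only [reduceCtorEq, false_or, Arrow.source, Arrow.short.injEq, Prod.mk.injEq]
    constructor
    · rintro ⟨rfl, rfl⟩; simp
    · rintro ⟨rfl, rfl⟩; simp

lemma mem_inArrows (e : Arrow) (q : Square) : e ∈ inArrows q ↔ e.target = q := by
  classical
  obtain ⟨A, k⟩ := q
  rw [inArrows, Finset.mem_insert, Finset.mem_singleton]
  rcases e with ⟨B, j⟩ | ⟨B, j⟩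
  · simp [Arrow.target, sub_eq_iff_eq_add]
  · simp [Arrow.target]

/-- The generating function of a region is its matching sum for suitable weights, up to a monomial
factor. -/
theorem matchingSum_eq_genFun {V : Set (ℤ × ℤ)} (h : GoodPlaneRegion V) {o : Square}
    (ho : IsOuterFace (plane V) o) {w : Arrow → Fin 3 → ℤ} (hw : SquareCond w squareExp) :
    MvPolynomial.constantCoeff (genFun (plane V) o) ≠ 0 ∧
    ∃ ν, matchingSum aends V (fun e ↦ laurent (w e)) =
      laurent ν * algebraMap _ RatFun (genFun (plane V) o) := by
  classical
  obtain ⟨F₁, hF₁, hτ⟩ := exists_numTiles h ho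
  have hfinite : Finite (PerfectMatching (plane V)) :=
    Set.finite_univ_iff.1 ((h.finite_isPM.preimage
      (PerfectMatching.arrows_injective h.finite).injOn).subset
        fun M _ ↦ M.isPM_arrows h.finite)
  have := Fintype.ofFinite (PerfectMatching (plane V))
  -- the exponent of the term of a perfect matching
  set tv : PerfectMatching (plane V) → Fin 3 → ℕ := fun M ↦
    ![tileCount (plane V) M o NE, tileCount (plane V) M o N, tileCount (plane V) M o NW] with htv
  have hgen : genFun (plane V) o = ∑ M, ∏ i, .X i ^ tv M i := by
    rw [genFun, finsum_eq_sum_of_fintype]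
    refine Finset.sum_congr rfl fun M _ ↦ ?_
    simp [htv, Fin.prod_univ_three]
  have hcount : ∀ (M : PerfectMatching (plane V)) (τ : Square → ℕ)
      (hfin : (Function.support τ).Finite), (∀ q, ¬squareVerts q ⊆ V → τ q = 0) →
      (∀ q, squareVerts q ⊆ V → numTiles (plane V) M o q = τ q) →
      ∀ i, tv M i = ∑ q ∈ hfin.toFinset, if squareClass q.2 = i then τ q else 0 := by
    intro M τ hfin h1 h2 i
    have h3 : ∀ k i, (∀ j : ZMod 6, (j = k ∨ j = k + 3) ↔ squareClass j = i) →
        tileCount (plane V) M o k =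
          ∑ q ∈ hfin.toFinset, if squareClass q.2 = i then τ q else 0 := by
      intro k i hk
      have h4 : ∀ q : Square, (∑ᶠ _ : q ∈
          {q : Square | square q ≤ plane V ∧ (q.2 = k ∨ q.2 = k + 3)},
          numTiles (plane V) M o q) = if squareClass q.2 = i then τ q else 0 := by
        intro q
        rw [finsum_eq_if]
        simp only [Set.mem_ofPred_eq, square_le_iff, hk]
        by_cases h5 : squareVerts q ⊆ V
        · simp only [h5, true_and, h2 q h5]
        · simp only [h5, false_and, if_false, h1 q h5, ite_self]
      rw [tileCount, finsum_congr h4]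
      refine finsum_eq_sum_of_support_subset _ fun q hq ↦ ?_
      rw [Function.mem_support] at hq
      simp only [Set.Finite.coe_toFinset, Function.mem_support]
      intro h5
      simp [h5] at hq
    fin_cases i
    · exact h3 0 0 (by decide)
    · exact h3 1 1 (by decide)
    · exact h3 2 2 (by decide)
  constructor
  · obtain ⟨M₁, hM₁⟩ := PerfectMatching.exists_arrows_eq h.finite hF₁
    have h1 : tv M₁ = 0 := by
      obtain ⟨τ, hfin, h1, h2, h3, -⟩ := hτ M₁
      funext i
      rw [hcount M₁ τ hfin h1 h2]
      exact Finset.sum_eq_zero fun q _ ↦ by simp [h3 hM₁]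
    have h2 : ∀ M, (0 : ℤ) ≤ MvPolynomial.constantCoeff (∏ i, .X i ^ tv M i) := by
      intro M
      rw [map_prod]
      refine Finset.prod_nonneg fun i _ ↦ ?_
      rw [map_pow, MvPolynomial.constantCoeff_X]
      positivity
    rw [hgen, map_sum]
    refine (lt_of_lt_of_le ?_ (Finset.single_le_sum (fun M _ ↦ h2 M) (Finset.mem_univ M₁))).ne'
    simp [h1]
  · refine ⟨∑ e ∈ F₁, w e, ?_⟩
    have hterm : ∀ M : PerfectMatching (plane V), ∏ e ∈ M.arrows h.finite, laurent (w e) =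
        laurent (∑ e ∈ F₁, w e) *
          algebraMap (MvPolynomial (Fin 3) ℤ) RatFun (∏ i, .X i ^ tv M i) := by
      intro M
      obtain ⟨τ, hfin, h1, h2, -, h3⟩ := hτ M
      have h4 := sum_eq_add_finsum hfin h3 w (fun q ↦ squareExp q.2) outArrows inArrows
        mem_outArrows mem_inArrows fun q ↦ by
          rw [outArrows, inArrows, Finset.sum_pair (by simp), Finset.sum_pair (by simp)]
          exact hw q.1 q.2
      rw [← addChar_sum, h4, AddChar.map_add_eq_mul, ← laurent_natCast]
      congr 2
      funext i
      rw [hcount M τ hfin h1 h2, Finset.sum_apply]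
      push_cast
      refine Finset.sum_congr rfl fun q _ ↦ ?_
      rw [Pi.smul_apply, squareExp, Pi.single_apply]
      by_cases hq : i = squareClass q.2
      · simp [← hq]
      · rw [if_neg hq, if_neg (Ne.symm hq), smul_zero]
    have hrange : {F | IsPM aends V F} = Set.range (PerfectMatching.arrows h.finite) := by
      ext F
      constructor
      · exact fun hF ↦ PerfectMatching.exists_arrows_eq h.finite hF
      · rintro ⟨M, rfl⟩
        exact M.isPM_arrows h.finite
    have h5 : matchingSum aends V (fun e ↦ laurent (w e)) =
        ∑ᶠ F ∈ {F | IsPM aends V F}, ∏ e ∈ F, laurent (w e) := rfl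
    rw [h5, hrange, finsum_mem_range (PerfectMatching.arrows_injective h.finite),
      finsum_congr hterm, finsum_eq_sum_of_fintype, ← Finset.mul_sum, ← map_sum, ← hgen]

/-- A polynomial with a constant term is the generating function of a region if it is the matching
sum for suitable weights, up to a monomial factor. -/
lemma genFun_eq {V : Set (ℤ × ℤ)} (h : GoodPlaneRegion V) {o : Square}
    (ho : IsOuterFace (plane V) o) {w : Arrow → Fin 3 → ℤ} (hw : SquareCond w squareExp)
    {P : MvPolynomial (Fin 3) ℤ} (hP : MvPolynomial.constantCoeff P ≠ 0) {μ : Fin 3 → ℤ}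
    (hμ : matchingSum aends V (fun e ↦ laurent (w e)) = laurent μ * algebraMap _ RatFun P) :
    genFun (plane V) o = P := by
  obtain ⟨hG, ν, hν⟩ := matchingSum_eq_genFun h ho hw
  refine eq_of_eq_laurent_mul (γ := μ - ν) ?_ hG hP
  rw [AddChar.map_sub_eq_div, div_mul_eq_mul_div, ← hμ, hν,
    mul_div_cancel_left₀ _ (addChar_ne_zero _ _)]

lemma map_dragonProd {R R' : Type*} [CommSemiring R] [CommSemiring R'] (f : R →+* R') (m : ℕ)
    (x y z : R) : f (dragonProd m x y z) = dragonProd m (f x) (f y) (f z) := by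
  simp only [dragonProd, map_mul, map_prod, map_pow, map_add, map_one]

lemma constantCoeff_dragonProd (m : ℕ) (i j k : Fin 3) : MvPolynomial.constantCoeff
    (dragonProd m (.X i) (.X j) (.X k) : MvPolynomial (Fin 3) ℤ) ≠ 0 := by
  rw [map_dragonProd]
  simp [dragonProd]

/-- The product formula for a region in standard position. -/
theorem genFun_region (m : ℕ) {o : Square}
    (ho : IsOuterFace (plane (pos '' region ((m + 1) / 2 : ℕ) (m / 2 : ℕ))) o) :
    genFun (plane (pos '' region ((m + 1) / 2 : ℕ) (m / 2 : ℕ))) o =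
      dragonProd m (.X 2) (.X 1) (.X 0) := by
  obtain ⟨w, hw⟩ := exists_squareCond squareExp squareExp_add_three
  obtain ⟨μ, hμ⟩ := matchingSum_region laurent one_add_laurent_ne_zero m
    (hw.faceCond squareExp_add_three)
  refine genFun_eq (goodPlaneRegion_image (by omega) (by omega) (by omega)) ho hw
    (constantCoeff_dragonProd m 2 1 0) (μ := μ) ?_
  rw [matchingSum_map (ends := lat.ends) arrowEquiv pos_injective
    fun e ↦ Or.inl (aends_arrow e), map_dragonProd, ← laurent_single, ← laurent_single,
    ← laurent_single]
  exact hμ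

/-- The product formula for the image of a region under a reflection, or glide reflection, with a
horizontal (`t = 0`) or a vertical (`t = 3`) axis.  It exchanges the NE and SW squares with the NW
and SE squares, and so the variables `X 0` and `X 2`. -/
theorem genFun_region_reflect (m : ℕ) {σ : ℤ × ℤ →+ ℤ × ℤ} {t : ZMod 6}
    (s : ℤ × ℤ) (hσ : ∀ A, σ (σ A) = A) (ht : ∀ k, σ (dir k) = dir (t - k)) (ht' : t = 0 ∨ t = 3)
    {o : Square} (ho : IsOuterFace
      (plane (reflVert σ s '' (pos '' region ((m + 1) / 2 : ℕ) (m / 2 : ℕ)))) o) :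
    genFun (plane (reflVert σ s '' (pos '' region ((m + 1) / 2 : ℕ) (m / 2 : ℕ)))) o =
      dragonProd m (.X 0) (.X 1) (.X 2) := by
  obtain ⟨w, hw⟩ := exists_squareCond squareExp squareExp_add_three
  have hw' := hw.reflect s ht
  have hφ : ∀ k, -squareExp (t - 1 - (k + 3)) = -squareExp (t - 1 - k) := by
    intro k
    have e : t - 1 - k = t - 1 - (k + 3) + 3 := by ring
    rw [e, squareExp_add_three]
  obtain ⟨μ, hμ⟩ := matchingSum_region laurent one_add_laurent_ne_zero m (hw'.faceCond hφ)
  -- the reflection inverts the weights of the squares, which changes the product by a monomial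
  obtain ⟨μ', hμ'⟩ := dragonProd_inv laurent m (squareExp 0) (squareExp 1) (squareExp 2)
  refine genFun_eq ((goodPlaneRegion_image (by omega) (by omega) (by omega)).reflect s hσ ht) ho hw
    (constantCoeff_dragonProd m 0 1 2) (μ := μ + μ') ?_
  rw [matchingSum_map (ends := aends) (reflArrowEquiv s hσ ht) (reflVert_injective s hσ)
    fun e ↦ Or.inl (aends_reflArrow s ht e), matchingSum_map (ends := lat.ends) arrowEquiv
    pos_injective fun e ↦ Or.inl (aends_arrow e), map_dragonProd, ← laurent_single,
    ← laurent_single, ← laurent_single, AddChar.map_add_eq_mul, mul_assoc]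
  refine hμ.trans ?_
  have e0 : squareExp (t - 1 - 2) = squareExp 0 := by rcases ht' with rfl | rfl <;> rfl
  have e1 : squareExp (t - 1 - 1) = squareExp 1 := by rcases ht' with rfl | rfl <;> rfl
  have e2 : squareExp (t - 1 - 0) = squareExp 2 := by rcases ht' with rfl | rfl <;> rfl
  rw [e0, e1, e2, hμ']
  rfl

/-! ### The shapes of the diamonds -/

/-- A subgraph contains all edges between the vertices of a region if it contains one of the two
squares at each of them. -/
lemma eq_plane {G : dP3.Subgraph} {V : Set (ℤ × ℤ)} (hV : GoodPlaneRegion V) (hG : G ≤ plane V)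
    (h : ∀ e, (aends e).1 ∈ V → (aends e).2 ∈ V → square e.source ≤ G ∨ square e.target ≤ G) :
    G = plane V := by
  have hsrc : ∀ (e : Arrow) (v : ℤ × ℤ), v ∈ e.edge →
      v ∈ squareVerts e.source ∧ v ∈ squareVerts e.target := by
    rintro (⟨A, k⟩ | ⟨A, k⟩) v hv
    · rcases mem_edge.1 hv with rfl | rfl <;>
        simp [aends, Arrow.source, Arrow.target, squareVerts]
    · have h1 : corner (A + dir k) (k + 2) = corner A k := by
        have h2 : ∀ k : ZMod 6, (6 : ℤ) • dir k + (2 : ℤ) • (dir (k + 2) + dir (k + 2 + 1)) =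
          (2 : ℤ) • (dir k + dir (k + 1)) := by decide
        rw [corner, corner, smul_add, add_assoc, h2]
      have h3 : mid (A + dir k) (k + 2 + 1) = mid A k := by
        rw [show k + 2 + 1 = k + 3 by ring, mid_add_dir]
      rcases mem_edge.1 hv with rfl | rfl <;>
        simp [aends, Arrow.source, Arrow.target, squareVerts, h1, h3]
  have hcov : ∀ e, (aends e).1 ∈ V → (aends e).2 ∈ V → ∃ q, square q ≤ G ∧
      (aends e).1 ∈ squareVerts q ∧ (aends e).2 ∈ squareVerts q := by
    intro e h1 h2
    have h3 := hsrc e _ (mem_edge.2 (Or.inl rfl))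
    have h4 := hsrc e _ (mem_edge.2 (Or.inr rfl))
    rcases h e h1 h2 with h5 | h5
    exacts [⟨_, h5, h3.1, h4.1⟩, ⟨_, h5, h3.2, h4.2⟩]
  refine le_antisymm hG ⟨fun v hv ↦ ?_, fun u v huv ↦ ?_⟩
  · obtain ⟨F, -, hF, -⟩ := hV.ref
    obtain ⟨e, he, hev⟩ := hF.exists_inc hv
    obtain ⟨q, hq, h1, h2⟩ := hcov e (hF.mem_of_inc he (Or.inl rfl)) (hF.mem_of_inc he (Or.inr rfl))
    rcases hev with rfl | rfl
    exacts [hq.1 h1, hq.1 h2]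
  · obtain ⟨hu, hv, hadj⟩ := huv
    obtain ⟨e, he⟩ := adj_iff.1 hadj
    have hmem : ∀ w ∈ e.edge, w ∈ V := by
      rw [he]
      intro w hw
      rcases Sym2.mem_iff.1 hw with rfl | rfl <;> assumption
    obtain ⟨q, hq, h1, h2⟩ := hcov e (hmem _ (mem_edge.2 (Or.inl rfl)))
      (hmem _ (mem_edge.2 (Or.inr rfl)))
    rw [edge_eq, Sym2.eq_iff] at he
    rcases he with ⟨h3, h4⟩ | ⟨h3, h4⟩ <;> rw [h3] at h1 <;> rw [h4] at h2
    exacts [hq.2 ⟨h1, h2, hadj⟩, hq.2 ⟨h2, h1, hadj⟩]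

/-- The positions of the `D₁`s of North type in the region with the parameters `p` and `r`. -/
def NorthPos (p r x y : ℤ) : Prop := (0 ≤ y ∧ 1 ≤ x ∧ x + y ≤ r) ∨ (y < 0 ∧ x ≤ p - 1 ∧ 1 ≤ x + y)

/-- The positions of the `D₁`s of South type in the region with the parameters `p` and `r`. -/
def SouthPos (p r x y : ℤ) : Prop := (1 ≤ y ∧ 1 ≤ x ∧ x + y ≤ r) ∨ (y ≤ 0 ∧ x ≤ p - 1 ∧ 1 ≤ x + y)

/-- The faces in the `D₁`s of a region, with the two additional faces at the eastern end of row `0`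
if `p = r + 1`. -/
def tileFaces (p r : ℤ) : LFace → Prop
  | .n x y => NorthPos p r x y
  | .s x y => SouthPos p r x y
  | .nw x y => NorthPos p r x y ∨ SouthPos p r (x - 1) (y + 1) ∨ (p = r + 1 ∧ x = p ∧ y = 0)
  | .se x y => SouthPos p r x y ∨ NorthPos p r (x + 1) (y - 1)
  | .ne x y => p = r + 1 ∧ x = r ∧ y = 0
  | .sw _ _ => False

section

variable {p r : ℤ}

/-- The faces in `tileFaces` are contained in the region. -/
lemma lverts_subset_of_tileFaces (hr : 0 ≤ r) (hp : r ≤ p) (hp' : p ≤ r + 1)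
    (hr' : p = r + 1 → 1 ≤ r) {f : LFace} (hf : tileFaces p r f) : lverts f ⊆ region p r := by
  have hp0 : 0 ≤ p := hr.trans hp
  rcases f with ⟨x, y⟩ | ⟨x, y⟩ | ⟨x, y⟩ | ⟨x, y⟩ | ⟨x, y⟩ | ⟨x, y⟩ <;>
  simp only [tileFaces, NorthPos, SouthPos] at hf <;>
  simp only [lverts, Set.insert_subset_iff, Set.singleton_subset_iff, Finset.mem_coe,
    mem_region_tf hp0 hr, mem_region_tt hp0 hr, mem_region_qf hp0 hr,
    mem_region_qt hp0 hr, mem_region_p hp0 hr, mem_region_d hp0 hr] <;> omega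

/-- Every edge in the region belongs to a face in `tileFaces`. -/
lemma tileFaces_of_inside (hr : 0 ≤ r) (hp : r ≤ p) (hp' : p ≤ r + 1) (e : LEdge)
    (h1 : (lat.ends e).1 ∈ region p r) (h2 : (lat.ends e).2 ∈ region p r) :
    tileFaces p r (lsrc e) ∨ tileFaces p r (ltgt e) := by
  have hp0 : 0 ≤ p := hr.trans hp
  rcases e with ⟨⟨_ | _, x, y⟩, _ | ⟨_ | _, _ | _⟩⟩ | ⟨_ | _, x, y⟩ <;>
  simp only [lat, CellGraph.ends, Bool.false_eq_true, if_true, if_false, mem_region_tf hp0 hr,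
    mem_region_tt hp0 hr, mem_region_qf hp0 hr, mem_region_qt hp0 hr, mem_region_p hp0 hr,
    mem_region_d hp0 hr] at h1 h2 <;>
  simp only [lsrc, ltgt, tileFaces, NorthPos, SouthPos] <;> omega

lemma eq_plane_image {G : dP3.Subgraph} (hr : 0 ≤ r) (hp : r ≤ p) (hp' : p ≤ r + 1)
    (hG : G ≤ plane (pos '' region p r))
    (h : ∀ f, tileFaces p r f → square (toSquare f) ≤ G) : G = plane (pos '' region p r) := by
  refine eq_plane (goodPlaneRegion_image hr hp hp') hG fun e h1 h2 ↦ ?_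
  obtain ⟨e, rfl⟩ := arrow_bijective.2 e
  rw [aends_arrow, Prod.map_fst, Prod.map_snd, pos_injective.mem_set_image] at *
  rw [source_arrow, target_arrow]
  exact (tileFaces_of_inside hr hp hp' e h1 h2).imp (h _) (h _)

lemma eq_plane_reflect {G : dP3.Subgraph} (hr : 0 ≤ r) (hp : r ≤ p) (hp' : p ≤ r + 1)
    {σ : ℤ × ℤ →+ ℤ × ℤ} {t : ZMod 6}
    (s : ℤ × ℤ) (hσ : ∀ A, σ (σ A) = A) (ht : ∀ k, σ (dir k) = dir (t - k))
    (hG : G ≤ plane (reflVert σ s '' (pos '' region p r)))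
    (h : ∀ f, tileFaces p r f → square (reflSquare σ t s (toSquare f)) ≤ G) :
    G = plane (reflVert σ s '' (pos '' region p r)) := by
  refine eq_plane ((goodPlaneRegion_image hr hp hp').reflect s hσ ht) hG fun e h1 h2 ↦ ?_
  obtain ⟨e, rfl⟩ := (reflArrowEquiv s hσ ht).surjective e
  obtain ⟨e, rfl⟩ := arrow_bijective.2 e
  change (aends (reflArrow σ t s _)).1 ∈ _ at h1
  change (aends (reflArrow σ t s _)).2 ∈ _ at h2
  rw [aends_reflArrow s ht, Prod.map_fst, (reflVert_injective s hσ).mem_set_image, aends_arrow,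
    Prod.map_fst, pos_injective.mem_set_image] at h1
  rw [aends_reflArrow s ht, Prod.map_snd, (reflVert_injective s hσ).mem_set_image, aends_arrow,
    Prod.map_snd, pos_injective.mem_set_image] at h2
  change square (reflArrow σ t s _).source ≤ G ∨ square (reflArrow σ t s _).target ≤ G
  rw [source_reflArrow, target_reflArrow s ht, source_arrow, target_arrow, or_comm]
  exact (tileFaces_of_inside hr hp hp' e h1 h2).imp (h _) (h _)

lemma square_toSquare_le (hr : 0 ≤ r) (hp : r ≤ p) (hp' : p ≤ r + 1) (hr' : p = r + 1 → 1 ≤ r)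
    {f : LFace} (hf : tileFaces p r f) : square (toSquare f) ≤ plane (pos '' region p r) := by
  rw [square_le_iff, squareVerts_toSquare]
  exact Set.image_mono (lverts_subset_of_tileFaces hr hp hp' hr' hf)

lemma square_reflSquare_le (hr : 0 ≤ r) (hp : r ≤ p) (hp' : p ≤ r + 1) (hr' : p = r + 1 → 1 ≤ r)
    {σ : ℤ × ℤ →+ ℤ × ℤ} {t : ZMod 6} (s : ℤ × ℤ) (ht : ∀ k, σ (dir k) = dir (t - k))
    {f : LFace} (hf : tileFaces p r f) :
    square (reflSquare σ t s (toSquare f)) ≤ plane (reflVert σ s '' (pos '' region p r)) := by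
  rw [square_le_iff, squareVerts_reflSquare s ht, squareVerts_toSquare]
  exact Set.image_mono (Set.image_mono (lverts_subset_of_tileFaces hr hp hp' hr' hf))

end

/-! #### Integer order -/

lemma northD1_eq (x y : ℤ) : northD1 (x, y) = square (toSquare (.n x y)) ⊔
    square (toSquare (.nw x y)) ⊔ square (toSquare (.se (x - 1) (y + 1))) := by
  simp only [northD1, toSquare, dir2, Prod.mk_add_mk, ← sub_eq_add_neg]

lemma southD1_eq (x y : ℤ) : southD1 (x, y) = square (toSquare (.s x y)) ⊔
    square (toSquare (.se x y)) ⊔ square (toSquare (.nw (x + 1) (y - 1))) := by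
  simp only [southD1, toSquare, dir5, Prod.mk_add_mk, ← sub_eq_add_neg]

/-- The diamonds of integer order are induced subgraphs, on regions in standard position. -/
theorem diamond_eq (n : ℕ) : diamond n = plane (pos '' region n n) := by
  have hN : ∀ x y, NorthPos n n x y → northD1 (x, y) ≤ diamond n := by
    intro x y h
    have h1 : |2 * x + y - (n + 1) + if y < 0 then 1 else 0| + |y| < n := by
      unfold NorthPos at h
      rw [abs_eq_max_neg, abs_eq_max_neg]
      split_ifs <;> omega
    refine le_trans (le_of_eq ?_) (le_iSup_of_le (2 * x + y - (n + 1) + if y < 0 then 1 else 0)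
      (le_iSup_of_le y (le_iSup_of_le h1 le_rfl)))
    have e : (n + 1 : ℤ) + (2 * x + y - (n + 1) + if y < 0 then 1 else 0) -
        (if y < 0 then 1 else 0) - y = 2 * x := by ring
    rw [tile, stripD1, e, if_pos (even_two_mul x), Int.mul_ediv_cancel_left _ (by norm_num)]
  have hS : ∀ x y, SouthPos n n x y → southD1 (x, y) ≤ diamond n := by
    intro x y h
    have h1 : |2 * x + y - (n + 1) + if y - 1 < 0 then 1 else 0| + |y - 1| < n := by
      unfold SouthPos at h
      rw [abs_eq_max_neg, abs_eq_max_neg]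
      split_ifs <;> omega
    refine le_trans (le_of_eq ?_) (le_iSup_of_le (2 * x + y - (n + 1) + if y - 1 < 0 then 1 else 0)
      (le_iSup_of_le (y - 1) (le_iSup_of_le h1 le_rfl)))
    have e : (n + 1 : ℤ) + (2 * x + y - (n + 1) + if y - 1 < 0 then 1 else 0) -
        (if y - 1 < 0 then 1 else 0) - (y - 1) = 2 * x + 1 := by ring
    have e' : (2 * x + 1) / 2 = x := by omega
    rw [tile, stripD1, e, if_neg (Int.not_even_two_mul_add_one x), e', sub_add_cancel]
  refine eq_plane_image (by omega) le_rfl (by omega) ?_ ?_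
  · refine iSup_le fun i ↦ iSup_le fun j ↦ iSup_le fun hij ↦ ?_
    have hle := fun f ↦ square_toSquare_le (p := n) (r := n) (by omega) le_rfl (by omega) (by omega)
      (f := f)
    rw [abs_eq_max_neg, abs_eq_max_neg] at hij
    rw [tile, stripD1]
    set z : ℤ := n + 1 + i - (if j < 0 then 1 else 0) - j with hz
    by_cases he : Even z
    · rw [if_pos he, northD1_eq]
      obtain ⟨a, ha⟩ := even_iff_two_dvd.1 he
      have e : z / 2 = a := by omega
      have h1 : NorthPos n n a j := by unfold NorthPos; split_ifs at hz <;> omega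
      rw [e]
      refine sup_le (sup_le (hle _ h1) (hle _ (Or.inl h1))) (hle _ (Or.inr ?_))
      rwa [sub_add_cancel, add_sub_cancel_right]
    · rw [if_neg he, southD1_eq]
      obtain ⟨a, ha⟩ := Int.not_even_iff_odd.1 he
      have e : z / 2 = a := by omega
      have h1 : SouthPos n n a (j + 1) := by unfold SouthPos; split_ifs at hz <;> omega
      rw [e]
      refine sup_le (sup_le (hle _ h1) (hle _ (Or.inl h1))) (hle _ (Or.inr (Or.inl ?_)))
      rwa [add_sub_cancel_right, sub_add_cancel]
  · rintro (⟨x, y⟩ | ⟨x, y⟩ | ⟨x, y⟩ | ⟨x, y⟩ | ⟨x, y⟩ | ⟨x, y⟩) hf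
    · simp only [tileFaces] at hf; omega
    · refine le_trans ?_ (hN x y hf)
      rw [northD1_eq]
      exact le_sup_of_le_left le_sup_left
    · rcases hf with hf | hf | hf
      · refine le_trans ?_ (hN x y hf)
        rw [northD1_eq]
        exact le_sup_of_le_left le_sup_right
      · refine le_trans ?_ (hS _ _ hf)
        rw [southD1_eq, sub_add_cancel, add_sub_cancel_right]
        exact le_sup_right
      · omega
    · exact hf.elim
    · refine le_trans ?_ (hS x y hf)
      rw [southD1_eq]
      exact le_sup_of_le_left le_sup_left
    · rcases hf with hf | hf
      · refine le_trans ?_ (hS x y hf)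
        rw [southD1_eq]
        exact le_sup_of_le_left le_sup_right
      · refine le_trans ?_ (hN _ _ hf)
        rw [northD1_eq, sub_add_cancel, add_sub_cancel_right]
        exact le_sup_right

/-! #### Half-integer order -/

/-- The linear part of the reflection in a row of hexagons. -/
def flipRow : ℤ × ℤ →+ ℤ × ℤ where
  toFun A := (A.1 + A.2, -A.2)
  map_zero' := by simp
  map_add' A B := by
    ext <;> simp <;> ring

lemma flipRow_flipRow (A : ℤ × ℤ) : flipRow (flipRow A) = A := by ext <;> simp [flipRow]

lemma flipRow_dir (k : ZMod 6) : flipRow (dir k) = dir (0 - k) := by revert k; decide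

/-- The linear part of the reflection in a column of hexagons. -/
def flipColumn : ℤ × ℤ →+ ℤ × ℤ where
  toFun A := (-A.1 - A.2, A.2)
  map_zero' := by simp
  map_add' A B := by
    ext <;> simp
    ring

lemma flipColumn_flipColumn (A : ℤ × ℤ) : flipColumn (flipColumn A) = A := by
  ext <;> simp [flipColumn]

lemma flipColumn_dir (k : ZMod 6) : flipColumn (dir k) = dir (3 - k) := by revert k; decide

lemma northD1'_eq (x y : ℤ) : northD1' (x + y - 1, 1 - y) =
    square (reflSquare flipRow 0 (-1, 1) (toSquare (.s x y))) ⊔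
    square (reflSquare flipRow 0 (-1, 1) (toSquare (.se x y))) ⊔
    square (reflSquare flipRow 0 (-1, 1) (toSquare (.nw (x + 1) (y - 1)))) := by
  have e1 : flipRow (x, y) + (-1, 1) = (x + y - 1, 1 - y) := by ext <;> simp [flipRow] <;> ring
  have e2 : flipRow (x + 1, y - 1) + (-1, 1) = (x + y - 1, 1 - y) + dir 1 := by
    ext <;> simp [flipRow, dir1] <;> ring
  simp only [northD1', toSquare, reflSquare, e1, e2]
  rfl

lemma southD1'_eq (x y : ℤ) : southD1' (x + y - 1, 1 - y) =
    square (reflSquare flipRow 0 (-1, 1) (toSquare (.n x y))) ⊔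
    square (reflSquare flipRow 0 (-1, 1) (toSquare (.nw x y))) ⊔
    square (reflSquare flipRow 0 (-1, 1) (toSquare (.se (x - 1) (y + 1)))) := by
  have e1 : flipRow (x, y) + (-1, 1) = (x + y - 1, 1 - y) := by ext <;> simp [flipRow] <;> ring
  have e2 : flipRow (x - 1, y + 1) + (-1, 1) = (x + y - 1, 1 - y) + dir 4 := by
    ext <;> simp [flipRow, dir4] <;> ring
  simp only [southD1', toSquare, reflSquare, e1, e2]
  rfl

lemma leftSquare_eq (n : ℕ) :
    leftSquare n = square (reflSquare flipRow 0 (-1, 1) (toSquare (.ne n 0))) := by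
  have e : flipRow ((n : ℤ), 0) + (-1, 1) = ((n : ℤ) - 1, 1) := by
    ext <;> simp [flipRow]
    ring
  simp only [leftSquare, toSquare, reflSquare, e]
  rfl

lemma rightSquare_eq (n : ℕ) :
    rightSquare n = square (reflSquare flipRow 0 (-1, 1) (toSquare (.nw (n + 1) 0))) := by
  have e : flipRow ((n : ℤ) + 1, 0) + (-1, 1) = ((n : ℤ), 1) := by
    ext <;> simp [flipRow]
  simp only [rightSquare, toSquare, reflSquare, e]
  rfl

/-- The diamonds of half-integer order are the images of regions under a glide reflection along a
line halfway between two rows of hexagons. -/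
theorem halfDiamond_succ_eq (n : ℕ) : halfDiamond (n + 1) =
    plane (reflVert flipRow (-1, 1) '' (pos '' region ((n + 1 : ℕ) + 1) (n + 1 : ℕ))) := by
  rw [halfDiamond]
  set N : ℕ := n + 1 with hN0
  have hNpos : 1 ≤ N := by omega
  set G₁ : dP3.Subgraph := ⨆ (i : ℤ) (j : ℤ) (_ : |i| + |j| < N), halfTile N i j with hG₁
  set G₂ : dP3.Subgraph := ⨆ (i : ℤ) (j : ℤ) (_ : 0 < j ∧ j ≤ N ∧ |i| < N + 1 - j), halfTile N i j
    with hG₂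
  have h₁ : ∀ i j : ℤ, |i| + |j| < N → halfTile N i j ≤ G₁ := fun i j h ↦
    le_iSup_of_le i (le_iSup_of_le j (le_iSup_of_le h le_rfl))
  have h₂ : ∀ i j : ℤ, 0 < j ∧ j ≤ N ∧ |i| < N + 1 - j → halfTile N i j ≤ G₂ := fun i j h ↦
    le_iSup_of_le i (le_iSup_of_le j (le_iSup_of_le h le_rfl))
  have h₁₂ : ∀ i j : ℤ, |i| + |j| < N ∨ (0 < j ∧ j ≤ N ∧ |i| < N + 1 - j) →
      halfTile N i j ≤ G₁ ⊔ G₂ := by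
    rintro i j (h | h)
    exacts [(h₁ i j h).trans le_sup_left, (h₂ i j h).trans le_sup_right]
  have hN : ∀ x y, NorthPos (N + 1) N x y → southD1' (x + y - 1, 1 - y) ≤ G₁ ⊔ G₂ := by
    intro x y h
    refine le_trans (le_of_eq ?_) (h₁₂ (2 * x + y - 1 - N) (-y) ?_)
    · have e : (N : ℤ) + (2 * x + y - 1 - N) - -y = 2 * (x + y - 1) + 1 := by ring
      have e' : (2 * (x + y - 1) + 1) / 2 = x + y - 1 := by omega
      rw [halfTile, stripD1', e, if_neg (Int.not_even_two_mul_add_one _), e', neg_add_eq_sub]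
    · unfold NorthPos at h
      simp only [abs_eq_max_neg]
      omega
  have hS : ∀ x y, SouthPos (N + 1) N x y → northD1' (x + y - 1, 1 - y) ≤ G₁ ⊔ G₂ := by
    intro x y h
    refine le_trans (le_of_eq ?_) (h₁₂ (2 * x + y - 1 - N) (1 - y) ?_)
    · have e : (N : ℤ) + (2 * x + y - 1 - N) - (1 - y) = 2 * (x + y - 1) := by ring
      rw [halfTile, stripD1', e, if_pos (even_two_mul _), Int.mul_ediv_cancel_left _ (by norm_num)]
    · unfold SouthPos at h
      simp only [abs_eq_max_neg]
      omega
  have hle := fun f ↦ square_reflSquare_le (p := N + 1) (r := N) (by omega) (by omega) (by omega)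
    (by omega) (-1, 1) flipRow_dir (f := f)
  have htile : ∀ i j : ℤ, |i| + |j| < N ∨ (0 < j ∧ j ≤ N ∧ |i| < N + 1 - j) → halfTile N i j ≤
      plane (reflVert flipRow (-1, 1) '' (pos '' region ((N : ℤ) + 1) N)) := by
    intro i j hij
    simp only [abs_eq_max_neg] at hij
    rw [halfTile, stripD1']
    by_cases he : Even ((N : ℤ) + i - j)
    · obtain ⟨a, ha⟩ := even_iff_two_dvd.1 he
      have e : ((N : ℤ) + i - j) / 2 = (a + j) + (1 - j) - 1 := by omega
      have e' : j = 1 - (1 - j) := by ring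
      have h1 : SouthPos (N + 1) N (a + j) (1 - j) := by unfold SouthPos; omega
      rw [if_pos he, e]
      nth_rewrite 3 [e']
      rw [northD1'_eq]
      refine sup_le (sup_le (hle _ h1) (hle _ (Or.inl h1))) (hle _ (Or.inr (Or.inl ?_)))
      rwa [add_sub_cancel_right, sub_add_cancel]
    · obtain ⟨a, ha⟩ := Int.not_even_iff_odd.1 he
      have e : ((N : ℤ) + i - j) / 2 = (a + j + 1) + (-j) - 1 := by omega
      have e' : j + 1 = 1 - -j := by ring
      have h1 : NorthPos (N + 1) N (a + j + 1) (-j) := by unfold NorthPos; omega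
      rw [if_neg he, e, e', southD1'_eq]
      refine sup_le (sup_le (hle _ h1) (hle _ (Or.inl h1))) (hle _ (Or.inr ?_))
      rwa [sub_add_cancel, add_sub_cancel_right]
  refine eq_plane_reflect (by omega) (by omega) (by omega) (-1, 1) flipRow_flipRow flipRow_dir ?_ ?_
  · refine sup_le (sup_le (sup_le ?_ ?_) ?_) ?_
    · exact iSup_le fun i ↦ iSup_le fun j ↦ iSup_le fun hij ↦ htile i j (Or.inl hij)
    · exact iSup_le fun i ↦ iSup_le fun j ↦ iSup_le fun hij ↦ htile i j (Or.inr hij)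
    · rw [leftSquare_eq]
      exact hle _ ⟨rfl, rfl, rfl⟩
    · rw [rightSquare_eq]
      exact hle _ (Or.inr (Or.inr ⟨rfl, rfl, rfl⟩))
  · rw [sup_assoc]
    rintro (⟨x, y⟩ | ⟨x, y⟩ | ⟨x, y⟩ | ⟨x, y⟩ | ⟨x, y⟩ | ⟨x, y⟩) hf
    · obtain ⟨-, rfl, rfl⟩ := hf
      rw [← leftSquare_eq]
      exact le_sup_of_le_right le_sup_left
    · refine le_sup_of_le_left (le_trans ?_ (hN x y hf))
      rw [southD1'_eq]
      exact le_sup_of_le_left le_sup_left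
    · rcases hf with hf | hf | hf
      · refine le_sup_of_le_left (le_trans ?_ (hN x y hf))
        rw [southD1'_eq]
        exact le_sup_of_le_left le_sup_right
      · refine le_sup_of_le_left (le_trans ?_ (hS _ _ hf))
        rw [northD1'_eq, sub_add_cancel, add_sub_cancel_right]
        exact le_sup_right
      · obtain ⟨-, rfl, rfl⟩ := hf
        rw [← rightSquare_eq]
        exact le_sup_of_le_right le_sup_right
    · exact hf.elim
    · refine le_sup_of_le_left (le_trans ?_ (hS x y hf))
      rw [northD1'_eq]
      exact le_sup_of_le_left le_sup_left
    · rcases hf with hf | hf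
      · refine le_sup_of_le_left (le_trans ?_ (hS x y hf))
        rw [northD1'_eq]
        exact le_sup_of_le_left le_sup_right
      · refine le_sup_of_le_left (le_trans ?_ (hN _ _ hf))
        rw [southD1'_eq, sub_add_cancel, add_sub_cancel_right]
        exact le_sup_right

lemma region_one_zero : (region 1 0 : Set LVert) = lverts (.nw 1 0) := by
  ext v
  rw [Finset.mem_coe]
  rcases v with ⟨_ | _, x, y⟩ | ⟨_ | _, x, y⟩ | ⟨x, y⟩ | ⟨x, y⟩ <;>
  simp [lverts, mem_region_tf, mem_region_tt, mem_region_qf, mem_region_qt, mem_region_p,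
    mem_region_d] <;> omega

/-- The single NE square is the reflection of a NW square in a vertical axis. -/
theorem halfDiamond_zero_eq :
    halfDiamond 0 = plane (reflVert flipColumn (1, 0) '' (pos '' region 1 0)) := by
  rw [region_one_zero, ← squareVerts_toSquare, ← squareVerts_reflSquare (1, 0) flipColumn_dir]
  rfl

lemma dragonProd_two_mul {R : Type*} [CommSemiring R] (n : ℕ) (a b c : R) :
    dragonProd (2 * n) c b a = ∏ i ∈ Finset.range n,
      ((1 + a ^ i * b ^ i * c ^ (i + 1)) ^ (n - i) *
        (1 + a ^ i * b ^ (i + 1) * c ^ (i + 1)) ^ (n - i)) := by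
  have e1 : (2 * n + 1) / 2 = n := by omega
  have e2 : 2 * n / 2 = n := by omega
  rw [dragonProd, e1, e2, Finset.prod_mul_distrib]
  congr 1 <;> refine Finset.prod_congr rfl fun i _ ↦ ?_ <;> congr 2 <;> ring

lemma dragonProd_two_mul_add_one {R : Type*} [CommSemiring R] (n : ℕ) (a b c : R) :
    dragonProd (2 * n + 1) a b c =
      (∏ i ∈ Finset.range (n + 1), (1 + a ^ (i + 1) * b ^ i * c ^ i) ^ (n - i + 1)) *
        ∏ i ∈ Finset.range n, (1 + a ^ (i + 1) * b ^ (i + 1) * c ^ i) ^ (n - i) := by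
  have e1 : (2 * n + 1 + 1) / 2 = n + 1 := by omega
  have e2 : (2 * n + 1) / 2 = n := by omega
  rw [dragonProd, e1, e2]
  congr 1
  refine Finset.prod_congr rfl fun i hi ↦ ?_
  rw [Finset.mem_range] at hi
  rw [show n + 1 - i = n - i + 1 by omega]

end DP3

theorem mainTheorem2 (n : ℕ) (a b c : MvPolynomial (Fin 3) ℤ)
    (ha : a = MvPolynomial.X 0) (hb : b = MvPolynomial.X 1) (hc : c = MvPolynomial.X 2) :
    (∀ o : DP3.Square, DP3.IsOuterFace (DP3.diamond n) o →
      DP3.genFun (DP3.diamond n) o =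
        ∏ i ∈ Finset.range n,
          ((1 + a ^ i * b ^ i * c ^ (i + 1)) ^ (n - i) *
            (1 + a ^ i * b ^ (i + 1) * c ^ (i + 1)) ^ (n - i))) ∧
    (∀ o : DP3.Square, DP3.IsOuterFace (DP3.halfDiamond n) o →
      DP3.genFun (DP3.halfDiamond n) o =
        (∏ i ∈ Finset.range (n + 1), (1 + a ^ (i + 1) * b ^ i * c ^ i) ^ (n - i + 1)) *
          ∏ i ∈ Finset.range n, (1 + a ^ (i + 1) * b ^ (i + 1) * c ^ i) ^ (n - i)) := by
  subst ha hb hc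
  constructor
  · intro o ho
    have e1 : (2 * n + 1) / 2 = n := by omega
    have e2 : 2 * n / 2 = n := by omega
    have h := DP3.genFun_region (2 * n) (o := o)
    rw [e1, e2, ← DP3.diamond_eq] at h
    rw [h ho, DP3.dragonProd_two_mul]
  · intro o ho
    have e1 : (2 * n + 1 + 1) / 2 = n + 1 := by omega
    have e2 : (2 * n + 1) / 2 = n := by omega
    have h : DP3.genFun (DP3.halfDiamond n) o =
        DP3.dragonProd (2 * n + 1) (.X 0) (.X 1) (.X 2) := by
      rcases n with _ | n
      · have h := DP3.genFun_region_reflect 1 (1, 0) DP3.flipColumn_flipColumn DP3.flipColumn_dir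
          (Or.inr rfl) (o := o)
        norm_num at h
        rw [← DP3.halfDiamond_zero_eq] at h
        exact h ho
      · have h := DP3.genFun_region_reflect (2 * (n + 1) + 1) (-1, 1) DP3.flipRow_flipRow
          DP3.flipRow_dir (Or.inl rfl) (o := o)
        rw [e1, e2, Nat.cast_add (n + 1) 1, Nat.cast_one, ← DP3.halfDiamond_succ_eq] at h
        exact h ho
    rw [h, DP3.dragonProd_two_mul_add_one]
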